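/- Let $D=\{z\in\mathbb C:|z|<1\}$, let $G$ be the topological group of Möbius transformations $z\mapsto\frac{az+\bar c}{cz+\bar a}$ with $a\bar a-c\bar c=1$ (acting on $D$ and on the circle $S^1$), let $K\subset G$ be the subgroup of rotations, and let $L^\infty(G)$ be the space of classes of real-valued essentially bounded functions with respect to Haar measure, with the weak$^*$ topology as the dual of $L^1(G)$ and with the action ${}^{g'}\!F(g)=F(gg')$ of $G$. An *affine dynamical system* $(Q,G)$ is a nonempty compact convex metrizable subset $Q$ of a Hausdorff locally convex real topological vector space with a jointly continuous action of $G$ on $Q$ by affine maps. It is *nontrivial* if $Q$ has more than one point, and *irreducible* if every nonempty closed convex $G$-invariant $Q'\subseteq Q$ equals $Q$. An affine homomorphism is a continuous $G$-equivariant map that preserves convex combinations; an isomorphism is a bijective one with inverse of the same kind. An affine subsystem of $L^\infty(G)$ is a subset $Q$ of $L^\infty(G)$ that is an affine dynamical system under the given action and topology. $M(S^1)$ is the space of Borel probability measures on $S^1$ with the weak$^*$ topology inherited from $C(S^1)^*$ and the push-forward action. For a bounded harmonic function $h:D\to\mathbb R$ let $\tilde h\in L^\infty(G)$, $\tilde h(g)=h(g(0))$,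 be its lift and let $Q_h$ be the weak$^*$-closed convex hull of $\{{}^{g}\tilde h:g\in G\}$. **Theorem.** The map $h\mapsto Q_h$ is a bijection from the set of non-constant bounded harmonic functions on $D$ onto the set of nontrivial irreducible affine subsystems of $L^\infty(G)$. For every non-constant bounded harmonic $h$, the lift $\tilde h$ is the unique element $F\in Q_h$ with ${}^{k}F=F$ for all $k\in K$. Moreover every such $(Q_h,G)$ is isomorphic to the affine system $(M(S^1),G)$, which is the universal irreducible affine system of $G$: it is irreducible, and for every irreducible affine system $(P,G)$ there is exactly one affine homomorphism $M(S^1)\to P$, and this homomorphism is surjective. -/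

import Mathlib

universe u

open MeasureTheory Topology Complex
open scoped ENNReal Complex.UnitDisc ComplexConjugate

noncomputable section

namespace MobiusDisc

/-! ### The group of Möbius transformations of the unit disc -/

/-- The matrices `!![a, conj c; c, conj a]` with `a * conj a - c * conj c = 1`. -/
def su11 : Subgroup (Matrix.SpecialLinearGroup (Fin 2) ℂ) where
  carrier := {A | A.1 1 1 = conj (A.1 0 0) ∧ A.1 0 1 = conj (A.1 1 0)}
  one_mem' := by simp
  mul_mem' := by
    rintro A B ⟨hA1, hA2⟩ ⟨hB1, hB2⟩
    simp only [Set.mem_ofPred_eq, Matrix.SpecialLinearGroup.coe_mul, Matrix.mul_apply,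
      Fin.sum_univ_two, hA1, hA2, hB1, hB2, map_add, map_mul, conj_conj]
    constructor <;> ring
  inv_mem' := by
    rintro A ⟨hA1, hA2⟩
    rw [Matrix.SpecialLinearGroup.SL2_inv_expl]
    change A.1 0 0 = conj (A.1 1 1) ∧ -A.1 0 1 = conj (-A.1 1 0)
    simp [hA1, hA2]

/-- The group `SU(1,1)`. -/
abbrev SU11 : Type := su11

namespace SU11

/-- The entry `a` of `!![a, conj c; c, conj a]`. -/
def a (A : SU11) : ℂ := A.1.1 0 0

/-- The entry `c` of `!![a, conj c; c, conj a]`. -/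
def c (A : SU11) : ℂ := A.1.1 1 0

lemma entry11 (A : SU11) : A.1.1 1 1 = conj A.a := A.2.1

lemma entry01 (A : SU11) : A.1.1 0 1 = conj A.c := A.2.2

lemma det_eq (A : SU11) : A.a * conj A.a - A.c * conj A.c = 1 := by
  have h := A.1.2
  rw [Matrix.det_fin_two, entry11, entry01] at h
  rw [← h, a, c]; ring

lemma normSq_eq (A : SU11) : normSq A.a - normSq A.c = 1 := by
  have h := A.det_eq
  rw [mul_conj, mul_conj] at h
  exact_mod_cast h

lemma a_mul (A B : SU11) : (A * B).a = A.a * B.a + conj A.c * B.c := by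
  rw [← entry01]
  simp [a, c, Matrix.mul_apply]

lemma c_mul (A B : SU11) : (A * B).c = A.c * B.a + conj A.a * B.c := by
  rw [← entry11]
  simp [a, c, Matrix.mul_apply]

@[simp] lemma a_one : (1 : SU11).a = 1 := by simp [a]

@[simp] lemma c_one : (1 : SU11).c = 0 := by simp [c]

lemma ext_ac {A B : SU11} (ha : A.a = B.a) (hc : A.c = B.c) : A = B := by
  apply Subtype.ext
  apply Subtype.ext
  ext i j
  fin_cases i <;> fin_cases j
  · exact ha
  · simpa [entry01] using congrArg conj hc
  · exact hc
  · simpa [entry11] using congrArg conj ha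

/-- The Möbius formula `z ↦ (a z + conj c) / (c z + conj a)`. -/
def moeb (A : SU11) (z : ℂ) : ℂ := (A.a * z + conj A.c) / (A.c * z + conj A.a)

lemma normSq_sub (A : SU11) (z : ℂ) :
    normSq (A.c * z + conj A.a) - normSq (A.a * z + conj A.c) = 1 - normSq z := by
  have h := A.normSq_eq
  simp only [normSq_apply, add_re, add_im, mul_re, mul_im, conj_re, conj_im] at h ⊢
  linear_combination (1 - (z.re * z.re + z.im * z.im)) * h

lemma denom_ne_zero (A : SU11) {z : ℂ} (hz : ‖z‖ ≤ 1) : A.c * z + conj A.a ≠ 0 := by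
  intro h0
  have h := A.normSq_eq
  have h1 : normSq (A.c * z) = normSq (conj A.a) := by
    rw [eq_neg_of_add_eq_zero_left h0, normSq_neg]
  rw [normSq_mul, normSq_conj] at h1
  have h2 : normSq z ≤ 1 := by
    rw [normSq_eq_norm_sq]; nlinarith [norm_nonneg z]
  nlinarith [normSq_nonneg A.c]

lemma moeb_one (z : ℂ) : moeb 1 z = z := by simp [moeb]

lemma moeb_mul (A B : SU11) {z : ℂ} (hz : ‖z‖ ≤ 1) :
    moeb (A * B) z = moeb A (moeb B z) := by
  have hB := B.denom_ne_zero hz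
  have key : ∀ p q r s x : ℂ, x ≠ 0 → (p * (r / x) + q) / (s * (r / x) + conj p)
      = (p * r + q * x) / (s * r + conj p * x) := by
    intro p q r s x hx
    rw [← mul_div_mul_right _ _ hx]
    congr 1 <;> field_simp
  rw [moeb, moeb, moeb, key _ _ _ _ _ hB, a_mul, c_mul]
  simp only [map_add, map_mul, conj_conj]
  congr 1 <;> ring

lemma normSq_moeb (A : SU11) {z : ℂ} (hz : ‖z‖ ≤ 1) :
    1 - normSq (A.moeb z) = (1 - normSq z) / normSq (A.c * z + conj A.a) := by
  have h0 : normSq (A.c * z + conj A.a) ≠ 0 := by simpa using A.denom_ne_zero hz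
  rw [moeb, normSq_div, ← normSq_sub A z, sub_div, div_self h0]

lemma norm_moeb_lt (A : SU11) {z : ℂ} (hz : ‖z‖ < 1) : ‖A.moeb z‖ < 1 := by
  have h := A.normSq_moeb hz.le
  have h0 : 0 < normSq (A.c * z + conj A.a) := normSq_pos.2 (A.denom_ne_zero hz.le)
  have h1 : 0 < 1 - normSq z := by
    rw [normSq_eq_norm_sq]; nlinarith [norm_nonneg z]
  have h2 := div_pos h1 h0
  rw [← h, normSq_eq_norm_sq] at h2
  nlinarith [norm_nonneg (A.moeb z)]

lemma norm_moeb_eq (A : SU11) {z : ℂ} (hz : ‖z‖ = 1) : ‖A.moeb z‖ = 1 := by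
  have h := A.normSq_moeb hz.le
  rw [normSq_eq_norm_sq, normSq_eq_norm_sq, hz] at h
  have h1 : ‖A.moeb z‖ ^ 2 = 1 := by
    norm_num at h; linarith
  exact (pow_eq_one_iff_of_nonneg (norm_nonneg _) two_ne_zero).1 h1

instance : MulAction SU11 𝔻 where
  smul A z := UnitDisc.mk (A.moeb z) (A.norm_moeb_lt z.norm_lt_one)
  one_smul z := by
    apply UnitDisc.coe_injective
    exact moeb_one _
  mul_smul A B z := by
    apply UnitDisc.coe_injective
    exact moeb_mul A B z.norm_lt_one.le

instance : MulAction SU11 Circle where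
  smul A z := ⟨A.moeb z, mem_sphere_zero_iff_norm.2 (A.norm_moeb_eq z.norm_coe)⟩
  one_smul z := by
    apply Circle.ext
    exact moeb_one _
  mul_smul A B z := by
    apply Circle.ext
    exact moeb_mul A B z.norm_coe.le

lemma coe_smul_disc (A : SU11) (z : 𝔻) :
    ((A • z : 𝔻) : ℂ) = (A.a * z + conj A.c) / (A.c * z + conj A.a) := rfl

lemma coe_smul_circle (A : SU11) (z : Circle) :
    ((A • z : Circle) : ℂ) = (A.a * z + conj A.c) / (A.c * z + conj A.a) := rfl

lemma continuous_a : Continuous a := by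
  have : Continuous fun A : SU11 => A.1.1 :=
    continuous_subtype_val.comp continuous_subtype_val
  exact this.matrix_elem 0 0

lemma continuous_c : Continuous c := by
  have : Continuous fun A : SU11 => A.1.1 :=
    continuous_subtype_val.comp continuous_subtype_val
  exact this.matrix_elem 1 0

/-- The subgroup `{1, -1}`, the matrices that act trivially. -/
def sign : Subgroup SU11 where
  carrier := {A | A.c = 0 ∧ (A.a = 1 ∨ A.a = -1)}
  one_mem' := by simp
  mul_mem' := by
    rintro A B ⟨hA, hA'⟩ ⟨hB, hB'⟩
    refine ⟨by simp [c_mul, hA, hB], ?_⟩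
    rcases hA' with h | h <;> rcases hB' with h' | h' <;> simp [a_mul, hA, h, h']
  inv_mem' := by
    rintro A ⟨hA, hA'⟩
    have hc : (A⁻¹).c = - A.c := by
      simp [c, Matrix.SpecialLinearGroup.SL2_inv_expl]
    have ha : (A⁻¹).a = conj A.a := by
      rw [← entry11]
      simp [a, Matrix.SpecialLinearGroup.SL2_inv_expl]
    refine ⟨by simp [hc, hA], ?_⟩
    rcases hA' with h | h <;> simp [ha, h]

lemma sign_commute {A : SU11} (hA : A ∈ sign) (B : SU11) : A * B = B * A := by
  obtain ⟨h, h'⟩ := hA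
  apply ext_ac
  · rcases h' with h' | h' <;> simp [a_mul, h, h']
  · rcases h' with h' | h' <;> simp [c_mul, h, h']

instance : sign.Normal where
  conj_mem A hA B := by
    rw [← sign_commute hA B, mul_assoc, mul_inv_cancel, mul_one]
    exact hA

lemma sign_moeb {A : SU11} (hA : A ∈ sign) (z : ℂ) : A.moeb z = z := by
  obtain ⟨h, h'⟩ := hA
  rcases h' with h' | h' <;> simp [moeb, h, h']

/-- The only matrices acting trivially on the disc are `1` and `-1`. -/
lemma mem_sign_iff (A : SU11) : A ∈ sign ↔ ∀ z : 𝔻, A • z = z := by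
  refine ⟨fun hA z => UnitDisc.coe_injective (sign_moeb hA z), fun h => ?_⟩
  have hc : A.c = 0 := by
    have h0 := congrArg UnitDisc.coe (h 0)
    rw [coe_smul_disc] at h0
    have hd := A.denom_ne_zero (z := 0) (by simp)
    simp at h0 hd
    tauto
  have ha : A.a = conj A.a := by
    have h0 := congrArg UnitDisc.coe (h (UnitDisc.mk (1 / 2) (by norm_num)))
    rw [coe_smul_disc] at h0
    have hd := A.denom_ne_zero (z := 0) (by simp)
    simp only [hc, UnitDisc.coe_mk, map_zero, zero_mul, zero_add, add_zero, mul_zero] at h0 hd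
    field_simp at h0
    exact h0
  refine ⟨hc, ?_⟩
  have hdet := A.det_eq
  rw [hc, ← ha] at hdet
  simp only [zero_mul, sub_zero] at hdet
  exact mul_self_eq_one_iff.1 hdet

lemma isClosed : IsClosed (su11 : Set (Matrix.SpecialLinearGroup (Fin 2) ℂ)) := by
  have h : ∀ i j, Continuous fun A : Matrix.SpecialLinearGroup (Fin 2) ℂ => A.1 i j :=
    fun i j => Continuous.matrix_elem continuous_subtype_val i j
  exact (isClosed_eq (h 1 1) (continuous_conj.comp (h 0 0))).inter
    (isClosed_eq (h 0 1) (continuous_conj.comp (h 1 0)))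

lemma isClosedEmbedding :
    IsClosedEmbedding (Y := Fin 2 → Fin 2 → ℂ) fun A : SU11 => A.1.1 :=
  Matrix.SpecialLinearGroup.isClosedEmbedding_val.comp isClosed.isClosedEmbedding_subtypeVal

instance : LocallyCompactSpace SU11 := isClosedEmbedding.locallyCompactSpace

instance : SecondCountableTopology SU11 :=
  isClosedEmbedding.isEmbedding.secondCountableTopology

end SU11

/-- The group `G` of Möbius transformations `z ↦ (a z + conj c) / (c z + conj a)`,
`a * conj a - c * conj c = 1`, of the unit disc: matrices up to sign, with the quotient
topology. -/
abbrev G : Type := SU11 ⧸ SU11.sign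

instance : MeasurableSpace G := borel G

instance : BorelSpace G := ⟨rfl⟩

/-- `G` acts on the disc by Möbius transformations. -/
instance : MulAction G 𝔻 :=
  MulAction.compHom 𝔻 (QuotientGroup.lift SU11.sign (MulAction.toPermHom SU11 𝔻)
    fun _ hA => Equiv.ext fun z => UnitDisc.coe_injective (SU11.sign_moeb hA z))

/-- `G` acts on the circle by Möbius transformations. -/
instance : MulAction G Circle :=
  MulAction.compHom Circle (QuotientGroup.lift SU11.sign (MulAction.toPermHom SU11 Circle)
    fun _ hA => Equiv.ext fun z => Circle.ext (SU11.sign_moeb hA z))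

lemma mk_smul_disc (A : SU11) (z : 𝔻) : (QuotientGroup.mk A : G) • z = A • z := rfl

lemma mk_smul_circle (A : SU11) (z : Circle) : (QuotientGroup.mk A : G) • z = A • z := rfl

instance : FaithfulSMul G 𝔻 where
  eq_of_smul_eq_smul := by
    intro g g' h
    obtain ⟨A, rfl⟩ := QuotientGroup.mk_surjective g
    obtain ⟨B, rfl⟩ := QuotientGroup.mk_surjective g'
    rw [QuotientGroup.eq, SU11.mem_sign_iff]
    intro z
    rw [mul_smul, ← mk_smul_disc B z, ← h z, mk_smul_disc, inv_smul_smul]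

lemma continuous_orbit_zero : Continuous fun g : G => g • (0 : 𝔻) := by
  have h : Continuous fun A : SU11 => A • (0 : 𝔻) := by
    rw [UnitDisc.isEmbedding_coe.continuous_iff]
    have : Continuous fun A : SU11 => conj A.c / conj A.a :=
      (continuous_conj.comp SU11.continuous_c).div (continuous_conj.comp SU11.continuous_a)
        fun A => by simpa using A.denom_ne_zero (z := 0) (by simp)
    refine this.congr fun A => ?_
    simp [SU11.coe_smul_disc]
  exact isQuotientMap_quotient_mk'.continuous_iff.2 h

instance : ContinuousConstSMul G Circle where
  continuous_const_smul g := by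
    obtain ⟨A, rfl⟩ := QuotientGroup.mk_surjective g
    change Continuous fun z : Circle => A • z
    have h : Continuous fun z : Circle => A.moeb z :=
      Continuous.div (by fun_prop) (by fun_prop) fun z => A.denom_ne_zero z.norm_coe.le
    exact h.subtype_mk _

/-- The subgroup `K` of rotations of the disc. -/
def K : Subgroup G where
  carrier := {g | ∃ u : Circle, ∀ z : 𝔻, g • z = u • z}
  one_mem' := ⟨1, by simp⟩
  mul_mem' := by
    rintro g g' ⟨u, hu⟩ ⟨v, hv⟩
    exact ⟨u * v, fun z => by rw [mul_smul, hv, hu, mul_smul]⟩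
  inv_mem' := by
    rintro g ⟨u, hu⟩
    exact ⟨u⁻¹, fun z => by rw [inv_smul_eq_iff, hu, smul_inv_smul]⟩

/-! ### Affine dynamical systems -/

section Affine

variable {Γ : Type*} [Group Γ] [TopologicalSpace Γ]
  {E : Type*} [AddCommGroup E] [Module ℝ E] [TopologicalSpace E]
  {F : Type*} [AddCommGroup F] [Module ℝ F] [TopologicalSpace F]

/-- `(Q, Γ)` is an affine dynamical system: `Q` is a nonempty compact convex metrizable set, and
the maps `ρ g`, restricted to `Q`, form a jointly continuous action of `Γ` on `Q` by maps that
preserve convex combinations. Only the values of `ρ g` on `Q` matter. -/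
structure IsAffineSystem (ρ : Γ → E → E) (Q : Set E) : Prop where
  nonempty : Q.Nonempty
  isCompact : IsCompact Q
  convex : Convex ℝ Q
  metrizable : TopologicalSpace.MetrizableSpace Q
  mapsTo : ∀ g, Set.MapsTo (ρ g) Q Q
  one : ∀ x ∈ Q, ρ 1 x = x
  mul : ∀ g g', ∀ x ∈ Q, ρ (g * g') x = ρ g (ρ g' x)
  continuousOn : ContinuousOn (fun p : Γ × E => ρ p.1 p.2) (Set.univ ×ˢ Q)
  affine : ∀ g, ∀ x ∈ Q, ∀ y ∈ Q, ∀ s t : ℝ, 0 ≤ s → 0 ≤ t → s + t = 1 →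
    ρ g (s • x + t • y) = s • ρ g x + t • ρ g y

/-- An affine dynamical system is irreducible if no proper nonempty subset of it is closed, convex
and invariant. -/
structure IsIrreducibleAffineSystem (ρ : Γ → E → E) (Q : Set E) : Prop
    extends IsAffineSystem ρ Q where
  eq_of_subset : ∀ Q' ⊆ Q, Q'.Nonempty → IsClosed Q' → Convex ℝ Q' →
    (∀ g, Set.MapsTo (ρ g) Q' Q') → Q' = Q

/-- Affine homomorphisms of affine dynamical systems: continuous equivariant maps preserving convex
combinations. Only the values of `Φ` on `Q` matter. -/
structure IsAffineHom (ρ : Γ → E → E) (Q : Set E) (σ : Γ → F → F) (P : Set F) (Φ : E → F) :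
    Prop where
  mapsTo : Set.MapsTo Φ Q P
  continuousOn : ContinuousOn Φ Q
  equivariant : ∀ g, ∀ x ∈ Q, Φ (ρ g x) = σ g (Φ x)
  affine : ∀ x ∈ Q, ∀ y ∈ Q, ∀ s t : ℝ, 0 ≤ s → 0 ≤ t → s + t = 1 →
    Φ (s • x + t • y) = s • Φ x + t • Φ y

/-- Isomorphism of affine dynamical systems. -/
def AffinelyIsomorphic (ρ : Γ → E → E) (Q : Set E) (σ : Γ → F → F) (P : Set F) : Prop :=
  ∃ (Φ : E → F) (Ψ : F → E), IsAffineHom ρ Q σ P Φ ∧ IsAffineHom σ P ρ Q Ψ ∧ Set.InvOn Ψ Φ Q P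

end Affine

/-! ### The system of probability measures on the circle -/

instance : MeasurableSpace Circle := borel Circle

instance : BorelSpace Circle := ⟨rfl⟩

/-- The set `M(S¹)` of Borel probability measures on the circle, as functionals on `C(S¹)`, with
the weak* topology. -/
def probCircle : Set (WeakDual ℝ C(Circle, ℝ)) :=
  {ξ | ∃ ν : ProbabilityMeasure Circle, ∀ f : C(Circle, ℝ), ξ f = ∫ ζ, f ζ ∂(ν : Measure Circle)}

/-- Push-forward of functionals (hence of measures) by `g`: `(g ξ)(f) = ξ (f ∘ g)`. -/
def pushCircle (g : G) (ξ : WeakDual ℝ C(Circle, ℝ)) : WeakDual ℝ C(Circle, ℝ) :=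
  StrongDual.toWeakDual ((WeakDual.toStrongDual ξ).comp
    (ContinuousMap.compCLM ℝ ℝ
      ⟨fun ζ : Circle => g • ζ, continuous_const_smul g⟩))

lemma pushCircle_apply (g : G) (ξ : WeakDual ℝ C(Circle, ℝ)) (f : C(Circle, ℝ)) :
    pushCircle g ξ f = ξ (f.comp ⟨fun ζ : Circle => g • ζ, continuous_const_smul g⟩) := rfl

/-! ### The space `L^∞(G)` -/

variable (μ : Measure G)

/-- `L^∞(G)`, with its structure of a real vector space. -/
def LInf : Type := Lp ℝ ∞ μ

namespace LInf

instance : AddCommGroup (LInf μ) := inferInstanceAs (AddCommGroup (Lp ℝ ∞ μ))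

instance : Module ℝ (LInf μ) := inferInstanceAs (Module ℝ (Lp ℝ ∞ μ))

variable {μ}

/-- An element of `L^∞(G)` as a function on `G`, defined up to null sets. -/
def fn (F : LInf μ) : G → ℝ := (show Lp ℝ ∞ μ from F : Lp ℝ ∞ μ)

/-- The weak* topology on `L^∞(G)` as the dual of `L^1(G)`. -/
instance : TopologicalSpace (LInf μ) :=
  TopologicalSpace.induced (fun (F : LInf μ) (φ : Lp ℝ 1 μ) => ∫ g, F.fn g * φ g ∂μ)
    Pi.topologicalSpace

/-- The class of an essentially bounded function. -/
def mk (f : G → ℝ) (hf : MemLp f ∞ μ) : LInf μ := hf.toLp f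

lemma fn_mk {f : G → ℝ} (hf : MemLp f ∞ μ) : (mk f hf).fn =ᵐ[μ] f := hf.coeFn_toLp

lemma ext_fn {F F' : LInf μ} (h : F.fn =ᵐ[μ] F'.fn) : F = F' := Lp.ext h

lemma memLp_fn (F : LInf μ) : MemLp F.fn ∞ μ := Lp.memLp (p := ∞) (μ := μ) F

lemma memLp_translate [μ.IsHaarMeasure] (g' : G) (F : LInf μ) :
    MemLp (fun g => F.fn (g * g')) ∞ μ := by
  have hq := quasiMeasurePreserving_mul_right μ g'
  refine memLp_top_of_bound (F.memLp_fn.1.comp_quasiMeasurePreserving hq)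
    (eLpNormEssSup F.fn μ).toReal ?_
  refine hq.ae (p := fun g => ‖F.fn g‖ ≤ (eLpNormEssSup F.fn μ).toReal) ?_
  have hfin : eLpNormEssSup F.fn μ ≠ ∞ := by
    have := F.memLp_fn.2.ne
    rwa [eLpNorm_exponent_top] at this
  filter_upwards [enorm_ae_le_eLpNormEssSup F.fn μ] with g hg
  have := ENNReal.toReal_mono hfin hg
  simpa using this

/-- The action of `G` on `L^∞(G)`: `(translate g' F) g = F (g * g')`. -/
def translate [μ.IsHaarMeasure] (g' : G) (F : LInf μ) : LInf μ :=
  mk (fun g => F.fn (g * g')) (F.memLp_translate g')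

end LInf

/-! ### Harmonic functions on the disc -/

/-- A bounded harmonic function on the disc (extended arbitrarily outside the disc, so that the
usual notion of harmonicity on an open subset of `ℂ` applies). -/
structure IsBoundedHarmonic (h : 𝔻 → ℝ) : Prop where
  harmonic : ∃ f : ℂ → ℝ, InnerProductSpace.HarmonicOnNhd f (Metric.ball 0 1) ∧
    ∀ z : 𝔻, f z = h z
  bounded : ∃ R : ℝ, ∀ z, |h z| ≤ R

lemma IsBoundedHarmonic.continuous {h : 𝔻 → ℝ} (hh : IsBoundedHarmonic h) : Continuous h := by
  obtain ⟨f, hf, hfh⟩ := hh.harmonic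
  rw [← show (fun z : 𝔻 => f z) = h from funext hfh, continuous_iff_continuousAt]
  intro z
  have hz : (z : ℂ) ∈ Metric.ball (0 : ℂ) 1 := by simpa using z.norm_lt_one
  exact ContinuousAt.comp (f := fun z : 𝔻 => (z : ℂ)) (hf z hz).1.continuousAt
    UnitDisc.continuous_coe.continuousAt

lemma IsBoundedHarmonic.memLp_lift {h : 𝔻 → ℝ} (hh : IsBoundedHarmonic h) :
    MemLp (fun g : G => h (g • (0 : 𝔻))) ∞ μ := by
  obtain ⟨R, hR⟩ := hh.bounded
  exact memLp_top_of_bound (hh.continuous.comp continuous_orbit_zero).aestronglyMeasurable R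
    (Filter.Eventually.of_forall fun g => hR _)

/-- The bounded harmonic functions on the disc. -/
abbrev BoundedHarmonic : Type := {h : 𝔻 → ℝ // IsBoundedHarmonic h}

/-- The lift `g ↦ h (g 0)` of `h` to `G`, as an element of `L^∞(G)`. -/
def harmonicLift (h : BoundedHarmonic) : LInf μ :=
  LInf.mk (fun g : G => h.1 (g • (0 : 𝔻))) (h.2.memLp_lift μ)

/-- `Q_h`: the weak*-closed convex hull of the translates of the lift of `h`. -/
def hullSystem [μ.IsHaarMeasure] (h : BoundedHarmonic) : Set (LInf μ) :=
  closedConvexHull ℝ (Set.range fun g : G => LInf.translate g (harmonicLift μ h))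

end MobiusDisc

end

open MobiusDisc

/-! Write m for the rotation-invariant probability measure on the circle and M for the system of
probability measures.

M is irreducible. Since K is commutative, Markov–Kakutani puts a K-fixed measure in every nonempty
closed convex invariant subset, and m is the only K-fixed measure. Boosts along the real axis push m
towards the point mass at 1, rotations give all point masses, and Hahn–Banach gives all of M
(`probCircle_subset_of_invariant`).

M is universal. The stabilizer of 1 is a product of two commutative groups, one normalizing the
other, so it fixes a point p of any affine system P. The orbit map of p is a continuous equivariant
map from the circle to P, and barycenters extend it to M (`IsAffineSystem.exists_affineHom`). If P
is irreducible, the map is onto and the only K-fixed point of P is the image of m; this forces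
uniqueness.

A homomorphism from M with more than one point in its image is injective (`IsAffineHom.injOn`): the
continuous functions that it pulls back form an invariant family with a nonconstant member, and a
Fourier argument shows that such a family separates measures (`measure_eq_of_invariant`).

A bounded harmonic h has a bounded boundary function f with h(g0) = ∫ f(gζ) dm(ζ). The map ν ↦ (g ↦
∫ f(gζ) dν(ζ)) is an affine homomorphism from M to L^∞(G) that sends m to the lift of h, and its
image is Q_h (`IsAffineHom.hullSystem_eq_image`). So Q_h is isomorphic to M when h is not constant,
and the lift is recovered from Q_h as its K-fixed point.

Conversely, let Φ map M onto an irreducible Q and put x = Φ(m). For every φ in L^1(G), the function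
g ↦ ⟨φ, gx⟩ is the lift of the Poisson integral of ζ ↦ ⟨φ, Φ(δ_ζ)⟩. Averaging x against a
K-invariant weight gives a continuous function with the same pairings, by the mean value property;
it is therefore equal to x, and harmonicity passes from the pairings to x itself
(`exists_eq_harmonicLift`). Hence Q = Q_h. -/

noncomputable section

namespace MobiusDisc

/-! ### Rotations and transitivity -/

namespace SU11

/-- The matrix `!![a, conj c; c, conj a]`. -/
def ofAC (a c : ℂ) (h : a * conj a - c * conj c = 1) : SU11 :=
  ⟨⟨!![a, conj c; c, conj a], by rw [Matrix.det_fin_two_of, ← h]; ring⟩, by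
    constructor <;> simp⟩

@[simp] lemma a_ofAC (a c : ℂ) (h : a * conj a - c * conj c = 1) : (ofAC a c h).a = a := by
  simp [SU11.a, ofAC]

@[simp] lemma c_ofAC (a c : ℂ) (h : a * conj a - c * conj c = 1) : (ofAC a c h).c = c := by
  simp [SU11.c, ofAC]

/-- Continuity of a map into `SU11` can now be checked on the two entries `a` and `c`. -/
lemma isEmbedding_ac : IsEmbedding fun A : SU11 => (A.a, A.c) := by
  have hc : Continuous fun p : ℂ × ℂ => (![![p.1, conj p.2], ![p.2, conj p.1]] : Fin 2 → Fin 2 → ℂ) := by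
    fun_prop
  refine IsEmbedding.of_comp (continuous_a.prodMk continuous_c) hc ?_
  have : (fun p : ℂ × ℂ => (![![p.1, conj p.2], ![p.2, conj p.1]] : Fin 2 → Fin 2 → ℂ)) ∘
      (fun A : SU11 => (A.a, A.c)) = fun A => A.1.1 := by
    funext A i j
    fin_cases i <;> fin_cases j <;> simp [entry11, entry01] <;> simp [a, c]
  rw [this]
  exact isClosedEmbedding.isEmbedding

/-- Rotation by `u ^ 2`. -/
def rot (u : Circle) : SU11 := ofAC u 0 (by
  rw [mul_conj, normSq_eq_norm_sq, u.norm_coe]; simp)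

lemma rot_mul (u v : Circle) : rot (u * v) = rot u * rot v := by
  apply ext_ac <;> simp [rot, a_mul, c_mul]

lemma continuous_rot : Continuous rot := by
  rw [isEmbedding_ac.continuous_iff]
  have : Continuous fun u : Circle => ((u : ℂ), (0 : ℂ)) := by fun_prop
  convert this using 1
  ext u <;> simp [rot]

lemma moeb_rot (u : Circle) (z : ℂ) : (rot u).moeb z = (u * u : ℂ) * z := by
  have h : (u : ℂ) * conj (u : ℂ) = 1 := by rw [mul_conj, normSq_eq_norm_sq, u.norm_coe]; simp
  have h0 : conj (u : ℂ) ≠ 0 := by simp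
  simp only [moeb, rot, a_ofAC, c_ofAC, map_zero, zero_mul, add_zero, zero_add]
  rw [div_eq_iff h0]
  linear_combination (-(u : ℂ) * z) * h

/-- A matrix that maps `0` to `w`. -/
def boost (w : 𝔻) : SU11 :=
  ofAC ((√(1 - normSq w))⁻¹ : ℝ) ((√(1 - normSq w))⁻¹ * conj (w : ℂ)) (by
    have h : 0 < 1 - normSq (w : ℂ) := sub_pos.2 w.normSq_lt_one
    have h1 : (((√(1 - normSq w))⁻¹ : ℝ) : ℂ) ^ 2 * (1 - normSq (w : ℂ)) = 1 := by
      have : (√(1 - normSq w))⁻¹ ^ 2 * (1 - normSq (w : ℂ)) = 1 := by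
        rw [inv_pow, Real.sq_sqrt h.le, inv_mul_cancel₀ h.ne']
      exact_mod_cast this
    rw [← mul_conj] at h1
    simp only [map_mul, conj_conj, conj_ofReal, ofReal_inv, map_inv₀] at h1 ⊢
    linear_combination h1)

lemma moeb_boost (w : 𝔻) (z : ℂ) : (boost w).moeb z = (z + w) / (conj (w : ℂ) * z + 1) := by
  have h : 0 < 1 - normSq (w : ℂ) := sub_pos.2 w.normSq_lt_one
  have h1 : (((√(1 - normSq w))⁻¹ : ℝ) : ℂ) ≠ 0 := by
    exact_mod_cast (inv_pos.2 (Real.sqrt_pos.2 h)).ne'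
  simp only [moeb, boost, a_ofAC, c_ofAC, map_mul, conj_conj, conj_ofReal, ofReal_inv, map_inv₀]
    at h1 ⊢
  rw [← mul_div_mul_left (z + w) _ h1]
  congr 1 <;> ring

end SU11

/-- The quotient of a topological group by a closed normal subgroup is Hausdorff, so this makes `G`
Hausdorff. -/
instance : IsClosed (SU11.sign : Set SU11) := by
  have : (SU11.sign : Set SU11) = {A | A.c = 0} ∩ ({A | A.a = 1} ∪ {A | A.a = -1}) := by
    ext A; rfl
  rw [this]
  exact (isClosed_eq SU11.continuous_c continuous_const).inter
    ((isClosed_eq SU11.continuous_a continuous_const).union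
      (isClosed_eq SU11.continuous_a continuous_const))

lemma continuous_smul_circle : Continuous fun p : G × Circle => p.1 • p.2 := by
  -- A product of quotient maps need not be a quotient map, but a product of open ones is; joint
  -- continuity can thus be checked on matrices.
  have hq : IsOpenQuotientMap (Prod.map (QuotientGroup.mk : SU11 → G) (id : Circle → Circle)) :=
    (QuotientGroup.isOpenQuotientMap_mk).prodMap .id
  refine hq.isQuotientMap.continuous_iff.2 ?_
  have h : Continuous fun p : SU11 × Circle => p.1.moeb p.2 := by
    have h1 := SU11.continuous_a.comp (continuous_fst (X := SU11) (Y := Circle))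
    have h2 := SU11.continuous_c.comp (continuous_fst (X := SU11) (Y := Circle))
    simp only [Function.comp_def] at h1 h2
    exact Continuous.div (by fun_prop) (by fun_prop) fun p => p.1.denom_ne_zero p.2.norm_coe.le
  exact h.subtype_mk _

instance : ContinuousSMul G Circle := ⟨continuous_smul_circle⟩

/-- The class in `G` of `diag (u, conj u)`, the rotation by `u ^ 2`. -/
def rotHalf : Circle →* G where
  toFun u := QuotientGroup.mk (SU11.rot u)
  map_one' := by
    rw [← QuotientGroup.mk_one]
    congr 1
    apply SU11.ext_ac <;> simp [SU11.rot]
  map_mul' u v := by rw [SU11.rot_mul]; rfl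

lemma rotHalf_smul_disc (u : Circle) (z : 𝔻) : rotHalf u • z = (u * u) • z := by
  apply UnitDisc.coe_injective
  change (SU11.rot u).moeb z = _
  rw [SU11.moeb_rot]
  simp

lemma exists_sq_eq_circle (ζ : Circle) : ∃ u : Circle, u * u = ζ := by
  refine ⟨Circle.exp (arg ζ / 2), ?_⟩
  rw [← Circle.exp_add, add_halves, Circle.exp_arg]

/-- The rotation by `ζ`. -/
def rotation : Circle →* G where
  -- The choice of square root is immaterial: the two roots differ by a sign and give the same
  -- element of `G`. This is why an arbitrary choice is still multiplicative.
  toFun ζ := rotHalf (exists_sq_eq_circle ζ).choose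
  map_one' := by
    apply FaithfulSMul.eq_of_smul_eq_smul (α := 𝔻)
    intro z
    rw [rotHalf_smul_disc, (exists_sq_eq_circle 1).choose_spec, one_smul, one_smul]
  map_mul' ζ ξ := by
    apply FaithfulSMul.eq_of_smul_eq_smul (α := 𝔻)
    intro z
    rw [mul_smul, rotHalf_smul_disc, rotHalf_smul_disc, rotHalf_smul_disc,
      (exists_sq_eq_circle _).choose_spec, (exists_sq_eq_circle _).choose_spec,
      (exists_sq_eq_circle _).choose_spec, mul_smul]

lemma rotation_smul_disc (ζ : Circle) (z : 𝔻) : rotation ζ • z = ζ • z := by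
  change rotHalf _ • z = _
  rw [rotHalf_smul_disc, (exists_sq_eq_circle _).choose_spec]

@[simp] lemma coe_rotation_smul_disc (ζ : Circle) (z : 𝔻) : ((rotation ζ • z : 𝔻) : ℂ) = ζ * z := by
  rw [rotation_smul_disc]
  simp

lemma rotation_sq (u : Circle) : rotation (u * u) = rotHalf u := by
  apply FaithfulSMul.eq_of_smul_eq_smul (α := 𝔻)
  intro z
  rw [rotHalf_smul_disc, rotation_smul_disc]

lemma rotation_smul_circle (ζ ξ : Circle) : rotation ζ • ξ = ζ * ξ := by
  obtain ⟨u, rfl⟩ := exists_sq_eq_circle ζ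
  rw [rotation_sq]
  apply Circle.ext
  change (SU11.rot u).moeb ξ = _
  rw [SU11.moeb_rot]
  simp

lemma continuous_rotation : Continuous rotation := by
  -- The chosen square root is not continuous. Squaring is a closed surjection, hence a quotient
  -- map, and after composition with it the root disappears.
  have hs : Continuous fun u : Circle => u * u := by fun_prop
  have hq : IsQuotientMap fun u : Circle => u * u :=
    hs.isClosedMap.isQuotientMap hs exists_sq_eq_circle
  refine hq.continuous_iff.2 ?_
  have : (rotation ∘ fun u : Circle => u * u) = fun u => (QuotientGroup.mk (SU11.rot u) : G) := by
    ext u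
    exact rotation_sq u
  rw [this]
  exact QuotientGroup.continuous_mk.comp SU11.continuous_rot

lemma mem_K_iff (g : G) : g ∈ K ↔ ∃ ζ, g = rotation ζ := by
  constructor
  · rintro ⟨ζ, hζ⟩
    refine ⟨ζ, FaithfulSMul.eq_of_smul_eq_smul (α := 𝔻) fun z => ?_⟩
    rw [hζ, rotation_smul_disc]
  · rintro ⟨ζ, rfl⟩
    exact ⟨ζ, rotation_smul_disc ζ⟩

/-- A Möbius transformation that maps `0` to `w`. -/
def boost (w : 𝔻) : G := QuotientGroup.mk (SU11.boost w)

lemma coe_boost_smul_disc (w z : 𝔻) :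
    ((boost w • z : 𝔻) : ℂ) = (z + w) / (conj (w : ℂ) * z + 1) := SU11.moeb_boost w z

lemma coe_boost_smul_circle (w : 𝔻) (z : Circle) :
    ((boost w • z : Circle) : ℂ) = (z + w) / (conj (w : ℂ) * z + 1) := SU11.moeb_boost w z

@[simp] lemma boost_smul_zero (w : 𝔻) : boost w • (0 : 𝔻) = w := by
  apply UnitDisc.coe_injective
  rw [coe_boost_smul_disc]
  simp

/-! ### Haar measure is invariant under right multiplication by rotations -/

-- The modular character is trivial on a compact subgroup. If C is a compact neighbourhood of 1,
-- then D = C·K has finite positive measure and is unchanged by right multiplication by a rotation,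
-- so the scaling factor must be 1. Unimodularity of `G` is never needed.
open scoped Pointwise in
lemma measurePreserving_mul_rotation (μ : Measure G) [μ.IsHaarMeasure] (ζ : Circle) :
    MeasurePreserving (fun g => g * rotation ζ) μ μ := by
  refine ⟨measurable_mul_const _, ?_⟩
  obtain ⟨C, hC, hC1⟩ := exists_compact_mem_nhds (1 : G)
  have hK : IsCompact (Set.range rotation) := isCompact_range continuous_rotation
  set D : Set G := C * Set.range rotation
  have hD : IsCompact D := hC.mul hK
  have hDpos : 0 < μ D := by
    refine lt_of_lt_of_le (Measure.measure_pos_of_mem_nhds μ hC1) (measure_mono ?_)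
    intro x hx
    exact ⟨x, hx, 1, ⟨1, map_one _⟩, mul_one x⟩
  rw [Measure.map_right_mul_eq_modularCharacterFun_smul]
  have h1 : (fun g => g * rotation ζ) ⁻¹' D = D := by
    ext x
    constructor
    · rintro ⟨y, hy, _, ⟨ξ, rfl⟩, hx⟩
      refine ⟨y, hy, rotation (ξ * ζ⁻¹), ⟨_, rfl⟩, ?_⟩
      simp only [map_mul, map_inv] at hx ⊢
      rw [← mul_assoc, hx, mul_inv_cancel_right]
    · rintro ⟨y, hy, _, ⟨ξ, rfl⟩, rfl⟩
      exact ⟨y, hy, rotation (ξ * ζ), ⟨_, rfl⟩, by simp [mul_assoc]⟩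
  have h2 := congrArg (fun ν : Measure G => ν D)
    (Measure.map_right_mul_eq_modularCharacterFun_smul μ (rotation ζ))
  simp only [Measure.map_apply (measurable_mul_const (rotation ζ)) hD.measurableSet] at h2
  rw [h1] at h2
  have h3 : (Measure.modularCharacterFun (rotation ζ) : ℝ≥0∞) = 1 := by
    have h4 : μ D = (Measure.modularCharacterFun (rotation ζ) : ℝ≥0∞) * μ D := h2
    have h5 := (ENNReal.mul_left_inj (a := 1) (b := Measure.modularCharacterFun (rotation ζ))
      hDpos.ne' hD.measure_lt_top.ne).1 (by rw [one_mul]; exact h4)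
    exact h5.symm
  have h6 : Measure.modularCharacterFun (rotation ζ) = 1 := by exact_mod_cast h3
  rw [h6, one_smul]

/-! ### The rotation-invariant measure on the circle -/

lemma continuous_integral_left {X : Type*} [TopologicalSpace X] [CompactSpace X]
    [MeasurableSpace X] [BorelSpace X] {E : Type*} [NormedAddCommGroup E] [NormedSpace ℝ E]
    [SecondCountableTopologyEither X E]
    (P : Measure X) [IsFiniteMeasure P] : Continuous fun f : C(X, E) => ∫ x, f x ∂P := by
  have hi : ∀ f : C(X, E), Integrable (fun x => f x) P := fun f =>
    f.continuous.integrable_of_hasCompactSupport (HasCompactSupport.of_compactSpace _)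
  refine LipschitzWith.continuous (K := (P Set.univ).toNNReal) (LipschitzWith.of_dist_le_mul ?_)
  intro f g
  rw [dist_eq_norm, ← integral_sub (hi f) (hi g), mul_comm]
  refine norm_integral_le_of_norm_le_const (Filter.Eventually.of_forall fun x => ?_)
  rw [← dist_eq_norm]
  exact ContinuousMap.dist_apply_le_dist x

/-- Finite measures on the circle are determined by their nonnegative Fourier coefficients. -/
lemma measure_circle_ext {P P' : Measure Circle} [IsFiniteMeasure P] [IsFiniteMeasure P']
    (h : ∀ n : ℕ, ∫ ζ : Circle, (ζ : ℂ) ^ n ∂P = ∫ ζ : Circle, (ζ : ℂ) ^ n ∂P') : P = P' := by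
  have hz : ∀ n : ℤ, ∫ ζ : Circle, (ζ : ℂ) ^ n ∂P = ∫ ζ : Circle, (ζ : ℂ) ^ n ∂P' := by
    intro n
    obtain ⟨k, rfl | rfl⟩ := n.eq_nat_or_neg
    · simpa using h k
    -- On the circle negative powers are conjugates of positive ones, so the coefficients of
    -- nonnegative order determine all others.
    · have hc : ∀ ζ : Circle, (ζ : ℂ) ^ (-(k : ℤ)) = conj ((ζ : ℂ) ^ k) := by
        intro ζ
        rw [zpow_neg, zpow_natCast, map_pow, ← Circle.coe_inv_eq_conj, Circle.coe_inv, inv_pow]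
      simp only [hc, integral_conj, h k]
  let e : AddCircle (1 : ℝ) ≃ₜ Circle := AddCircle.homeomorphCircle one_ne_zero
  have he : ∀ ζ, AddCircle.toCircle (e.symm ζ) = ζ := fun ζ => by
    rw [← AddCircle.homeomorphCircle_apply one_ne_zero]
    exact e.apply_symm_apply ζ
  have key : ∀ f : C(AddCircle (1 : ℝ), ℂ),
      ∫ ζ, f (e.symm ζ) ∂P = ∫ ζ, f (e.symm ζ) ∂P' := by
    intro f
    have hint : ∀ (ρ : Measure Circle) [IsFiniteMeasure ρ] (f : C(AddCircle (1 : ℝ), ℂ)),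
        Integrable (fun ζ => f (e.symm ζ)) ρ := fun R _ f =>
      (f.continuous.comp e.symm.continuous).integrable_of_hasCompactSupport
        (HasCompactSupport.of_compactSpace _)
    have hcl : f ∈ (Submodule.span ℂ (Set.range (@fourier 1))).topologicalClosure := by
      rw [span_fourier_closure_eq_top]; trivial
    have hc : ∀ (ρ : Measure Circle) [IsFiniteMeasure ρ],
        Continuous fun f : C(AddCircle (1 : ℝ), ℂ) => ∫ ζ, f (e.symm ζ) ∂ρ := fun ρ _ =>
      (continuous_integral_left ρ).comp
        (ContinuousMap.continuous_precomp (⟨e.symm, e.symm.continuous⟩ : C(Circle, AddCircle (1 : ℝ))))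
    refine closure_minimal (t := {f | ∫ ζ, f (e.symm ζ) ∂P = ∫ ζ, f (e.symm ζ) ∂P'}) ?_
      (isClosed_eq (hc P) (hc P')) hcl
    intro f hf
    induction hf using Submodule.span_induction with
    | mem f hf =>
      obtain ⟨n, rfl⟩ := hf
      have : ∀ ζ : Circle, (fourier n (e.symm ζ) : ℂ) = (ζ : ℂ) ^ n := fun ζ => by
        rw [fourier_apply, AddCircle.toCircle_zsmul, he, Circle.coe_zpow]
      simp only [Set.mem_ofPred_eq, this, hz n]
    | zero => simp
    | add f g _ _ hf hg =>
      simp only [Set.mem_ofPred_eq, ContinuousMap.add_apply] at hf hg ⊢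
      rw [integral_add (hint P f) (hint P g), integral_add (hint P' f) (hint P' g), hf, hg]
    | smul c f _ hf =>
      simp only [Set.mem_ofPred_eq, ContinuousMap.smul_apply] at hf ⊢
      rw [integral_smul, integral_smul, hf]
  refine ext_of_forall_integral_eq_of_IsFiniteMeasure fun f => ?_
  have h1 := key ⟨fun x => (f (e x) : ℂ), by fun_prop⟩
  simp only [ContinuousMap.coe_mk, Homeomorph.apply_symm_apply] at h1
  rw [integral_complex_ofReal, integral_complex_ofReal] at h1
  exact_mod_cast h1

/-- The rotation-invariant probability measure on the circle. -/
def circleMeasure : Measure Circle :=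
  (ENNReal.ofReal (2 * Real.pi)⁻¹ • volume.restrict (Set.Ioc 0 (2 * Real.pi))).map Circle.exp

instance : IsProbabilityMeasure circleMeasure := by
  have : IsProbabilityMeasure
      (ENNReal.ofReal (2 * Real.pi)⁻¹ • volume.restrict (Set.Ioc 0 (2 * Real.pi))) := by
    constructor
    rw [Measure.smul_apply, Measure.restrict_apply_univ, Real.volume_Ioc, smul_eq_mul,
      ← ENNReal.ofReal_mul (by positivity), sub_zero, inv_mul_cancel₀ (by positivity),
      ENNReal.ofReal_one]
  exact Measure.isProbabilityMeasure_map Circle.exp.continuous.aemeasurable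

/-- Bridge to `Real.circleAverage`, which takes functions on ℂ. Any extension `F` of `f` will do,
because only its values on the circle enter. -/
lemma integral_circleMeasure {E : Type*} [NormedAddCommGroup E] [NormedSpace ℝ E] {f : Circle → E}
    (hf : AEStronglyMeasurable f circleMeasure) {F : ℂ → E} (hF : ∀ ζ : Circle, F ζ = f ζ) :
    ∫ ζ, f ζ ∂circleMeasure = Real.circleAverage F 0 1 := by
  rw [circleMeasure, integral_map Circle.exp.continuous.aemeasurable hf, integral_smul_measure,
    Real.circleAverage, intervalIntegral.integral_of_le (by positivity),
    ENNReal.toReal_ofReal (by positivity)]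
  congr 2
  ext θ
  rw [← hF]
  simp [circleMap]

lemma continuous_integrable {E : Type*} [NormedAddCommGroup E] {f : Circle → E} (hf : Continuous f)
    (P : Measure Circle) [IsFiniteMeasure P] : Integrable f P :=
  hf.integrable_of_hasCompactSupport (HasCompactSupport.of_compactSpace _)

lemma continuous_of_diffContOnCl {F : ℂ → ℂ} (hF : DiffContOnCl ℂ F (Metric.ball 0 1)) :
    Continuous fun ζ : Circle => F ζ := by
  refine ContinuousOn.comp_continuous (s := Metric.closedBall 0 1) ?_ 
    continuous_subtype_val fun ζ => by simp [ζ.norm_coe]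
  have := hF.continuousOn
  rwa [closure_ball _ one_ne_zero] at this

/-- The mean value property of holomorphic functions. -/
lemma integral_of_diffContOnCl {F : ℂ → ℂ} (hF : DiffContOnCl ℂ F (Metric.ball 0 1)) :
    ∫ ζ : Circle, F ζ ∂circleMeasure = F 0 := by
  rw [integral_circleMeasure (continuous_of_diffContOnCl hF).aestronglyMeasurable fun _ => rfl]
  exact DiffContOnCl.circleAverage (by simpa using hF)

lemma integral_pow_circleMeasure (n : ℕ) :
    ∫ ζ : Circle, (ζ : ℂ) ^ n ∂circleMeasure = 0 ^ n :=
  integral_of_diffContOnCl (F := fun z => z ^ n) (by fun_prop : Differentiable ℂ fun z : ℂ => z ^ n).diffContOnCl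

/-- Rotation multiplies the n-th moment by ξ^n, and the moments of positive order vanish. -/
lemma map_mul_circleMeasure (ξ : Circle) : circleMeasure.map (fun ζ => ξ * ζ) = circleMeasure := by
  have hm : Measurable fun ζ : Circle => ξ * ζ := (continuous_const_mul ξ).measurable
  have : IsProbabilityMeasure (circleMeasure.map (fun ζ => ξ * ζ)) :=
    Measure.isProbabilityMeasure_map hm.aemeasurable
  refine measure_circle_ext fun n => ?_
  rw [integral_map hm.aemeasurable (by fun_prop : Continuous fun ζ : Circle => (ζ : ℂ) ^ n).aestronglyMeasurable]
  simp only [Circle.coe_mul, mul_pow]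
  rw [integral_const_mul, integral_pow_circleMeasure]
  rcases n with _ | n <;> simp

lemma measurePreserving_mul_circle (ξ : Circle) :
    MeasurePreserving (fun ζ => ξ * ζ) circleMeasure circleMeasure :=
  ⟨(continuous_const_mul ξ).measurable, map_mul_circleMeasure ξ⟩

lemma integral_mul_circle {E : Type*} [NormedAddCommGroup E] [NormedSpace ℝ E] (f : Circle → E)
    (ξ : Circle) : ∫ ζ, f (ξ * ζ) ∂circleMeasure = ∫ ζ, f ζ ∂circleMeasure :=
  (measurePreserving_mul_circle ξ).integral_comp (Homeomorph.mulLeft ξ).measurableEmbedding f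

/-! ### The Poisson kernel -/

lemma poissonKernel_circle (z : ℂ) (ζ : Circle) :
    poissonKernel 0 z ζ = (1 - ‖z‖ ^ 2) / ‖(ζ : ℂ) - z‖ ^ 2 := by
  simp [poissonKernel, ζ.norm_coe]

lemma circle_sub_ne_zero {z : ℂ} (hz : ‖z‖ < 1) (ζ : Circle) : ‖(ζ : ℂ) - z‖ ≠ 0 := by
  rw [norm_ne_zero_iff, sub_ne_zero]
  rintro rfl
  simp [ζ.norm_coe] at hz

lemma poissonKernel_circle_nonneg {z : ℂ} (hz : ‖z‖ < 1) (ζ : Circle) :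
    0 ≤ poissonKernel 0 z ζ := by
  rw [poissonKernel_circle]
  have : ‖z‖ ^ 2 ≤ 1 := by nlinarith [norm_nonneg z]
  exact div_nonneg (sub_nonneg.2 this) (by positivity)

lemma continuous_poissonKernel_circle {z : ℂ} (hz : ‖z‖ < 1) :
    Continuous fun ζ : Circle => poissonKernel 0 z ζ := by
  simp only [poissonKernel_circle]
  exact Continuous.div (by fun_prop) (by fun_prop) fun ζ => pow_ne_zero _ (circle_sub_ne_zero hz ζ)

lemma integral_poissonKernel_of_diffContOnCl {F : ℂ → ℂ} (hF : DiffContOnCl ℂ F (Metric.ball 0 1))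
    {z : ℂ} (hz : ‖z‖ < 1) :
    ∫ ζ : Circle, poissonKernel 0 z ζ • F ζ ∂circleMeasure = F z := by
  refine (integral_circleMeasure (f := fun ζ : Circle => poissonKernel 0 z ζ • F ζ)
    ((continuous_poissonKernel_circle hz).smul (continuous_of_diffContOnCl hF)).aestronglyMeasurable
    (F := poissonKernel 0 z • F) fun _ => rfl).trans ?_
  exact hF.circleAverage_poissonKernel_smul (by simpa using hz)

lemma integral_poissonKernel {z : ℂ} (hz : ‖z‖ < 1) :
    ∫ ζ : Circle, poissonKernel 0 z ζ ∂circleMeasure = 1 := by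
  have h := integral_poissonKernel_of_diffContOnCl (F := fun _ => 1) diffContOnCl_const hz
  simp only [real_smul, mul_one] at h
  rw [integral_complex_ofReal] at h
  exact_mod_cast h

lemma integral_poissonKernel_mul_re {F : ℂ → ℂ} (hF : DiffContOnCl ℂ F (Metric.ball 0 1))
    {z : ℂ} (hz : ‖z‖ < 1) :
    ∫ ζ : Circle, poissonKernel 0 z ζ * (F ζ).re ∂circleMeasure = (F z).re := by
  have h := congrArg re (integral_poissonKernel_of_diffContOnCl hF hz)
  rw [← h]
  have h1 := reCLM.integral_comp_comm (continuous_integrable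
    ((continuous_poissonKernel_circle hz).smul (continuous_of_diffContOnCl hF)) circleMeasure)
  simpa using h1

lemma SU11.diffContOnCl_moeb (A : SU11) : DiffContOnCl ℂ A.moeb (Metric.ball 0 1) := by
  apply DifferentiableOn.diffContOnCl
  intro z hz
  rw [closure_ball _ one_ne_zero, mem_closedBall_zero_iff] at hz
  have := A.denom_ne_zero hz
  have h1 : DifferentiableAt ℂ (fun z => (A.a * z + conj A.c) / (A.c * z + conj A.a)) z :=
    DifferentiableAt.div (by fun_prop) (by fun_prop) this
  exact h1.differentiableWithinAt

lemma diffContOnCl_pow {F : ℂ → ℂ} {s : Set ℂ} (hF : DiffContOnCl ℂ F s) (n : ℕ) :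
    DiffContOnCl ℂ (fun z => F z ^ n) s :=
  (by fun_prop : Differentiable ℂ fun z : ℂ => z ^ n).comp_diffContOnCl hF

lemma measurable_smul_circle (g : G) : Measurable fun ζ : Circle => g • ζ :=
  (continuous_const_smul g).measurable

/-- A Möbius transformation maps `circleMeasure` to a Poisson kernel. -/
lemma map_smul_circleMeasure (g : G) : circleMeasure.map (fun ζ => g • ζ) =
    circleMeasure.withDensity fun ζ => ENNReal.ofReal (poissonKernel 0 (g • (0 : 𝔻) : 𝔻) ζ) := by
  have hz : ‖((g • (0 : 𝔻) : 𝔻) : ℂ)‖ < 1 := UnitDisc.norm_lt_one _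
  have hc := continuous_poissonKernel_circle hz
  have h1 : IsProbabilityMeasure (circleMeasure.map (fun ζ => g • ζ)) :=
    Measure.isProbabilityMeasure_map (measurable_smul_circle g).aemeasurable
  have h2 : IsFiniteMeasure (circleMeasure.withDensity
      fun ζ => ENNReal.ofReal (poissonKernel 0 (g • (0 : 𝔻) : 𝔻) ζ)) :=
    isFiniteMeasure_withDensity_ofReal (continuous_integrable hc circleMeasure).2
  -- Both measures have n-th moment (g0)^n: one by the mean value property of the n-th power of the
  -- Möbius map, the other by the Poisson formula for z^n.
  refine measure_circle_ext fun n => ?_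
  rw [integral_map (measurable_smul_circle g).aemeasurable
    (by fun_prop : Continuous fun ζ : Circle => (ζ : ℂ) ^ n).aestronglyMeasurable,
    integral_withDensity_eq_integral_toReal_smul hc.measurable.ennreal_ofReal
    (Filter.Eventually.of_forall fun _ => ENNReal.ofReal_lt_top)]
  simp only [ENNReal.toReal_ofReal (poissonKernel_circle_nonneg hz _)]
  rw [integral_poissonKernel_of_diffContOnCl (F := fun z => z ^ n)
    (by fun_prop : Differentiable ℂ fun z : ℂ => z ^ n).diffContOnCl hz]
  obtain ⟨A, rfl⟩ := QuotientGroup.mk_surjective g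
  exact integral_of_diffContOnCl (diffContOnCl_pow A.diffContOnCl_moeb n)

/-- The link between the two pictures: g ↦ ∫ f(gζ) dm is the lift to `G` of the Poisson integral of
f. -/
lemma integral_smul_circle {f : Circle → ℝ} (hf : Measurable f) (g : G) :
    ∫ ζ, f (g • ζ) ∂circleMeasure =
      ∫ ζ, poissonKernel 0 (g • (0 : 𝔻) : 𝔻) ζ * f ζ ∂circleMeasure := by
  have hz : ‖((g • (0 : 𝔻) : 𝔻) : ℂ)‖ < 1 := UnitDisc.norm_lt_one _
  have hc := continuous_poissonKernel_circle hz
  rw [← integral_map (measurable_smul_circle g).aemeasurable hf.aestronglyMeasurable,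
    map_smul_circleMeasure, integral_withDensity_eq_integral_toReal_smul hc.measurable.ennreal_ofReal
    (Filter.Eventually.of_forall fun _ => ENNReal.ofReal_lt_top)]
  simp only [ENNReal.toReal_ofReal (poissonKernel_circle_nonneg hz _), smul_eq_mul]

/-! ### Bounded harmonic functions -/

lemma IsBoundedHarmonic.exists_analytic {h : 𝔻 → ℝ} (hh : IsBoundedHarmonic h) :
    ∃ F : ℂ → ℂ, DifferentiableOn ℂ F (Metric.ball 0 1) ∧ ∀ z : 𝔻, (F z).re = h z := by
  obtain ⟨f, hf, hfh⟩ := hh.harmonic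
  obtain ⟨F, hF, hFf⟩ := hf.exists_analyticOnNhd_ball_re_eq
  refine ⟨F, hF.differentiableOn, fun z => ?_⟩
  rw [← hfh]
  exact hFf (by simpa using z.norm_lt_one)

/-- The mean value property on hyperbolic circles. -/
lemma IsBoundedHarmonic.integral_rotation {h : 𝔻 → ℝ} (hh : IsBoundedHarmonic h) (g : G) (z : 𝔻) :
    ∫ ζ, h (g • rotation ζ • z) ∂circleMeasure = h (g • (0 : 𝔻)) := by
  obtain ⟨F, hF, hFh⟩ := hh.exists_analytic
  obtain ⟨A, rfl⟩ := QuotientGroup.mk_surjective g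
  -- Rotating z amounts to evaluating w ↦ F(A(wz)) at |w| = 1. As |z| < 1, this function is
  -- holomorphic at every point of the closed disc, and its value at 0 gives the right-hand side.
  have hd : DiffContOnCl ℂ (fun w => F (A.moeb (w * z))) (Metric.ball 0 1) := by
    apply DifferentiableOn.diffContOnCl
    intro w hw
    rw [closure_ball _ one_ne_zero, mem_closedBall_zero_iff] at hw
    have h1 : ‖w * z‖ < 1 := by
      rw [norm_mul]
      exact mul_lt_one_of_nonneg_of_lt_one_right hw (norm_nonneg _) z.norm_lt_one
    have h2 : DifferentiableAt ℂ A.moeb (w * z) :=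
      A.diffContOnCl_moeb.differentiableAt Metric.isOpen_ball (by simpa using h1)
    have h3 : DifferentiableAt ℂ F (A.moeb (w * z)) :=
      hF.differentiableAt (Metric.isOpen_ball.mem_nhds (by simpa using A.norm_moeb_lt h1))
    exact (DifferentiableAt.comp w h3
      (DifferentiableAt.comp (f := fun w : ℂ => w * z) w h2 (by fun_prop))).differentiableWithinAt
  have h1 := integral_poissonKernel_mul_re hd (z := 0) (by simp)
  simp only [poissonKernel_circle] at h1
  simp only [norm_zero, sub_zero, Circle.norm_coe, zero_mul] at h1
  norm_num at h1
  have h2 : ∀ w : 𝔻, h ((QuotientGroup.mk A : G) • w) = (F (A.moeb w)).re := fun w => (hFh _).symm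
  simp only [h2, coe_rotation_smul_disc]
  rw [h1]
  simp

/-- The Poisson formula for dilates. -/
lemma IsBoundedHarmonic.poisson {h : 𝔻 → ℝ} (hh : IsBoundedHarmonic h) (z r : 𝔻) :
    ∫ ζ : Circle, poissonKernel 0 z ζ * h (ζ • r) ∂circleMeasure = h (z * r) := by
  obtain ⟨F, hF, hFh⟩ := hh.exists_analytic
  have hd : DiffContOnCl ℂ (fun w => F (w * r)) (Metric.ball 0 1) := by
    apply DifferentiableOn.diffContOnCl
    intro w hw
    rw [closure_ball _ one_ne_zero, mem_closedBall_zero_iff] at hw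
    have h1 : ‖w * r‖ < 1 := by
      rw [norm_mul]
      exact mul_lt_one_of_nonneg_of_lt_one_right hw (norm_nonneg _) r.norm_lt_one
    have h3 : DifferentiableAt ℂ F (w * r) :=
      hF.differentiableAt (Metric.isOpen_ball.mem_nhds (by simpa using h1))
    exact (DifferentiableAt.comp (f := fun w : ℂ => w * r) w h3 (by fun_prop)).differentiableWithinAt
  have h1 := integral_poissonKernel_mul_re hd z.norm_lt_one
  simp only [← hFh]
  simpa using h1

/-- The Poisson kernel is the real part of the Herglotz–Riesz kernel, which is holomorphic in z. The
function `e` extends ψ by 0 off the circle only to have a function on ℂ. -/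
lemma harmonicAt_poisson {ψ : Circle → ℝ} (hψ : Continuous ψ) {z₀ : ℂ} (hz₀ : ‖z₀‖ < 1) :
    InnerProductSpace.HarmonicAt
      (fun z => ∫ ζ : Circle, poissonKernel 0 z ζ * ψ ζ ∂circleMeasure) z₀ := by
  classical
  let e : ℂ → ℝ := fun z => if hz : z ∈ Metric.sphere (0 : ℂ) 1 then ψ ⟨z, hz⟩ else 0
  have he : ∀ ζ : Circle, e ζ = ψ ζ := fun ζ => by
    have := ζ.norm_coe
    simp only [e, mem_sphere_zero_iff_norm, this, dite_true]
    rfl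
  have hei : CircleIntegrable e 0 1 := by
    have : Continuous fun θ : ℝ => e (circleMap 0 1 θ) := by
      have h1 : (fun θ : ℝ => e (circleMap 0 1 θ)) = fun θ => ψ (Circle.exp θ) := by
        ext θ
        rw [← he]
        simp [circleMap]
      rw [h1]
      fun_prop
    exact this.intervalIntegrable _ _
  have h1 := analyticOnNhd_circleAverage_herglotzRieszKernel_smul
    (f := fun ζ => (e ζ : ℂ)) (R := 1) (by
      rw [CircleIntegrable, intervalIntegrable_iff] at hei ⊢
      exact ofRealCLM.integrable_comp hei) z₀ (by simpa using hz₀)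
  refine (InnerProductSpace.harmonicAt_congr_nhds ?_).1 h1.harmonicAt_re
  filter_upwards [Metric.isOpen_ball.mem_nhds
    (show z₀ ∈ Metric.ball (0 : ℂ) 1 by simpa using hz₀)] with z hz
  rw [re_circleAverage_herglotzRieszKernel_smul hei hz, ← poissonKernel_eq_re_herglotzRieszKernel]
  refine (integral_circleMeasure
    ((continuous_poissonKernel_circle (by simpa using hz)).mul hψ).aestronglyMeasurable ?_).symm
  intro ζ
  simp [he]

lemma isBoundedHarmonic_poisson {ψ : Circle → ℝ} (hψ : Continuous ψ) :
    IsBoundedHarmonic fun z : 𝔻 => ∫ ζ : Circle, poissonKernel 0 z ζ * ψ ζ ∂circleMeasure where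
  harmonic := ⟨fun z => ∫ ζ : Circle, poissonKernel 0 z ζ * ψ ζ ∂circleMeasure,
    fun z hz => harmonicAt_poisson hψ (by simpa using hz), fun _ => rfl⟩
  bounded := by
    obtain ⟨C, hC⟩ := (isCompact_range hψ).exists_bound_of_continuousOn continuousOn_id
    refine ⟨C, fun z => ?_⟩
    have hz := z.norm_lt_one
    have hc := continuous_poissonKernel_circle hz
    calc |∫ ζ : Circle, poissonKernel 0 z ζ * ψ ζ ∂circleMeasure|
        ≤ ∫ ζ : Circle, poissonKernel 0 z ζ * C ∂circleMeasure := by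
          rw [← Real.norm_eq_abs]
          refine norm_integral_le_of_norm_le (g := fun ζ : Circle => poissonKernel 0 z ζ * C)
            (continuous_integrable (hc.mul continuous_const) circleMeasure)
            (Filter.Eventually.of_forall fun ζ => ?_)
          rw [norm_mul, Real.norm_of_nonneg (poissonKernel_circle_nonneg hz ζ)]
          exact mul_le_mul_of_nonneg_left (hC _ ⟨ζ, rfl⟩) (poissonKernel_circle_nonneg hz ζ)
      _ = C := by rw [integral_mul_const, integral_poissonKernel hz, one_mul]

/-! ### The Markov–Kakutani fixed point theorem -/

section MarkovKakutani

lemma isClosed_fixedPoints {E : Type*} [TopologicalSpace E] [T2Space E] {T : E → E} {P : Set E} (hP : IsCompact P)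
    (hcont : ContinuousOn T P) : IsClosed {x | x ∈ P ∧ T x = x} := by
  have h : IsClosed {x : P | T x = x} :=
    isClosed_eq (continuousOn_iff_continuous_domRestrict.1 hcont) continuous_subtype_val
  convert hP.isClosed.isClosedEmbedding_subtypeVal.isClosedMap _ h
  ext x
  simp [and_comm]

variable {E : Type*} [AddCommGroup E] [Module ℝ E] [TopologicalSpace E]

/-- `T` preserves convex combinations of points of `P`. -/
def AffineOn {F : Type*} [AddCommGroup F] [Module ℝ F] (T : E → F) (P : Set E) : Prop :=
  ∀ x ∈ P, ∀ y ∈ P, ∀ s t : ℝ, 0 ≤ s → 0 ≤ t → s + t = 1 → T (s • x + t • y) = s • T x + t • T y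

/-- The Cesàro averages of an orbit satisfy T x_n - x_n = (T^(n+1) x₀ - x₀)/(n+1), which tends to 0,
so every limit point of the averages is fixed. -/
lemma exists_fixedPoint [IsTopologicalAddGroup E] [ContinuousSMul ℝ E] [T2Space E]
    {T : E → E} {P : Set E} (hP : IsCompact P) (hc : Convex ℝ P) (hne : P.Nonempty)
    (hT : Set.MapsTo T P P) (hcont : ContinuousOn T P) (haff : AffineOn T P) :
    ∃ p ∈ P, T p = p := by
  obtain ⟨x₀, hx₀⟩ := hne
  have hit : ∀ n, T^[n] x₀ ∈ P := fun n => hT.iterate n hx₀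
  let ε : ℕ → ℝ := fun n => 1 / ((n : ℝ) + 1)
  -- The average of x₀, T x₀, ..., T^n x₀, written recursively so that each step is a convex
  -- combination of two points, the only kind that `haff` handles.
  let x : ℕ → E := fun n => Nat.rec x₀ (fun n y => (1 - ε (n + 1)) • y + ε (n + 1) • T^[n + 1] x₀) n
  have hxs : ∀ n, x (n + 1) = (1 - ε (n + 1)) • x n + ε (n + 1) • T^[n + 1] x₀ := fun _ => rfl
  have hε0 : ∀ n, 0 ≤ ε n := fun n => by positivity
  have hε1 : ∀ n, 0 ≤ 1 - ε n := fun n => by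
    rw [sub_nonneg, div_le_one (by positivity)]
    linarith [(Nat.cast_nonneg n : (0 : ℝ) ≤ n)]
  have hxP : ∀ n, x n ∈ P := by
    intro n
    induction n with
    | zero => exact hx₀
    | succ n ih => exact hc ih (hit _) (hε1 _) (hε0 _) (by ring)
  have hTx : ∀ n, T (x n) = x n + ε n • (T^[n + 1] x₀ - x₀) := by
    intro n
    induction n with
    | zero => simp [x, ε]
    | succ n ih =>
      rw [hxs, haff _ (hxP n) _ (hit _) _ _ (hε1 _) (hε0 _) (by ring), ih,
        ← Function.iterate_succ_apply' T]
      have h : (1 - ε (n + 1)) * ε n = ε (n + 1) := by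
        simp only [ε]
        push_cast
        field_simp
        ring
      rw [smul_add, smul_smul, h, smul_sub, smul_sub]
      abel
  -- `P` need not be sequentially compact. Along an ultrafilter the averages and the orbit both
  -- converge, and the factor 1/(n+1) then kills the difference.
  let U : Ultrafilter ℕ := Ultrafilter.of Filter.atTop
  have hU : (U : Filter ℕ) ≤ Filter.atTop := Ultrafilter.of_le _
  have hlim : ∀ y : ℕ → E, (∀ n, y n ∈ P) → ∃ q ∈ P, Filter.Tendsto y U (𝓝 q) := by
    intro y hy
    obtain ⟨q, hq, h⟩ := hP.ultrafilter_le_nhds (U.map y)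
      (Filter.tendsto_principal.2 (Filter.Eventually.of_forall hy))
    exact ⟨q, hq, h⟩
  obtain ⟨p, hp, hxp⟩ := hlim x hxP
  obtain ⟨q, hq, hyq⟩ := hlim (fun n => T^[n + 1] x₀) fun n => hit _
  have h1 : Filter.Tendsto (fun n => T (x n)) U (𝓝 (T p)) :=
    (hcont p hp).tendsto.comp (tendsto_nhdsWithin_iff.2 ⟨hxp, Filter.Eventually.of_forall hxP⟩)
  have h2 : Filter.Tendsto (fun n => T (x n)) U (𝓝 (p + (0 : ℝ) • (q - x₀))) := by
    simp only [hTx]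
    exact hxp.add ((tendsto_one_div_add_atTop_nhds_zero_nat.mono_left hU).smul
      (hyq.sub tendsto_const_nhds))
  exact ⟨p, hp, by simpa using tendsto_nhds_unique h1 h2⟩

/-- **Markov–Kakutani**: commuting continuous affine self-maps of a compact convex set have a common
fixed point. -/
theorem exists_common_fixedPoint [IsTopologicalAddGroup E] [ContinuousSMul ℝ E] [T2Space E]
    {ι : Type*} {T : ι → E → E} {P : Set E} (hP : IsCompact P) (hc : Convex ℝ P) (hne : P.Nonempty)
    (hT : ∀ i, Set.MapsTo (T i) P P) (hcont : ∀ i, ContinuousOn (T i) P)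
    (haff : ∀ i, AffineOn (T i) P) (hcomm : ∀ i j, ∀ x ∈ P, T i (T j x) = T j (T i x)) :
    ∃ p ∈ P, ∀ i, T i p = p := by
  classical
  have hcl : ∀ i, IsClosed {x | x ∈ P ∧ T i x = x} := fun i => isClosed_fixedPoints hP (hcont i)
  -- By compactness finite subfamilies suffice. The common fixed set of a finite subfamily is
  -- compact and convex, and commutation makes it stable under one more map. Intersecting with `P`
  -- takes care of the empty subfamily.
  have hfin : ∀ s : Finset ι, (P ∩ ⋂ i ∈ s, {x | x ∈ P ∧ T i x = x}).Nonempty := by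
    intro s
    induction s using Finset.induction_on with
    | empty => simpa using hne
    | insert j s _ ih =>
      set F := P ∩ ⋂ i ∈ s, {x | x ∈ P ∧ T i x = x} with hF
      have hmem : ∀ x, x ∈ F ↔ x ∈ P ∧ ∀ i ∈ s, T i x = x := by
        intro x
        simp only [hF, Set.mem_inter_iff, Set.mem_iInter, Set.mem_ofPred_eq]
        exact ⟨fun h => ⟨h.1, fun i hi => (h.2 i hi).2⟩, fun h => ⟨h.1, fun i hi => ⟨h.1, h.2 i hi⟩⟩⟩
      have hFP : F ⊆ P := Set.inter_subset_left
      have hFc : IsCompact F := hP.inter_right (isClosed_biInter fun i _ => hcl i)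
      obtain ⟨p, hp, hpj⟩ := exists_fixedPoint (T := T j) hFc (by
          intro x hx y hy a b ha hb hab
          rw [hmem] at hx hy ⊢
          refine ⟨hc hx.1 hy.1 ha hb hab, fun i hi => ?_⟩
          rw [haff i x hx.1 y hy.1 a b ha hb hab, hx.2 i hi, hy.2 i hi]) ih (by
          intro x hx
          rw [hmem] at hx ⊢
          refine ⟨hT j hx.1, fun i hi => ?_⟩
          rw [hcomm i j x hx.1, hx.2 i hi]) ((hcont j).mono hFP)
        (fun x hx y hy => haff j x (hFP hx) y (hFP hy))
      refine ⟨p, hFP hp, Set.mem_iInter₂.2 fun i hi => ?_⟩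
      rcases Finset.mem_insert.1 hi with rfl | hi
      · exact ⟨hFP hp, hpj⟩
      · exact ⟨hFP hp, ((hmem p).1 hp).2 i hi⟩
  obtain ⟨p, hp, h⟩ := hP.inter_iInter_nonempty _ hcl hfin
  exact ⟨p, hp, fun i => (Set.mem_iInter.1 h i).2⟩

end MarkovKakutani

/-! ### The system of probability measures on the circle -/

/-- A finite measure as a functional on continuous functions. -/
def measureFunctional (ν : Measure Circle) [IsFiniteMeasure ν] : WeakDual ℝ C(Circle, ℝ) :=
  StrongDual.toWeakDual
    ⟨{ toFun := fun f => ∫ ζ, f ζ ∂ν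
       map_add' := fun f g => integral_add (continuous_integrable f.continuous ν)
         (continuous_integrable g.continuous ν)
       map_smul' := fun c _ => integral_const_mul c _ }, continuous_integral_left ν⟩

lemma measureFunctional_apply (ν : Measure Circle) [IsFiniteMeasure ν] (f : C(Circle, ℝ)) :
    measureFunctional ν f = ∫ ζ, f ζ ∂ν := rfl

lemma weakDual_ext {ξ ξ' : WeakDual ℝ C(Circle, ℝ)} (h : ∀ f, ξ f = ξ' f) : ξ = ξ' :=
  DFunLike.ext _ _ h

lemma measureFunctional_mem (ν : Measure Circle) [hν : IsProbabilityMeasure ν] :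
    measureFunctional ν ∈ probCircle := ⟨⟨ν, hν⟩, fun _ => rfl⟩

lemma exists_of_mem_probCircle {ξ : WeakDual ℝ C(Circle, ℝ)} (hξ : ξ ∈ probCircle) :
    ∃ (ν : Measure Circle) (_ : IsProbabilityMeasure ν), ξ = measureFunctional ν := by
  obtain ⟨ν, hν⟩ := hξ
  exact ⟨ν, ν.2, weakDual_ext hν⟩

lemma isCompact_probCircle : IsCompact probCircle := by
  have h : probCircle = Set.range fun ν : ProbabilityMeasure Circle =>
      measureFunctional (ν : Measure Circle) := by
    ext ξ
    constructor
    · rintro ⟨ν, hν⟩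
      exact ⟨ν, (weakDual_ext hν).symm⟩
    · rintro ⟨ν, rfl⟩
      exact measureFunctional_mem _
  rw [h]
  refine isCompact_range (WeakDual.continuous_of_continuous_eval fun f => ?_)
  exact ProbabilityMeasure.continuous_integral_boundedContinuousFunction
    (BoundedContinuousFunction.mkOfCompact f)

lemma convex_probCircle : Convex ℝ probCircle := by
  intro ξ hξ ξ' hξ' a b ha hb hab
  obtain ⟨ν, hν, rfl⟩ := exists_of_mem_probCircle hξ
  obtain ⟨ν', hν', rfl⟩ := exists_of_mem_probCircle hξ'
  have h : IsProbabilityMeasure (ENNReal.ofReal a • ν + ENNReal.ofReal b • ν') := by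
    constructor
    simp only [Measure.add_apply, Measure.smul_apply, measure_univ, smul_eq_mul, mul_one]
    rw [← ENNReal.ofReal_add ha hb, hab, ENNReal.ofReal_one]
  have e : a • measureFunctional ν + b • measureFunctional ν' =
      measureFunctional (ENNReal.ofReal a • ν + ENNReal.ofReal b • ν') := by
    refine weakDual_ext fun f => ?_
    have h1 := (continuous_integrable f.continuous ν).smul_measure (c := ENNReal.ofReal a)
      ENNReal.ofReal_ne_top
    have h2 := (continuous_integrable f.continuous ν').smul_measure (c := ENNReal.ofReal b)
      ENNReal.ofReal_ne_top
    rw [measureFunctional_apply, integral_add_measure h1 h2, integral_smul_measure,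
      integral_smul_measure, ENNReal.toReal_ofReal ha, ENNReal.toReal_ofReal hb]
    rfl
  rw [e]
  exact measureFunctional_mem _

lemma pushCircle_measureFunctional (g : G) (ν : Measure Circle) [IsFiniteMeasure ν] :
    pushCircle g (measureFunctional ν) = measureFunctional (ν.map fun ζ => g • ζ) := by
  refine weakDual_ext fun f => ?_
  rw [pushCircle_apply, measureFunctional_apply, measureFunctional_apply,
    integral_map (measurable_smul_circle g).aemeasurable f.continuous.aestronglyMeasurable]
  rfl

lemma pushCircle_mem (g : G) {ξ : WeakDual ℝ C(Circle, ℝ)} (hξ : ξ ∈ probCircle) :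
    pushCircle g ξ ∈ probCircle := by
  obtain ⟨ν, hν, rfl⟩ := exists_of_mem_probCircle hξ
  have : IsProbabilityMeasure (ν.map fun ζ => g • ζ) :=
    Measure.isProbabilityMeasure_map (measurable_smul_circle g).aemeasurable
  rw [pushCircle_measureFunctional]
  exact measureFunctional_mem _

lemma pushCircle_one (ξ : WeakDual ℝ C(Circle, ℝ)) : pushCircle 1 ξ = ξ := by
  refine weakDual_ext fun f => ?_
  rw [pushCircle_apply]
  congr 1
  ext ζ
  simp

lemma pushCircle_mul (g g' : G) (ξ : WeakDual ℝ C(Circle, ℝ)) :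
    pushCircle (g * g') ξ = pushCircle g (pushCircle g' ξ) := by
  refine weakDual_ext fun f => ?_
  rw [pushCircle_apply, pushCircle_apply, pushCircle_apply]
  congr 1
  ext ζ
  simp [mul_smul]

lemma pushCircle_affine (g : G) (ξ ξ' : WeakDual ℝ C(Circle, ℝ)) (s t : ℝ) :
    pushCircle g (s • ξ + t • ξ') = s • pushCircle g ξ + t • pushCircle g ξ' := rfl

lemma continuous_pushCircle (g : G) : Continuous (pushCircle g) :=
  WeakDual.continuous_of_continuous_eval fun f => by
    simp only [pushCircle_apply]
    exact WeakDual.eval_continuous _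

lemma abs_apply_le_of_mem_probCircle {ξ : WeakDual ℝ C(Circle, ℝ)} (hξ : ξ ∈ probCircle)
    (f : C(Circle, ℝ)) : |ξ f| ≤ ‖f‖ := by
  obtain ⟨ν, hν, rfl⟩ := exists_of_mem_probCircle hξ
  have := norm_integral_le_of_norm_le_const (μ := ν) (Filter.Eventually.of_forall f.norm_coe_le_norm)
  rw [measureFunctional_apply]
  simpa using this

/-- Continuity of `g ↦ f ∘ g` in the uniform norm. -/
lemma continuous_comp_smul (f : C(Circle, ℝ)) : Continuous fun g : G =>
    f.comp ⟨fun ζ : Circle => g • ζ, continuous_const_smul g⟩ := by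
  have := (ContinuousMap.curry ⟨fun p : G × Circle => f (p.1 • p.2),
    f.continuous.comp continuous_smul_circle⟩).continuous
  exact this

/-- Split ξ(f∘g) = ξ(f∘g - f∘g₀) + ξ(f∘g₀). A probability functional bounds the first term by a
uniform norm that tends to 0; the second is weak* continuous in ξ. -/
lemma continuousOn_pushCircle :
    ContinuousOn (fun p : G × WeakDual ℝ C(Circle, ℝ) => pushCircle p.1 p.2)
      (Set.univ ×ˢ probCircle) := by
  rw [continuousOn_iff_continuous_domRestrict]
  refine WeakDual.continuous_of_continuous_eval fun f => ?_
  rw [continuous_iff_continuousAt]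
  rintro ⟨⟨g₀, ξ₀⟩, hp₀⟩
  have h1 : Filter.Tendsto (fun p : ↥((Set.univ : Set G) ×ˢ probCircle) =>
      p.1.2 (f.comp ⟨fun ζ : Circle => g₀ • ζ, continuous_const_smul g₀⟩))
      (𝓝 ⟨(g₀, ξ₀), hp₀⟩) (𝓝 (pushCircle g₀ ξ₀ f)) :=
    ((WeakDual.eval_continuous _).comp (continuous_snd.comp continuous_subtype_val)).tendsto _
  have h2 : Filter.Tendsto (fun p : ↥((Set.univ : Set G) ×ˢ probCircle) =>
      p.1.2 (f.comp ⟨fun ζ : Circle => p.1.1 • ζ, continuous_const_smul p.1.1⟩ -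
        f.comp ⟨fun ζ : Circle => g₀ • ζ, continuous_const_smul g₀⟩))
      (𝓝 ⟨(g₀, ξ₀), hp₀⟩) (𝓝 0) := by
    refine squeeze_zero_norm (fun p => abs_apply_le_of_mem_probCircle p.2.2 _) ?_
    have := (((continuous_comp_smul f).comp
      (continuous_fst.comp continuous_subtype_val)).sub (continuous_const
        (y := f.comp ⟨fun ζ : Circle => g₀ • ζ, continuous_const_smul g₀⟩))).norm.tendsto
      (⟨(g₀, ξ₀), hp₀⟩ : ↥((Set.univ : Set G) ×ˢ probCircle))
    simpa using this
  have h3 := h2.add h1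
  rw [zero_add] at h3
  refine h3.congr fun p => ?_
  rw [map_sub, sub_add_cancel]
  rfl

lemma isAffineSystem_probCircle : IsAffineSystem pushCircle probCircle where
  nonempty := ⟨_, measureFunctional_mem circleMeasure⟩
  isCompact := isCompact_probCircle
  convex := convex_probCircle
  metrizable := WeakDual.metrizable_of_isCompact ℝ _ _ isCompact_probCircle
  mapsTo g _ hξ := pushCircle_mem g hξ
  one ξ _ := pushCircle_one ξ
  mul g g' ξ _ := pushCircle_mul g g' ξ
  continuousOn := continuousOn_pushCircle
  affine g ξ _ η _ s t _ _ _ := pushCircle_affine g ξ η s t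

/-! ### Point masses, the invariant measure, and irreducibility. -/

/-- The point mass at `ζ`. -/
def diracFunctional (ζ : Circle) : WeakDual ℝ C(Circle, ℝ) := measureFunctional (Measure.dirac ζ)

lemma diracFunctional_apply (ζ : Circle) (f : C(Circle, ℝ)) : diracFunctional ζ f = f ζ :=
  integral_dirac _ _

lemma diracFunctional_mem (ζ : Circle) : diracFunctional ζ ∈ probCircle := measureFunctional_mem _

lemma pushCircle_dirac (g : G) (ζ : Circle) :
    pushCircle g (diracFunctional ζ) = diracFunctional (g • ζ) := by
  refine weakDual_ext fun f => ?_
  rw [pushCircle_apply, diracFunctional_apply, diracFunctional_apply]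
  rfl

lemma continuous_diracFunctional : Continuous diracFunctional :=
  WeakDual.continuous_of_continuous_eval fun f => by
    simp only [diracFunctional_apply]
    exact f.continuous

instance : LocallyConvexSpace ℝ (WeakDual ℝ C(Circle, ℝ)) :=
  inferInstanceAs (LocallyConvexSpace ℝ (WeakBilin (topDualPairing ℝ C(Circle, ℝ))))

/-- A closed convex set that contains the point masses contains all probability measures. -/
lemma probCircle_subset_of_dirac {S : Set (WeakDual ℝ C(Circle, ℝ))} (hcl : IsClosed S)
    (hconv : Convex ℝ S) (hd : ∀ ζ, diracFunctional ζ ∈ S) : probCircle ⊆ S := by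
  intro ξ hξ
  by_contra hS
  obtain ⟨L, c, hL, hLξ⟩ := geometric_hahn_banach_closed_point hconv hcl hS
  -- A weak* continuous functional is evaluation at some continuous function, so the separation
  -- becomes a strict inequality between an integral of `f` and its upper bound.
  obtain ⟨f, rfl⟩ := LinearMap.dualEmbedding_surjective (topDualPairing ℝ C(Circle, ℝ)) L
  have h1 : ∀ ζ, f ζ < c := fun ζ => by
    have := hL _ (hd ζ)
    rwa [← diracFunctional_apply]
  obtain ⟨ν, hν, rfl⟩ := exists_of_mem_probCircle hξ
  have h2 : c < ∫ ζ, f ζ ∂ν := hLξ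
  have h3 : ∫ ζ, f ζ ∂ν ≤ ∫ _, c ∂ν :=
    integral_mono (continuous_integrable f.continuous ν) (integrable_const c) fun ζ => (h1 ζ).le
  simp at h3
  linarith

/-- The functional of the rotation-invariant measure. -/
def circleFunctional : WeakDual ℝ C(Circle, ℝ) := measureFunctional circleMeasure

lemma circleFunctional_mem : circleFunctional ∈ probCircle := measureFunctional_mem _

lemma pushCircle_rotation_circleFunctional (ζ : Circle) :
    pushCircle (rotation ζ) circleFunctional = circleFunctional := by
  refine weakDual_ext fun f => ?_
  rw [pushCircle_apply, circleFunctional, measureFunctional_apply, measureFunctional_apply,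
    ← integral_mul_circle f ζ]
  simp [rotation_smul_circle]

/-- The only rotation-invariant probability measure is the standard one. -/
lemma eq_circleFunctional {ξ : WeakDual ℝ C(Circle, ℝ)} (hξ : ξ ∈ probCircle)
    (h : ∀ ζ, pushCircle (rotation ζ) ξ = ξ) : ξ = circleFunctional := by
  obtain ⟨ν, hν, rfl⟩ := exists_of_mem_probCircle hξ
  refine weakDual_ext fun f => ?_
  have h1 : ∀ ζ, ∫ x, f (ζ * x) ∂ν = ∫ x, f x ∂ν := fun ζ => by
    have h2 := DFunLike.congr_fun (h ζ) f
    rw [pushCircle_apply, measureFunctional_apply, measureFunctional_apply] at h2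
    simpa [rotation_smul_circle] using h2
  have hc : Continuous (Function.uncurry fun ζ x : Circle => f (ζ * x)) := by fun_prop
  -- Averaging the invariance over all rotations and exchanging integrals replaces the inner
  -- integral by the constant ∫ f dm.
  have h2 : ∫ ζ, ∫ x, f (ζ * x) ∂ν ∂circleMeasure = ∫ x, ∫ ζ, f (ζ * x) ∂circleMeasure ∂ν :=
    integral_integral_swap
      (hc.integrable_of_hasCompactSupport (HasCompactSupport.of_compactSpace _))
  simp only [h1, mul_comm _ (_ : Circle)] at h2
  simp only [integral_mul_circle] at h2
  rw [circleFunctional, measureFunctional_apply, measureFunctional_apply]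
  simpa using h2

/-- A nonempty closed convex rotation-invariant set of probability measures contains the
rotation-invariant measure. -/
lemma circleFunctional_mem_of_invariant {S : Set (WeakDual ℝ C(Circle, ℝ))} (hS : S ⊆ probCircle)
    (hne : S.Nonempty) (hcl : IsClosed S) (hconv : Convex ℝ S)
    (hinv : ∀ ζ, Set.MapsTo (pushCircle (rotation ζ)) S S) : circleFunctional ∈ S := by
  have hcomp : IsCompact S := isCompact_probCircle.of_isClosed_subset hcl hS
  obtain ⟨ξ, hξ, h⟩ := exists_common_fixedPoint (T := fun ζ : Circle => pushCircle (rotation ζ))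
    hcomp hconv hne hinv
    (fun ζ => (continuous_pushCircle (rotation ζ)).continuousOn)
    (fun ζ ξ _ ξ' _ s t _ _ _ => pushCircle_affine _ ξ ξ' s t)
    (fun ζ ζ' ξ _ => by
      rw [← pushCircle_mul, ← pushCircle_mul, ← map_mul, ← map_mul, mul_comm])
  rwa [← eq_circleFunctional (hS hξ) h]

/-- The point -1 is fixed by the boosts along the real axis, so it alone is not drawn to 1; it has
to be negligible. -/
lemma circleMeasure_singleton_neg_one : circleMeasure {(-1 : Circle)} = 0 := by
  rw [circleMeasure, Measure.map_apply Circle.exp.continuous.measurable (measurableSet_singleton _),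
    Measure.smul_apply]
  have : (Circle.exp ⁻¹' {(-1 : Circle)}).Countable := by
    refine (Set.countable_range fun n : ℤ => Real.pi + n * (2 * Real.pi)).mono fun θ hθ => ?_
    have h1 : Circle.exp θ = Circle.exp Real.pi := by
      rw [Set.mem_preimage, Set.mem_singleton_iff] at hθ
      rw [hθ]
      apply Circle.ext
      simp
    obtain ⟨n, hn⟩ := Circle.exp_eq_exp.1 h1
    exact ⟨n, hn.symm⟩
  rw [this.measure_zero]
  simp

/-- The real numbers `1 - 1 / (n + 1)` as points of the disc. -/
def radial (n : ℕ) : 𝔻 := UnitDisc.mk ((1 - 1 / ((n : ℝ) + 1) : ℝ) : ℂ) (by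
  have h : 0 < 1 / ((n : ℝ) + 1) := by positivity
  have h1 : 1 / ((n : ℝ) + 1) ≤ 1 := by
    rw [div_le_one (by positivity)]
    linarith [(Nat.cast_nonneg n : (0 : ℝ) ≤ n)]
  rw [norm_real, Real.norm_of_nonneg (by linarith)]
  linarith)

lemma tendsto_radial : Filter.Tendsto (fun n => (radial n : ℂ)) Filter.atTop (𝓝 1) := by
  have h := (tendsto_const_nhds (x := (1 : ℝ))).sub (tendsto_one_div_add_atTop_nhds_zero_nat (𝕜 := ℝ))
  rw [sub_zero] at h
  exact (continuous_ofReal.tendsto 1).comp h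

lemma tendsto_boost_radial {ζ : Circle} (hζ : ζ ≠ -1) :
    Filter.Tendsto (fun n => boost (radial n) • ζ) Filter.atTop (𝓝 1) := by
  have he : IsEmbedding fun ζ : Circle => (ζ : ℂ) := IsEmbedding.subtypeVal
  rw [he.tendsto_nhds_iff]
  have h1 : (ζ : ℂ) + 1 ≠ 0 := by
    intro h
    apply hζ
    apply Circle.ext
    rw [Circle.coe_neg, Circle.coe_one]
    exact eq_neg_of_add_eq_zero_left h
  have h2 : Filter.Tendsto (fun n => ((ζ : ℂ) + radial n) / (radial n * ζ + 1)) Filter.atTop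
      (𝓝 ((ζ + 1) / (1 * ζ + 1))) :=
    (tendsto_const_nhds.add tendsto_radial).div
      ((tendsto_radial.mul tendsto_const_nhds).add tendsto_const_nhds) (by simpa using h1)
  rw [one_mul, div_self h1] at h2
  refine h2.congr fun n => ?_
  have : conj (radial n : ℂ) = radial n := conj_ofReal _
  simp only [Function.comp_apply]
  rw [coe_boost_smul_circle, this]

/-- Dominated convergence: almost every point of the circle is carried to 1 by the boosts. -/
lemma tendsto_pushCircle_boost :
    Filter.Tendsto (fun n => pushCircle (boost (radial n)) circleFunctional) Filter.atTop
      (𝓝 (diracFunctional 1)) := by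
  rw [tendsto_iff_forall_eval_tendsto_topDualPairing]
  intro f
  change Filter.Tendsto (fun n => ∫ ζ, f (boost (radial n) • ζ) ∂circleMeasure) Filter.atTop
    (𝓝 (diracFunctional 1 f))
  rw [diracFunctional_apply]
  have h0 : ∀ᵐ ζ ∂circleMeasure, ζ ≠ -1 := by
    rw [ae_iff]
    simpa using circleMeasure_singleton_neg_one
  have h1 : ∫ _ : Circle, f 1 ∂circleMeasure = f 1 := by simp
  rw [← h1]
  refine tendsto_integral_of_dominated_convergence (fun _ => ‖f‖)
    (fun n => (f.continuous.comp (continuous_const_smul _)).aestronglyMeasurable)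
    (integrable_const _) (fun n => Filter.Eventually.of_forall fun ζ => f.norm_coe_le_norm _) ?_
  filter_upwards [h0] with ζ hζ
  exact (f.continuous.tendsto 1).comp (tendsto_boost_radial hζ)

/-- Serves below as an induction principle: a closed, convex, invariant condition that holds at m
holds for every probability measure. -/
lemma probCircle_subset_of_invariant {S : Set (WeakDual ℝ C(Circle, ℝ))} (hcl : IsClosed S)
    (hconv : Convex ℝ S) (hinv : ∀ g, Set.MapsTo (pushCircle g) S S) (hS : circleFunctional ∈ S) :
    probCircle ⊆ S := by
  have h1 : diracFunctional 1 ∈ S := hcl.mem_of_tendsto tendsto_pushCircle_boost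
    (Filter.Eventually.of_forall fun n => hinv _ hS)
  refine probCircle_subset_of_dirac hcl hconv fun ζ => ?_
  have := hinv (rotation ζ) h1
  rwa [pushCircle_dirac, rotation_smul_circle, mul_one] at this

theorem isIrreducibleAffineSystem_probCircle : IsIrreducibleAffineSystem pushCircle probCircle where
  toIsAffineSystem := isAffineSystem_probCircle
  eq_of_subset _ hS hne hcl hconv hinv := hS.antisymm
    (probCircle_subset_of_invariant hcl hconv hinv
      (circleFunctional_mem_of_invariant hS hne hcl hconv fun _ => hinv _))

/-! ### The stabilizer of a boundary point -/

namespace SU11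

/-- The parabolic matrices that fix `1`. -/
def parabolic (t : ℝ) : SU11 := ofAC (1 + t * I) (t * I) (by
  simp only [map_add, map_one, map_mul, conj_ofReal, conj_I]
  ring)

/-- The diagonalizable matrices that fix `1` and `-1`. -/
def hyperbolic (l : ℝˣ) : SU11 := ofAC ((l + (l : ℂ)⁻¹) / 2) ((l - (l : ℂ)⁻¹) / 2) (by
  have h : (l : ℂ) ≠ 0 := by exact_mod_cast l.ne_zero
  simp only [map_add, map_sub, map_div₀, map_inv₀, conj_ofReal, map_ofNat]
  field_simp
  ring)

lemma parabolic_mul (s t : ℝ) : parabolic s * parabolic t = parabolic (s + t) := by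
  apply ext_ac <;> simp only [parabolic, a_mul, c_mul, a_ofAC, c_ofAC, map_add, map_one, map_mul,
    conj_ofReal, conj_I, ofReal_add] <;> ring

lemma hyperbolic_mul (l m : ℝˣ) : hyperbolic l * hyperbolic m = hyperbolic (l * m) := by
  have h : (l : ℂ) ≠ 0 := by exact_mod_cast l.ne_zero
  have h' : (m : ℂ) ≠ 0 := by exact_mod_cast m.ne_zero
  apply ext_ac <;> simp only [hyperbolic, a_mul, c_mul, a_ofAC, c_ofAC, map_add, map_sub, map_div₀,
    map_inv₀, conj_ofReal, map_ofNat, Units.val_mul, ofReal_mul] <;> field_simp <;> ring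

/-- The hyperbolic matrices normalize the parabolic ones, so they act on the set of parabolic fixed
points. -/
lemma parabolic_mul_hyperbolic (t : ℝ) (l : ℝˣ) :
    parabolic t * hyperbolic l = hyperbolic l * parabolic (t / (l : ℝ) ^ 2) := by
  have h : (l : ℂ) ≠ 0 := by exact_mod_cast l.ne_zero
  apply ext_ac <;> simp only [parabolic, hyperbolic, a_mul, c_mul, a_ofAC, c_ofAC, map_add, map_sub,
    map_div₀, map_inv₀, conj_ofReal, map_ofNat, map_one, map_mul, conj_I, ofReal_div,
    ofReal_pow] <;> field_simp <;> ring

lemma exists_eq_parabolic_mul_hyperbolic {A : SU11} (hA : A • (1 : Circle) = 1) :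
    ∃ t l, A = parabolic t * hyperbolic l := by
  have h0 := congrArg (fun z : Circle => (z : ℂ)) hA
  simp only [coe_smul_circle] at h0
  have hd := A.denom_ne_zero (z := 1) (by simp)
  rw [Circle.coe_one, mul_one, mul_one, div_eq_one_iff_eq (by simpa using hd)] at h0
  have him : A.a.im = A.c.im := by
    have := congrArg im h0
    simp at this
    linarith
  have hdet := A.normSq_eq
  rw [normSq_apply, normSq_apply, him] at hdet
  have hdet' : (A.a.re + A.c.re) * (A.a.re - A.c.re) = 1 := by linarith
  -- Fixing 1 means Im a = Im c, and the determinant condition becomes (Re a + Re c)(Re a - Re c) =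
  -- 1. So Re a + Re c is a unit, possibly negative because -1 also fixes the point. Comparing
  -- imaginary parts of `a` gives t = l · Im a.
  let l : ℝˣ := ⟨A.a.re + A.c.re, A.a.re - A.c.re, hdet', by rw [mul_comm]; exact hdet'⟩
  have hl : (l : ℂ)⁻¹ = ((A.a.re - A.c.re : ℝ) : ℂ) := by
    rw [← ofReal_inv]
    congr 1
    exact inv_eq_of_mul_eq_one_right hdet'
  have hl' : (l : ℂ) = ((A.a.re + A.c.re : ℝ) : ℂ) := rfl
  have hdet'' : ((A.a.re : ℂ) + A.c.re) * (A.a.re - A.c.re) = 1 := by exact_mod_cast hdet'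
  refine ⟨A.a.im * (A.a.re + A.c.re), l, ?_⟩
  apply ext_ac
  · simp only [parabolic, hyperbolic, a_mul, a_ofAC, c_ofAC, map_mul, conj_ofReal, conj_I, hl]
    rw [hl']
    push_cast
    nth_rewrite 1 [← re_add_im A.a]
    linear_combination (-(A.a.im : ℂ) * I) * hdet''
  · simp only [parabolic, hyperbolic, c_mul, a_ofAC, c_ofAC, map_add, map_one, map_mul, conj_ofReal,
      conj_I, hl]
    rw [hl']
    push_cast
    nth_rewrite 1 [← re_add_im A.c]
    rw [← him]
    linear_combination (-(A.a.im : ℂ) * I) * hdet''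

end SU11

/-! ### Universality of the system of probability measures -/

section Universal

variable {E : Type*} [AddCommGroup E] [Module ℝ E] [TopologicalSpace E] {σ : G → E → E} {P : Set E}

lemma IsAffineSystem.continuousOn_apply (h : IsAffineSystem σ P) (g : G) : ContinuousOn (σ g) P :=
  h.continuousOn.comp (f := fun x => (g, x)) (by fun_prop) fun _ hx => ⟨trivial, hx⟩

lemma IsAffineSystem.continuous_orbit (h : IsAffineSystem σ P) {x : E} (hx : x ∈ P) :
    Continuous fun g => σ g x := by
  rw [← continuousOn_univ]
  exact h.continuousOn.comp (f := fun g => (g, x)) (by fun_prop) fun _ _ => ⟨trivial, hx⟩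

/-- Markov–Kakutani is applied twice: to the parabolic group on `P`, then to the hyperbolic group on
the compact convex set of parabolic fixed points. Together the two groups generate the stabilizer of
1. -/
lemma IsAffineSystem.exists_fixed_by_stabilizer [IsTopologicalAddGroup E] [ContinuousSMul ℝ E]
    [T2Space E] (h : IsAffineSystem σ P) :
    ∃ p ∈ P, ∀ g : G, g • (1 : Circle) = 1 → σ g p = p := by
  let N : ℝ → E → E := fun t => σ (QuotientGroup.mk (SU11.parabolic t))
  let H : ℝˣ → E → E := fun l => σ (QuotientGroup.mk (SU11.hyperbolic l))
  have hmul : ∀ A B : SU11, ∀ x ∈ P, σ (QuotientGroup.mk A) (σ (QuotientGroup.mk B) x) =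
      σ (QuotientGroup.mk (A * B)) x := fun A B x hx => (h.mul _ _ x hx).symm
  have hNN : ∀ s t, ∀ x ∈ P, N s (N t x) = N t (N s x) := fun s t x hx => by
    simp only [N]
    rw [hmul _ _ x hx, hmul _ _ x hx, SU11.parabolic_mul, SU11.parabolic_mul, add_comm]
  have hHH : ∀ s t, ∀ x ∈ P, H s (H t x) = H t (H s x) := fun s t x hx => by
    simp only [H]
    rw [hmul _ _ x hx, hmul _ _ x hx, SU11.hyperbolic_mul, SU11.hyperbolic_mul, mul_comm]
  have hNH : ∀ t l, ∀ x ∈ P, N t (H l x) = H l (N (t / (l : ℝ) ^ 2) x) := fun t l x hx => by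
    simp only [N, H]
    rw [hmul _ _ x hx, hmul _ _ x hx, SU11.parabolic_mul_hyperbolic]
  let F : Set E := {x | x ∈ P ∧ ∀ t, N t x = x}
  have hFP : F ⊆ P := fun x hx => hx.1
  have hFne : F.Nonempty := by
    obtain ⟨p, hp, hfix⟩ := exists_common_fixedPoint (T := N) h.isCompact h.convex h.nonempty
      (fun _ => h.mapsTo _) (fun _ => h.continuousOn_apply _) (fun _ => h.affine _) hNN
    exact ⟨p, hp, hfix⟩
  have hFcl : IsClosed F := by
    have : F = ⋂ t, {x | x ∈ P ∧ N t x = x} := by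
      ext x
      simp only [F, Set.mem_iInter, Set.mem_ofPred_eq]
      exact ⟨fun hx t => ⟨hx.1, hx.2 t⟩, fun hx => ⟨(hx 0).1, fun t => (hx t).2⟩⟩
    rw [this]
    exact isClosed_iInter fun t => isClosed_fixedPoints h.isCompact (h.continuousOn_apply _)
  have hFconv : Convex ℝ F := fun x hx y hy a b ha hb hab =>
    ⟨h.convex hx.1 hy.1 ha hb hab, fun t => by
      simp only [N]
      rw [h.affine _ x hx.1 y hy.1 a b ha hb hab]
      exact congrArg₂ _ (congrArg _ (hx.2 t)) (congrArg _ (hy.2 t))⟩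
  obtain ⟨p, hp, hfix⟩ := exists_common_fixedPoint (T := H)
    (h.isCompact.of_isClosed_subset hFcl hFP) hFconv hFne
    (fun l x hx => ⟨h.mapsTo _ hx.1, fun t => by rw [hNH t l x hx.1, hx.2]⟩)
    (fun l => (h.continuousOn_apply _).mono hFP)
    (fun l x hx y hy => h.affine _ x (hFP hx) y (hFP hy))
    (fun s t x hx => hHH s t x (hFP hx))
  refine ⟨p, hFP hp, fun g hg => ?_⟩
  obtain ⟨A, rfl⟩ := QuotientGroup.mk_surjective g
  obtain ⟨t, l, rfl⟩ := SU11.exists_eq_parabolic_mul_hyperbolic hg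
  rw [← hmul _ _ p (hFP hp)]
  exact (congrArg (N t) (hfix l)).trans (hp.2 t)

/-- `x` is a barycenter of the image of the measure `ξ` under `b`, with respect to all continuous
affine functions on `P`. -/
def IsBarycenter (b : Circle → E) (P : Set E) (ξ : WeakDual ℝ C(Circle, ℝ)) (x : E) : Prop :=
  ξ ∈ probCircle ∧ x ∈ P ∧ ∀ u : E → ℝ, ContinuousOn u P → AffineOn u P →
    ∀ f : C(Circle, ℝ), (∀ ζ, f ζ = u (b ζ)) → u x = ξ f

/-- Used twice: projecting this compact set shows that the measures with a barycenter form a closed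
set, and a closed graph with compact target makes the barycenter map continuous. -/
lemma isClosed_isBarycenter [T2Space E] (hP : IsCompact P) (b : Circle → E) :
    IsClosed {q : WeakDual ℝ C(Circle, ℝ) × E | IsBarycenter b P q.1 q.2} := by
  have h0 : IsClosed (probCircle ×ˢ P) := isCompact_probCircle.isClosed.prod hP.isClosed
  have h1 : {q : WeakDual ℝ C(Circle, ℝ) × E | IsBarycenter b P q.1 q.2} =
      (probCircle ×ˢ P) ∩ ⋂ (u : E → ℝ) (_ : ContinuousOn u P) (_ : AffineOn u P)
        (f : C(Circle, ℝ)) (_ : ∀ ζ, f ζ = u (b ζ)),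
        -- Each condition is cut down to `probCircle ×ˢ P` because `u` is continuous only on `P`.
        (probCircle ×ˢ P) ∩ (fun q => u q.2 - q.1 f) ⁻¹' {0} := by
    ext q
    simp only [IsBarycenter, Set.mem_inter_iff, Set.mem_iInter, Set.mem_prod, Set.mem_ofPred_eq,
      Set.mem_preimage, Set.mem_singleton_iff, sub_eq_zero]
    constructor
    · rintro ⟨h1, h2, h3⟩
      exact ⟨⟨h1, h2⟩, fun u hu hu' f hf => ⟨⟨h1, h2⟩, h3 u hu hu' f hf⟩⟩
    · rintro ⟨⟨h1, h2⟩, h3⟩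
      exact ⟨h1, h2, fun u hu hu' f hf => (h3 u hu hu' f hf).2⟩
  rw [h1]
  refine h0.inter (isClosed_iInter fun u => isClosed_iInter fun hu => isClosed_iInter fun _ =>
    isClosed_iInter fun f => isClosed_iInter fun _ => ?_)
  refine ContinuousOn.preimage_isClosed_of_isClosed ?_ h0 isClosed_singleton
  exact (hu.comp continuousOn_snd fun q hq => hq.2).sub
    ((WeakDual.eval_continuous f).comp continuous_fst).continuousOn

lemma IsBarycenter.unique [IsTopologicalAddGroup E] [ContinuousSMul ℝ E] [LocallyConvexSpace ℝ E]
    [T2Space E] {b : Circle → E} (hb : Continuous b) {ξ : WeakDual ℝ C(Circle, ℝ)} {x y : E}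
    (hx : IsBarycenter b P ξ x) (hy : IsBarycenter b P ξ y) : x = y := by
  by_contra hne
  obtain ⟨L, hL⟩ := geometric_hahn_banach_point_point hne
  have haff : AffineOn L P := fun x _ y _ s t _ _ _ => by simp
  have h1 := hx.2.2 L L.continuous.continuousOn haff ⟨fun ζ => L (b ζ), by fun_prop⟩ fun _ => rfl
  have h2 := hy.2.2 L L.continuous.continuousOn haff ⟨fun ζ => L (b ζ), by fun_prop⟩ fun _ => rfl
  exact hL.ne (h1.trans h2.symm)

lemma IsBarycenter.convexCombo (hP : Convex ℝ P) {b : Circle → E}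
    {ξ ξ' : WeakDual ℝ C(Circle, ℝ)} {x y : E} (hx : IsBarycenter b P ξ x)
    (hy : IsBarycenter b P ξ' y) {s t : ℝ} (hs : 0 ≤ s) (ht : 0 ≤ t) (hst : s + t = 1) :
    IsBarycenter b P (s • ξ + t • ξ') (s • x + t • y) := by
  refine ⟨convex_probCircle hx.1 hy.1 hs ht hst, hP hx.2.1 hy.2.1 hs ht hst, fun u hu hu' f hf => ?_⟩
  rw [hu' x hx.2.1 y hy.2.1 s t hs ht hst, hx.2.2 u hu hu' f hf, hy.2.2 u hu hu' f hf]
  rfl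

/-- Explains the choice of test functions: continuous affine functions on `P` are stable under
composition with `σ g`, whereas linear functionals on `E` would not be. -/
lemma IsBarycenter.push (h : IsAffineSystem σ P) {b : Circle → E}
    (hb : ∀ (g : G) ζ, b (g • ζ) = σ g (b ζ)) {ξ : WeakDual ℝ C(Circle, ℝ)} {x : E}
    (hx : IsBarycenter b P ξ x) (g : G) : IsBarycenter b P (pushCircle g ξ) (σ g x) := by
  refine ⟨pushCircle_mem g hx.1, h.mapsTo g hx.2.1, fun u hu hu' f hf => ?_⟩
  rw [pushCircle_apply]
  refine hx.2.2 (fun x => u (σ g x)) (hu.comp (h.continuousOn_apply g) (h.mapsTo g)) ?_ _ ?_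
  · intro x hx y hy s t hs ht hst
    simp only
    rw [h.affine g x hx y hy s t hs ht hst, hu' _ (h.mapsTo g hx) _ (h.mapsTo g hy) s t hs ht hst]
  · intro ζ
    rw [← hb]
    exact hf _

theorem IsAffineSystem.exists_affineHom [IsTopologicalAddGroup E] [ContinuousSMul ℝ E]
    [LocallyConvexSpace ℝ E] [T2Space E] (h : IsAffineSystem σ P) :
    ∃ Φ, IsAffineHom pushCircle probCircle σ P Φ := by
  obtain ⟨p, hp, hfix⟩ := h.exists_fixed_by_stabilizer
  let b : Circle → E := fun ζ => σ (rotation ζ) p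
  have hbP : ∀ ζ, b ζ ∈ P := fun ζ => h.mapsTo _ hp
  have hbc : Continuous b := (h.continuous_orbit hp).comp continuous_rotation
  have hb : ∀ (g : G) ζ, b (g • ζ) = σ g (b ζ) := fun g ζ => by
    -- The element rotation(gζ)⁻¹ · g · rotation(ζ) fixes 1, hence fixes `p`; this makes `b`
    -- equivariant.
    have h1 : g * rotation ζ = rotation (g • ζ) * ((rotation (g • ζ))⁻¹ * (g * rotation ζ)) := by
      rw [mul_inv_cancel_left]
    have h2 : ((rotation (g • ζ))⁻¹ * (g * rotation ζ)) • (1 : Circle) = 1 := by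
      rw [mul_smul, inv_smul_eq_iff, mul_smul, rotation_smul_circle, rotation_smul_circle, mul_one,
        mul_one]
    simp only [b]
    rw [← h.mul _ _ p hp, h1, h.mul _ _ p hp, hfix _ h2]
  have hcl := isClosed_isBarycenter h.isCompact b
  -- The measures that have a barycenter form a closed convex set containing the point masses, hence
  -- all of M.
  let S : Set (WeakDual ℝ C(Circle, ℝ)) := {ξ | ∃ x, IsBarycenter b P ξ x}
  have hScl : IsClosed S := by
    have hK : IsCompact {q : WeakDual ℝ C(Circle, ℝ) × E | IsBarycenter b P q.1 q.2} :=
      (isCompact_probCircle.prod h.isCompact).of_isClosed_subset hcl fun q hq => ⟨hq.1, hq.2.1⟩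
    have : S = Prod.fst '' {q : WeakDual ℝ C(Circle, ℝ) × E | IsBarycenter b P q.1 q.2} := by
      ext ξ
      simp [S]
    rw [this]
    exact (hK.image continuous_fst).isClosed
  have hS : probCircle ⊆ S := by
    refine probCircle_subset_of_dirac hScl ?_ fun ζ => ?_
    · rintro ξ ⟨x, hx⟩ ξ' ⟨y, hy⟩ s t hs ht hst
      exact ⟨_, hx.convexCombo h.convex hy hs ht hst⟩
    · refine ⟨b ζ, diracFunctional_mem ζ, hbP ζ, fun u hu hu' f hf => ?_⟩
      rw [diracFunctional_apply, hf]
  have hex : ∀ ξ, ∃ x, ξ ∈ probCircle → IsBarycenter b P ξ x := fun ξ => by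
    by_cases hξ : ξ ∈ probCircle
    · obtain ⟨x, hx⟩ := hS hξ
      exact ⟨x, fun _ => hx⟩
    · exact ⟨0, fun h => absurd h hξ⟩
  choose Φ hΦ' using hex
  have hΦ : ∀ {ξ}, ξ ∈ probCircle → IsBarycenter b P ξ (Φ ξ) := fun {ξ} hξ => hΦ' ξ hξ
  refine ⟨Φ, fun ξ hξ => (hΦ hξ).2.1, ?_, fun g ξ hξ => ?_, fun ξ hξ ξ' hξ' s t hs ht hst => ?_⟩
  · intro ξ hξ
    rw [ContinuousWithinAt, Filter.tendsto_iff_ultrafilter]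
    intro U hU
    have hUM : probCircle ∈ U := hU (self_mem_nhdsWithin)
    obtain ⟨y, hy, hlim⟩ := h.isCompact.ultrafilter_le_nhds (U.map Φ)
      (Filter.tendsto_principal.2 (Filter.mem_of_superset hUM fun ξ hξ => (hΦ hξ).2.1))
    have h1 : IsBarycenter b P ξ y := by
      have h2 : Filter.Tendsto (fun ξ => (ξ, Φ ξ)) U (𝓝 (ξ, y)) :=
        (Filter.tendsto_id'.2 (hU.trans nhdsWithin_le_nhds)).prodMk_nhds hlim
      exact hcl.mem_of_tendsto h2 (Filter.mem_of_superset hUM fun ξ hξ => hΦ hξ)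
    rw [(hΦ hξ).unique hbc h1]
    exact hlim
  · exact (hΦ (pushCircle_mem g hξ)).unique hbc ((hΦ hξ).push h hb g)
  · exact (hΦ (convex_probCircle hξ hξ' hs ht hst)).unique hbc
      ((hΦ hξ).convexCombo h.convex (hΦ hξ') hs ht hst)

variable {Φ Φ' : WeakDual ℝ C(Circle, ℝ) → E}

theorem IsAffineHom.image_eq [T2Space E] (h : IsIrreducibleAffineSystem σ P)
    (hΦ : IsAffineHom pushCircle probCircle σ P Φ) : Φ '' probCircle = P := by
  refine h.eq_of_subset _ hΦ.mapsTo.image_subset ⟨_, _, circleFunctional_mem, rfl⟩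
    (isCompact_probCircle.image_of_continuousOn hΦ.continuousOn).isClosed ?_ ?_
  · rintro _ ⟨ξ, hξ, rfl⟩ _ ⟨ξ', hξ', rfl⟩ s t hs ht hst
    exact ⟨_, convex_probCircle hξ hξ' hs ht hst, hΦ.affine ξ hξ ξ' hξ' s t hs ht hst⟩
  · rintro g _ ⟨ξ, hξ, rfl⟩
    exact ⟨_, pushCircle_mem g hξ, hΦ.equivariant g ξ hξ⟩

/-- In an irreducible system there is only one point fixed by the rotations. -/
lemma IsAffineHom.eq_of_rotation_fixed [T2Space E] (h : IsIrreducibleAffineSystem σ P)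
    (hΦ : IsAffineHom pushCircle probCircle σ P Φ) {y : E} (hy : y ∈ P)
    (hfix : ∀ ζ, σ (rotation ζ) y = y) : Φ circleFunctional = y := by
  -- The fibre over `y` is closed, convex, rotation-invariant and, since Φ is onto, nonempty; it
  -- therefore contains m.
  have hcl : IsClosed (probCircle ∩ Φ ⁻¹' {y}) :=
    hΦ.continuousOn.preimage_isClosed_of_isClosed isCompact_probCircle.isClosed isClosed_singleton
  refine (circleFunctional_mem_of_invariant (S := probCircle ∩ Φ ⁻¹' {y}) Set.inter_subset_left
    ?_ hcl ?_ ?_).2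
  · rw [← hΦ.image_eq h] at hy
    obtain ⟨ξ, hξ, hξy⟩ := hy
    exact ⟨ξ, hξ, hξy⟩
  · rintro ξ ⟨hξ, hξy⟩ ξ' ⟨hξ', hξy'⟩ s t hs ht hst
    refine ⟨convex_probCircle hξ hξ' hs ht hst, ?_⟩
    rw [Set.mem_preimage, Set.mem_singleton_iff] at hξy hξy' ⊢
    rw [hΦ.affine ξ hξ ξ' hξ' s t hs ht hst, hξy, hξy', ← add_smul, hst, one_smul]
  · rintro ζ ξ ⟨hξ, hξy⟩
    refine ⟨pushCircle_mem _ hξ, ?_⟩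
    rw [Set.mem_preimage, Set.mem_singleton_iff] at hξy ⊢
    rw [hΦ.equivariant _ ξ hξ, hξy, hfix]

lemma IsAffineHom.rotation_fixed (hΦ : IsAffineHom pushCircle probCircle σ P Φ) (ζ : Circle) :
    σ (rotation ζ) (Φ circleFunctional) = Φ circleFunctional := by
  rw [← hΦ.equivariant _ _ circleFunctional_mem, pushCircle_rotation_circleFunctional]

/-- The equalizer is closed, convex and invariant. It contains m because both images of m are
rotation-fixed and there is only one such point. -/
theorem IsAffineHom.eqOn [T2Space E] (h : IsIrreducibleAffineSystem σ P)
    (hΦ : IsAffineHom pushCircle probCircle σ P Φ) (hΦ' : IsAffineHom pushCircle probCircle σ P Φ') :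
    Set.EqOn Φ Φ' probCircle := by
  have hcl : IsClosed (probCircle ∩ (fun ξ => (Φ ξ, Φ' ξ)) ⁻¹' Set.diagonal E) :=
    (hΦ.continuousOn.prodMk hΦ'.continuousOn).preimage_isClosed_of_isClosed
      isCompact_probCircle.isClosed isClosed_diagonal
  have hsub := probCircle_subset_of_invariant hcl ?_ ?_ ⟨circleFunctional_mem, ?_⟩
  · exact fun ξ hξ => (hsub hξ).2
  · rintro ξ ⟨hξ, hξe⟩ ξ' ⟨hξ', hξe'⟩ s t hs ht hst
    refine ⟨convex_probCircle hξ hξ' hs ht hst, ?_⟩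
    simp only [Set.mem_preimage, Set.mem_diagonal_iff] at hξe hξe' ⊢
    rw [hΦ.affine ξ hξ ξ' hξ' s t hs ht hst, hΦ'.affine ξ hξ ξ' hξ' s t hs ht hst, hξe, hξe']
  · rintro g ξ ⟨hξ, hξe⟩
    refine ⟨pushCircle_mem _ hξ, ?_⟩
    simp only [Set.mem_preimage, Set.mem_diagonal_iff] at hξe ⊢
    rw [hΦ.equivariant _ ξ hξ, hΦ'.equivariant _ ξ hξ, hξe]
  · exact hΦ.eq_of_rotation_fixed h (hΦ'.mapsTo circleFunctional_mem) hΦ'.rotation_fixed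

end Universal

/-! ### Invariant sets of continuous functions separate measures -/

instance : circleMeasure.IsMulLeftInvariant := ⟨map_mul_circleMeasure⟩

instance : circleMeasure.IsOpenPosMeasure :=
  isOpenPosMeasure_of_mulLeftInvariant_of_compact Set.univ isCompact_univ (by simp)

/-- The Fourier coefficients of a continuous real function. -/
def fourierIntegral (ψ : C(Circle, ℝ)) (n : ℕ) : ℂ := ∫ ζ : Circle, (ζ : ℂ) ^ n * ψ ζ ∂circleMeasure

/-- Adding ‖ψ‖ turns ψ into the density of a finite measure. If all coefficients of positive order
vanish, this measure has the moments of a multiple of m, so its density is constant. -/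
lemma exists_fourierIntegral_ne_zero {ψ : C(Circle, ℝ)} (h : ¬ ∃ c, ∀ ζ, ψ ζ = c) :
    ∃ n, fourierIntegral ψ (n + 1) ≠ 0 := by
  by_contra! h0
  apply h
  have hb : ∀ ζ, 0 ≤ ψ ζ + ‖ψ‖ := fun ζ => by
    have := abs_le.1 (ψ.norm_coe_le_norm ζ)
    linarith [this.1]
  have hc : Continuous fun ζ => ψ ζ + ‖ψ‖ := by fun_prop
  have hm : Measurable fun ζ => ψ ζ + ‖ψ‖ := hc.measurable
  set c := ∫ ζ, (ψ ζ + ‖ψ‖) ∂circleMeasure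
  have hc0 : 0 ≤ c := integral_nonneg hb
  have h1 : IsFiniteMeasure (circleMeasure.withDensity fun ζ => ENNReal.ofReal (ψ ζ + ‖ψ‖)) :=
    isFiniteMeasure_withDensity_ofReal (continuous_integrable hc circleMeasure).2
  have h2 : IsFiniteMeasure (circleMeasure.withDensity fun _ => ENNReal.ofReal c) :=
    isFiniteMeasure_withDensity_ofReal (integrable_const c).2
  have h3 : circleMeasure.withDensity (fun ζ => ENNReal.ofReal (ψ ζ + ‖ψ‖)) =
      circleMeasure.withDensity fun _ => ENNReal.ofReal c := by
    refine measure_circle_ext fun n => ?_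
    rw [integral_withDensity_eq_integral_toReal_smul hm.ennreal_ofReal
      (Filter.Eventually.of_forall fun _ => ENNReal.ofReal_lt_top),
      integral_withDensity_eq_integral_toReal_smul measurable_const
      (Filter.Eventually.of_forall fun _ => ENNReal.ofReal_lt_top)]
    simp only [ENNReal.toReal_ofReal (hb _), ENNReal.toReal_ofReal hc0, integral_smul]
    rw [integral_pow_circleMeasure]
    rcases n with _ | n
    · simp only [pow_zero, real_smul, mul_one]
      rw [integral_complex_ofReal]
    · have h4 : ∀ ζ : Circle, (ψ ζ + ‖ψ‖) • (ζ : ℂ) ^ (n + 1) =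
          (ζ : ℂ) ^ (n + 1) * ψ ζ + (ζ : ℂ) ^ (n + 1) * ‖ψ‖ := fun ζ => by
        rw [real_smul]
        push_cast
        ring
      simp only [h4]
      rw [integral_add (continuous_integrable (by fun_prop) _)
        (continuous_integrable (by fun_prop) _), integral_mul_const, integral_pow_circleMeasure]
      have h5 := h0 n
      rw [fourierIntegral] at h5
      rw [h5]
      simp
  have h4 := (withDensity_eq_iff_of_sigmaFinite hm.ennreal_ofReal.aemeasurable
    aemeasurable_const).1 h3
  have h5 : (fun ζ => ψ ζ + ‖ψ‖) =ᵐ[circleMeasure] fun _ => c := by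
    filter_upwards [h4] with ζ hζ
    exact (ENNReal.ofReal_eq_ofReal_iff (hb ζ) hc0).1 hζ
  have h6 := (hc.ae_eq_iff_eq circleMeasure continuous_const).1 h5
  exact ⟨c - ‖ψ‖, fun ζ => eq_sub_of_add_eq (congrFun h6 ζ)⟩

lemma circle_inv_eq_conj (x : Circle) : (x : ℂ)⁻¹ = conj (x : ℂ) := by
  rw [← Circle.coe_inv, Circle.coe_inv_eq_conj]

lemma integral_pow_mul_rotate (φ : C(Circle, ℝ)) (n : ℕ) (x : Circle) :
    ∫ k : Circle, (k : ℂ) ^ n * φ (k * x) ∂circleMeasure = conj (x : ℂ) ^ n * fourierIntegral φ n := by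
  rw [← integral_mul_circle _ x⁻¹, fourierIntegral, ← integral_const_mul]
  congr 1
  ext k
  rw [mul_comm x⁻¹ k, inv_mul_cancel_right, Circle.coe_mul, Circle.coe_inv, circle_inv_eq_conj]
  ring

/-- By Fubini the Fourier coefficient in k splits into a coefficient of φ times a moment of β. With
β a boost it transfers nonvanishing between orders; with β = id it reads off the moments of `P`. -/
lemma integral_pow_mul_integral (φ : C(Circle, ℝ)) (n : ℕ) (P : Measure Circle)
    [IsProbabilityMeasure P] {β : Circle → Circle} (hβ : Continuous β) {w : Circle → ℂ}
    (hw : Continuous w) :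
    ∫ k : Circle, (k : ℂ) ^ n * ∫ x, w x * φ (k * β x) ∂P ∂circleMeasure =
      fourierIntegral φ n * ∫ x, conj (β x : ℂ) ^ n * w x ∂P := by
  have hc : Continuous (Function.uncurry fun k x : Circle =>
      (k : ℂ) ^ n * (w x * φ (k * β x))) := by
    simp only [Function.uncurry_def]
    fun_prop
  have h1 : ∫ k : Circle, ∫ x, (k : ℂ) ^ n * (w x * φ (k * β x)) ∂P ∂circleMeasure =
      ∫ x, ∫ k : Circle, (k : ℂ) ^ n * (w x * φ (k * β x)) ∂circleMeasure ∂P :=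
    integral_integral_swap
      (hc.integrable_of_hasCompactSupport (HasCompactSupport.of_compactSpace _))
  simp only [integral_const_mul] at h1
  rw [h1, ← integral_const_mul]
  congr 1
  ext x
  have h2 : ∀ k : Circle, (k : ℂ) ^ n * (w x * φ (k * β x)) =
      w x * ((k : ℂ) ^ n * φ (k * β x)) := fun k => by ring
  simp only [h2]
  rw [integral_const_mul, integral_pow_mul_rotate]
  ring

lemma integral_conj_pow (n : ℕ) : ∫ x : Circle, conj (x : ℂ) ^ (n + 1) ∂circleMeasure = 0 := by
  have h := integral_pow_circleMeasure (n + 1)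
  simp only [← map_pow]
  rw [integral_conj, h]
  simp

/-! ### Taylor coefficients of powers of B(z) = (2z + 1)/(z + 2). -/

/-- The point `1 / 2` of the disc. -/
def discHalf : 𝔻 := UnitDisc.mk (1 / 2) (by norm_num)

lemma add_two_ne_zero {z : ℂ} (hz : ‖z‖ ≤ 1) : z + 2 ≠ 0 := by
  intro h
  rw [eq_neg_of_add_eq_zero_left h] at hz
  norm_num at hz

lemma coe_boost_half (x : Circle) : ((boost discHalf • x : Circle) : ℂ) = (2 * x + 1) / (x + 2) := by
  have h := add_two_ne_zero x.norm_coe.le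
  rw [coe_boost_smul_circle]
  have h1 : conj (discHalf : ℂ) = 1 / 2 := by
    rw [discHalf, UnitDisc.coe_mk, map_div₀, map_one, map_ofNat]
  have h2 : (discHalf : ℂ) = 1 / 2 := rfl
  have h3 : (1 / 2 * (x : ℂ) + 1) ≠ 0 := fun h0 => h (by linear_combination 2 * h0)
  rw [h1, h2, div_eq_div_iff h3 h]
  ring

lemma diffContOnCl_two_div : DiffContOnCl ℂ (fun z : ℂ => 2 / (z + 2)) (Metric.ball 0 1) := by
  apply DifferentiableOn.diffContOnCl
  intro z hz
  rw [closure_ball _ one_ne_zero, mem_closedBall_zero_iff] at hz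
  have h : DifferentiableAt ℂ (fun z : ℂ => 2 / (z + 2)) z :=
    DifferentiableAt.div (by fun_prop) (by fun_prop) (add_two_ne_zero hz)
  exact h.differentiableWithinAt

lemma diffContOnCl_boost_half :
    DiffContOnCl ℂ (fun z : ℂ => (2 * z + 1) / (z + 2)) (Metric.ball 0 1) := by
  apply DifferentiableOn.diffContOnCl
  intro z hz
  rw [closure_ball _ one_ne_zero, mem_closedBall_zero_iff] at hz
  have h : DifferentiableAt ℂ (fun z : ℂ => (2 * z + 1) / (z + 2)) z :=
    DifferentiableAt.div (by fun_prop) (by fun_prop) (add_two_ne_zero hz)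
  exact h.differentiableWithinAt

lemma continuous_two_div : Continuous fun x : Circle => 2 / ((x : ℂ) + 2) :=
  continuous_of_diffContOnCl diffContOnCl_two_div

lemma conj_mul_self_circle (x : Circle) : conj (x : ℂ) * x = 1 := by
  rw [← circle_inv_eq_conj, inv_mul_cancel₀ x.coe_ne_zero]

/-- These are the Taylor coefficients of 2/(z + 2) = ∑ (-z/2)^m; the induction uses 2/(z + 2) = 1 -
(z/2) · 2/(z + 2). -/
lemma integral_conj_pow_mul_two_div (m : ℕ) :
    ∫ x : Circle, conj (x : ℂ) ^ m * (2 / (x + 2)) ∂circleMeasure = (-1 / 2) ^ m := by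
  have hc := continuous_two_div
  induction m with
  | zero =>
    simp only [pow_zero, one_mul]
    rw [integral_of_diffContOnCl diffContOnCl_two_div]
    norm_num
  | succ m ih =>
    have h : ∀ x : Circle, conj (x : ℂ) ^ (m + 1) * (2 / (x + 2)) =
        conj (x : ℂ) ^ (m + 1) - 1 / 2 * (conj (x : ℂ) ^ m * (2 / (x + 2))) := fun x => by
      have h1 := add_two_ne_zero x.norm_coe.le
      have h2 : (2 : ℂ) / (x + 2) = 1 - x / 2 * (2 / (x + 2)) := by
        field_simp
        ring
      rw [pow_succ]
      nth_rewrite 1 [h2]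
      linear_combination (-(conj (x : ℂ)) ^ m * (1 / 2) * (2 / (x + 2))) * conj_mul_self_circle x
    simp only [h]
    rw [integral_sub (continuous_integrable (by fun_prop) _) (continuous_integrable (by fun_prop) _),
      integral_const_mul, ih, integral_conj_pow]
    ring

/-- Since B(z) = 1/2 + (3/4) z · 2/(z + 2), the integral is (3/4)(-1/2)^m. It serves to pass from
order 1 to any positive order. -/
lemma integral_conj_pow_mul_boost_half (m : ℕ) :
    ∫ x : Circle, conj (x : ℂ) ^ (m + 1) * ((boost discHalf • x : Circle) : ℂ) ∂circleMeasure ≠ 0 := by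
  have hc := continuous_two_div
  have h : ∀ x : Circle, conj (x : ℂ) ^ (m + 1) * ((boost discHalf • x : Circle) : ℂ) =
      1 / 2 * conj (x : ℂ) ^ (m + 1) + 3 / 4 * (conj (x : ℂ) ^ m * (2 / (x + 2))) := fun x => by
    have h1 := add_two_ne_zero x.norm_coe.le
    have h2 : (2 * (x : ℂ) + 1) / (x + 2) = 1 / 2 + 3 / 4 * x * (2 / (x + 2)) := by
      field_simp
      ring
    rw [coe_boost_half, h2, pow_succ]
    linear_combination ((conj (x : ℂ)) ^ m * (3 / 4) * (2 / (x + 2))) * conj_mul_self_circle x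
  simp only [h]
  rw [integral_add (continuous_integrable (by fun_prop) _) (continuous_integrable (by fun_prop) _),
    integral_const_mul, integral_const_mul, integral_conj_pow, integral_conj_pow_mul_two_div]
  simp

/-- The coefficient of z in B^(n+1) is (n+1)(1/2)^n · 3/4. It serves to pass from any positive order
to order 1. -/
lemma integral_conj_mul_boost_half_pow (n : ℕ) :
    ∫ x : Circle, conj (x : ℂ) * ((boost discHalf • x : Circle) : ℂ) ^ (n + 1) ∂circleMeasure ≠ 0 := by
  have hF := diffContOnCl_boost_half
  have hc := continuous_of_diffContOnCl hF
  -- This is (B(z)^(n+1) - (1/2)^(n+1))/z with the division carried out by the geometric sum, so the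
  -- mean value property at 0 applies.
  let S : ℂ → ℂ := fun z => 3 / 4 * (2 / (z + 2)) *
    ∑ i ∈ Finset.range (n + 1), ((2 * z + 1) / (z + 2)) ^ i * (1 / 2) ^ (n + 1 - 1 - i)
  have hS : DiffContOnCl ℂ S (Metric.ball 0 1) := by
    have h0 : DiffContOnCl ℂ (fun z : ℂ => (3 / 4 : ℂ) * (2 / (z + 2))) (Metric.ball 0 1) :=
      diffContOnCl_two_div.const_smul (3 / 4 : ℂ)
    refine h0.smul ?_
    exact (by fun_prop : Differentiable ℂ fun w : ℂ =>
      ∑ i ∈ Finset.range (n + 1), w ^ i * (1 / 2) ^ (n + 1 - 1 - i)).comp_diffContOnCl hF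
  have h : ∀ x : Circle, conj (x : ℂ) * ((boost discHalf • x : Circle) : ℂ) ^ (n + 1) =
      (1 / 2) ^ (n + 1) * conj (x : ℂ) ^ (0 + 1) + S x := fun x => by
    have h1 := add_two_ne_zero x.norm_coe.le
    have h2 : (2 * (x : ℂ) + 1) / (x + 2) - 1 / 2 = 3 / 4 * x * (2 / (x + 2)) := by
      field_simp
      ring
    have h3 := geom_sum₂_mul ((2 * (x : ℂ) + 1) / (x + 2)) (1 / 2) (n + 1)
    rw [h2] at h3
    rw [coe_boost_half]
    simp only [S]
    generalize (∑ i ∈ Finset.range (n + 1), ((2 * (x : ℂ) + 1) / (x + 2)) ^ i *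
      (1 / 2 : ℂ) ^ (n + 1 - 1 - i)) = T at h3 ⊢
    linear_combination (-conj (x : ℂ)) * h3 + (3 / 4 * (2 / ((x : ℂ) + 2)) * T) *
      conj_mul_self_circle x
  simp only [h]
  rw [integral_add (continuous_integrable (by fun_prop) _)
    (continuous_integrable (continuous_of_diffContOnCl hS) _), integral_const_mul,
    integral_conj_pow, integral_of_diffContOnCl hS]
  simp only [S, mul_zero, zero_add]
  have h4 : ∀ i ∈ Finset.range (n + 1), (1 / 2 : ℂ) ^ i * (1 / 2) ^ (n + 1 - 1 - i) = (1 / 2) ^ n := by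
    intro i hi
    rw [← pow_add]
    congr 1
    have := Finset.mem_range.1 hi
    omega
  rw [Finset.sum_congr rfl h4]
  simp only [Finset.sum_const, Finset.card_range, nsmul_eq_mul]
  have h5 : ((n + 1 : ℕ) : ℂ) ≠ 0 := by exact_mod_cast n.succ_ne_zero
  norm_num
  exact_mod_cast n.succ_ne_zero

/-- Suppose that all coefficients of order m vanish on V. Applied to ψ(kB(·)) for each rotation k,
this says that a function of k is zero; its n-th Fourier coefficient is that of ψ times the
conjugate of the integral in `hne`, a contradiction. -/
lemma exists_fourierIntegral_boost {V : Set C(Circle, ℝ)}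
    (hV : ∀ ψ ∈ V, ∀ g : G, ψ.comp ⟨fun ζ : Circle => g • ζ, continuous_const_smul g⟩ ∈ V)
    {n m : ℕ}
    (hne : ∫ x : Circle, conj (x : ℂ) ^ m * ((boost discHalf • x : Circle) : ℂ) ^ n ∂circleMeasure ≠ 0)
    (hn : ∃ ψ ∈ V, fourierIntegral ψ n ≠ 0) : ∃ ψ ∈ V, fourierIntegral ψ m ≠ 0 := by
  obtain ⟨ψ, hψ, hψn⟩ := hn
  by_contra! h0
  have h1 := integral_pow_mul_integral ψ n circleMeasure
    (β := fun x => boost discHalf • x) (continuous_const_smul _)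
    (w := fun x => (x : ℂ) ^ m) (by fun_prop)
  have h2 : ∀ k : Circle, ∫ x : Circle, (x : ℂ) ^ m * ψ (k * boost discHalf • x) ∂circleMeasure = 0 := by
    intro k
    rw [← h0 _ (hV ψ hψ (rotation k * boost discHalf)), fourierIntegral]
    simp [mul_smul, rotation_smul_circle]
  simp only [h2, mul_zero, integral_zero] at h1
  have h3 := (mul_eq_zero.1 h1.symm).resolve_left hψn
  apply hne
  have h4 := congrArg conj h3
  rw [← integral_conj] at h4
  simpa [mul_comm] using h4

/-- Two probability measures that agree on an invariant set of continuous functions, not all of them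
constant, are equal. -/
theorem measure_eq_of_invariant {V : Set C(Circle, ℝ)}
    (hV : ∀ ψ ∈ V, ∀ g : G, ψ.comp ⟨fun ζ : Circle => g • ζ, continuous_const_smul g⟩ ∈ V)
    (hne : ∃ ψ ∈ V, ¬ ∃ c, ∀ ζ, ψ ζ = c) {ν ν' : Measure Circle}
    [IsProbabilityMeasure ν] [IsProbabilityMeasure ν']
    (h : ∀ ψ ∈ V, ∫ ζ, ψ ζ ∂ν = ∫ ζ, ψ ζ ∂ν') : ν = ν' := by
  obtain ⟨ψ, hψ, hψc⟩ := hne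
  obtain ⟨n, hn⟩ := exists_fourierIntegral_ne_zero hψc
  have h1 : ∃ ψ ∈ V, fourierIntegral ψ 1 ≠ 0 := exists_fourierIntegral_boost hV
    (by simpa using integral_conj_mul_boost_half_pow n) ⟨ψ, hψ, hn⟩
  refine measure_circle_ext fun m => ?_
  rcases m with _ | m
  · simp
  obtain ⟨φ, hφ, hφm⟩ := exists_fourierIntegral_boost hV
    (by simpa using integral_conj_pow_mul_boost_half m) h1
  -- The two measures give the same function k ↦ ∫ φ(kx), hence the same product of a coefficient of
  -- φ with a conjugated moment; the coefficient cancels.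
  have h2 := integral_pow_mul_integral φ (m + 1) ν (β := id) continuous_id
    (w := fun _ => 1) continuous_const
  have h3 := integral_pow_mul_integral φ (m + 1) ν' (β := id) continuous_id
    (w := fun _ => 1) continuous_const
  have h4 : ∀ k : Circle, ∫ x : Circle, (φ (k * x) : ℂ) ∂ν = ∫ x : Circle, (φ (k * x) : ℂ) ∂ν' := by
    intro k
    rw [integral_complex_ofReal, integral_complex_ofReal]
    have := h _ (hV φ hφ (rotation k))
    simp only [ContinuousMap.comp_apply, ContinuousMap.coe_mk, rotation_smul_circle] at this
    rw [this]
  simp only [id, one_mul, mul_one, h4] at h2 h3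
  rw [h2] at h3
  have h5 := congrArg conj (mul_left_cancel₀ hφm h3)
  rw [← integral_conj, ← integral_conj] at h5
  simpa using h5

/-! ### Nontrivial images of the system of probability measures -/

/-- A continuous affine function on probability measures is an integral. -/
lemma affine_eq_integral {u : WeakDual ℝ C(Circle, ℝ) → ℝ} (hu : ContinuousOn u probCircle)
    (hu' : AffineOn u probCircle) {f : C(Circle, ℝ)} (hf : ∀ ζ, f ζ = u (diracFunctional ζ))
    {ξ : WeakDual ℝ C(Circle, ℝ)} (hξ : ξ ∈ probCircle) : u ξ = ξ f := by
  have hcl : IsClosed (probCircle ∩ (fun ξ => u ξ - ξ f) ⁻¹' {0}) :=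
    (hu.sub (WeakDual.eval_continuous f).continuousOn).preimage_isClosed_of_isClosed
      isCompact_probCircle.isClosed isClosed_singleton
  have hsub := probCircle_subset_of_dirac hcl ?_ ?_
  · exact sub_eq_zero.1 (hsub hξ).2
  · rintro ξ ⟨hξ, hξe⟩ ξ' ⟨hξ', hξe'⟩ s t hs ht hst
    refine ⟨convex_probCircle hξ hξ' hs ht hst, ?_⟩
    simp only [Set.mem_preimage, Set.mem_singleton_iff, sub_eq_zero] at hξe hξe' ⊢
    rw [hu' ξ hξ ξ' hξ' s t hs ht hst, hξe, hξe']
    rfl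
  · intro ζ
    refine ⟨diracFunctional_mem ζ, ?_⟩
    simp only [Set.mem_preimage, Set.mem_singleton_iff, sub_eq_zero]
    rw [diracFunctional_apply, hf]

section Image

variable {E : Type*} [AddCommGroup E] [Module ℝ E] [TopologicalSpace E] {σ : G → E → E} {P : Set E}
  {Φ : WeakDual ℝ C(Circle, ℝ) → E}

lemma IsAffineHom.continuous_dirac (hΦ : IsAffineHom pushCircle probCircle σ P Φ) (g : G) :
    Continuous fun ζ : Circle => Φ (diracFunctional (g • ζ)) :=
  hΦ.continuousOn.comp_continuous (continuous_diracFunctional.comp (continuous_const_smul g))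
    fun _ => diracFunctional_mem _

lemma IsAffineHom.apply_eq_integral (hΦ : IsAffineHom pushCircle probCircle σ P Φ) (L : E →L[ℝ] ℝ)
    {f : C(Circle, ℝ)} (hf : ∀ ζ, f ζ = L (Φ (diracFunctional ζ)))
    {ξ : WeakDual ℝ C(Circle, ℝ)} (hξ : ξ ∈ probCircle) : L (Φ ξ) = ξ f :=
  affine_eq_integral (u := fun ξ => L (Φ ξ)) (L.continuous.comp_continuousOn hΦ.continuousOn)
    (fun ξ hξ ξ' hξ' s t hs ht hst => by
      simp only
      rw [hΦ.affine ξ hξ ξ' hξ' s t hs ht hst, map_add, map_smul, map_smul]) hf hξ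

/-- If Φ ξ = Φ ξ', then ξ and ξ' agree on every ζ ↦ L(Φ(δ_{gζ})), since its integral against ξ is
L(σ g (Φ ξ)). These functions form an invariant family, not all constant when the image is
nontrivial. -/
theorem IsAffineHom.injOn [IsTopologicalAddGroup E] [ContinuousSMul ℝ E]
    [LocallyConvexSpace ℝ E] [T2Space E] (hΦ : IsAffineHom pushCircle probCircle σ P Φ)
    (hne : (Φ '' probCircle).Nontrivial) : Set.InjOn Φ probCircle := by
  intro ξ hξ ξ' hξ' hξξ'
  let V : Set C(Circle, ℝ) :=
    {ψ | ∃ (g : G) (L : E →L[ℝ] ℝ), ∀ ζ, ψ ζ = L (Φ (diracFunctional (g • ζ)))}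
  have hV : ∀ ψ ∈ V, ∀ g : G,
      ψ.comp ⟨fun ζ : Circle => g • ζ, continuous_const_smul g⟩ ∈ V := by
    rintro ψ ⟨g', L, h⟩ g
    refine ⟨g' * g, L, fun ζ => ?_⟩
    rw [mul_smul, ← h]
    rfl
  have hVn : ∃ ψ ∈ V, ¬ ∃ c, ∀ ζ, ψ ζ = c := by
    obtain ⟨_, ⟨ξ, hξ, rfl⟩, _, ⟨ξ', hξ', rfl⟩, hΦne⟩ := hne
    obtain ⟨L, hL⟩ := geometric_hahn_banach_point_point hΦne
    let f : C(Circle, ℝ) := ⟨fun ζ => L (Φ (diracFunctional ζ)), by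
      simpa [Function.comp_def] using L.continuous.comp (hΦ.continuous_dirac 1)⟩
    refine ⟨f, ⟨1, L, fun ζ => by rw [one_smul]; rfl⟩, ?_⟩
    rintro ⟨c, hc⟩
    apply hL.ne
    have hfc : f = ContinuousMap.const _ c := ContinuousMap.ext hc
    rw [hΦ.apply_eq_integral L (f := f) (fun _ => rfl) hξ,
      hΦ.apply_eq_integral L (f := f) (fun _ => rfl) hξ', hfc]
    obtain ⟨ν, hν, rfl⟩ := exists_of_mem_probCircle hξ
    obtain ⟨ν', hν', rfl⟩ := exists_of_mem_probCircle hξ'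
    simp [measureFunctional_apply]
  obtain ⟨ν, hν, rfl⟩ := exists_of_mem_probCircle hξ
  obtain ⟨ν', hν', rfl⟩ := exists_of_mem_probCircle hξ'
  have : ν = ν' := by
    refine measure_eq_of_invariant hV hVn ?_
    rintro ψ ⟨g, L, hψ⟩
    let f : C(Circle, ℝ) := ⟨fun ζ => L (Φ (diracFunctional ζ)), by
      simpa [Function.comp_def] using L.continuous.comp (hΦ.continuous_dirac 1)⟩
    have hfψ : ψ = f.comp ⟨fun ζ : Circle => g • ζ, continuous_const_smul g⟩ :=
      ContinuousMap.ext hψ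
    have key : ∀ {ξ}, ξ ∈ probCircle → ξ ψ = L (σ g (Φ ξ)) := fun {ξ} hξ => by
      rw [hfψ, ← pushCircle_apply, ← hΦ.equivariant g ξ hξ,
        hΦ.apply_eq_integral L (f := f) (fun _ => rfl) (pushCircle_mem g hξ)]
    have h1 := key hξ
    rw [hξξ', ← key hξ'] at h1
    exact h1
  subst this
  rfl

lemma IsAffineHom.continuousOn_invFunOn [T2Space E]
    (hΦ : IsAffineHom pushCircle probCircle σ P Φ)
    (hinj : Set.InjOn Φ probCircle) :
    ContinuousOn (Function.invFunOn Φ probCircle) (Φ '' probCircle) := by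
  rw [continuousOn_iff_isClosed]
  intro t ht
  refine ⟨Φ '' (probCircle ∩ t), ?_, ?_⟩
  · exact ((isCompact_probCircle.inter_right ht).image_of_continuousOn
      (hΦ.continuousOn.mono Set.inter_subset_left)).isClosed
  · ext x
    constructor
    · rintro ⟨hx, ξ, hξ, rfl⟩
      rw [Set.mem_preimage, hinj.leftInvOn_invFunOn hξ] at hx
      exact ⟨⟨ξ, ⟨hξ, hx⟩, rfl⟩, ξ, hξ, rfl⟩
    · rintro ⟨⟨ξ, ⟨hξ, hξt⟩, rfl⟩, hx⟩
      refine ⟨?_, hx⟩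
      rwa [Set.mem_preimage, hinj.leftInvOn_invFunOn hξ]

lemma IsAffineHom.affinelyIsomorphic [T2Space E]
    (hΦ : IsAffineHom pushCircle probCircle σ P Φ)
    (hinj : Set.InjOn Φ probCircle) (hP : Φ '' probCircle = P) :
    AffinelyIsomorphic pushCircle probCircle σ P := by
  subst hP
  have hL := hinj.leftInvOn_invFunOn
  refine ⟨Φ, Function.invFunOn Φ probCircle, hΦ, ⟨?_, hΦ.continuousOn_invFunOn hinj, ?_, ?_⟩,
    hL, by rintro _ ⟨ξ, hξ, rfl⟩; rw [hL hξ]⟩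
  · rintro _ ⟨ξ, hξ, rfl⟩
    rwa [hL hξ]
  · rintro g _ ⟨ξ, hξ, rfl⟩
    rw [hL hξ, ← hΦ.equivariant g ξ hξ, hL (pushCircle_mem g hξ)]
  · rintro _ ⟨ξ, hξ, rfl⟩ _ ⟨ξ', hξ', rfl⟩ s t hs ht hst
    rw [hL hξ, hL hξ', ← hΦ.affine ξ hξ ξ' hξ' s t hs ht hst,
      hL (convex_probCircle hξ hξ' hs ht hst)]

/-- Nothing is assumed of `σ` beyond the equivariance of Φ. Every axiom, including metrizability and
joint continuity, is carried over from M through the inverse of Φ. -/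
lemma IsAffineHom.isIrreducible_image [T2Space E]
    (hΦ : IsAffineHom pushCircle probCircle σ P Φ)
    (hinj : Set.InjOn Φ probCircle) : IsIrreducibleAffineSystem σ (Φ '' probCircle) := by
  have hL := hinj.leftInvOn_invFunOn
  have hΨ := hΦ.continuousOn_invFunOn hinj
  have hΨm : Set.MapsTo (Function.invFunOn Φ probCircle) (Φ '' probCircle) probCircle := by
    rintro _ ⟨ξ, hξ, rfl⟩
    rwa [hL hξ]
  refine ⟨⟨⟨_, _, circleFunctional_mem, rfl⟩,
    isCompact_probCircle.image_of_continuousOn hΦ.continuousOn, ?_, ?_, ?_, ?_, ?_, ?_, ?_⟩, ?_⟩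
  · rintro _ ⟨ξ, hξ, rfl⟩ _ ⟨ξ', hξ', rfl⟩ s t hs ht hst
    exact ⟨_, convex_probCircle hξ hξ' hs ht hst, hΦ.affine ξ hξ ξ' hξ' s t hs ht hst⟩
  · have hm : TopologicalSpace.MetrizableSpace probCircle := isAffineSystem_probCircle.metrizable
    have hc : CompactSpace (Φ '' probCircle) := isCompact_iff_compactSpace.1
      (isCompact_probCircle.image_of_continuousOn hΦ.continuousOn)
    have hcont : Continuous (hΨm.restrict _ _ _) := hΨ.mapsToRestrict hΨm
    refine (hcont.isClosedEmbedding ?_).isEmbedding.metrizableSpace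
    rw [Set.MapsTo.restrict_inj]
    rintro _ ⟨ξ, hξ, rfl⟩ _ ⟨ξ', hξ', rfl⟩ h
    rw [hL hξ, hL hξ'] at h
    rw [h]
  · rintro g _ ⟨ξ, hξ, rfl⟩
    exact ⟨_, pushCircle_mem g hξ, hΦ.equivariant g ξ hξ⟩
  · rintro _ ⟨ξ, hξ, rfl⟩
    rw [← hΦ.equivariant 1 ξ hξ, pushCircle_one]
  · rintro g g' _ ⟨ξ, hξ, rfl⟩
    rw [← hΦ.equivariant _ ξ hξ, pushCircle_mul, hΦ.equivariant _ _ (pushCircle_mem _ hξ),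
      hΦ.equivariant _ ξ hξ]
  · have h1 : ContinuousOn (fun p : G × E =>
        Φ (pushCircle p.1 (Function.invFunOn Φ probCircle p.2))) (Set.univ ×ˢ (Φ '' probCircle)) := by
      refine hΦ.continuousOn.comp (continuousOn_pushCircle.comp
        (f := fun p : G × E => (p.1, Function.invFunOn Φ probCircle p.2))
        (continuousOn_fst.prodMk (hΨ.comp continuousOn_snd fun p hp => hp.2))
        fun p hp => ⟨trivial, hΨm hp.2⟩) fun p hp => pushCircle_mem _ (hΨm hp.2)
    refine h1.congr ?_
    rintro ⟨g, _⟩ ⟨-, ξ, hξ, rfl⟩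
    simp only
    rw [hL hξ, hΦ.equivariant g ξ hξ]
  · rintro g _ ⟨ξ, hξ, rfl⟩ _ ⟨ξ', hξ', rfl⟩ s t hs ht hst
    rw [← hΦ.affine ξ hξ ξ' hξ' s t hs ht hst,
      ← hΦ.equivariant g _ (convex_probCircle hξ hξ' hs ht hst), pushCircle_affine,
      hΦ.affine _ (pushCircle_mem g hξ) _ (pushCircle_mem g hξ') s t hs ht hst,
      hΦ.equivariant g ξ hξ, hΦ.equivariant g ξ' hξ']
  · intro S hS hne hcl hconv hinv
    have hScl : IsClosed (probCircle ∩ Φ ⁻¹' S) :=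
      hΦ.continuousOn.preimage_isClosed_of_isClosed isCompact_probCircle.isClosed hcl
    have hS' : probCircle ∩ Φ ⁻¹' S = probCircle := by
      refine isIrreducibleAffineSystem_probCircle.eq_of_subset _ Set.inter_subset_left ?_ hScl ?_ ?_
      · obtain ⟨x, hx⟩ := hne
        obtain ⟨ξ, hξ, rfl⟩ := hS hx
        exact ⟨ξ, hξ, hx⟩
      · rintro ξ ⟨hξ, hξS⟩ ξ' ⟨hξ', hξS'⟩ s t hs ht hst
        refine ⟨convex_probCircle hξ hξ' hs ht hst, ?_⟩
        rw [Set.mem_preimage, hΦ.affine ξ hξ ξ' hξ' s t hs ht hst]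
        exact hconv hξS hξS' hs ht hst
      · rintro g ξ ⟨hξ, hξS⟩
        refine ⟨pushCircle_mem g hξ, ?_⟩
        rw [Set.mem_preimage, hΦ.equivariant g ξ hξ]
        exact hinv g hξS
    refine hS.antisymm ?_
    rintro _ ⟨ξ, hξ, rfl⟩
    rw [← hS'] at hξ
    exact hξ.2

end Image

/-! ### The weak* topology of `L^∞(G)` -/

namespace LInf

variable {μ : Measure G}

lemma fn_add (F F' : LInf μ) : (F + F').fn =ᵐ[μ] F.fn + F'.fn :=
  Lp.coeFn_add (show Lp ℝ ∞ μ from F) (show Lp ℝ ∞ μ from F')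

lemma fn_smul (c : ℝ) (F : LInf μ) : (c • F).fn =ᵐ[μ] c • F.fn :=
  Lp.coeFn_smul c (show Lp ℝ ∞ μ from F)

lemma integrable_fn_mul (F : LInf μ) {φ : G → ℝ} (hφ : Integrable φ μ) :
    Integrable (fun g => F.fn g * φ g) μ :=
  hφ.mul_of_top_right F.memLp_fn

/-- The pairing of `L^∞(G)` with `L^1(G)`. -/
def pairing : LInf μ →ₗ[ℝ] (Lp ℝ 1 μ → ℝ) where
  toFun F φ := ∫ g, F.fn g * φ g ∂μ
  map_add' F F' := by
    ext φ
    rw [Pi.add_apply, ← integral_add (F.integrable_fn_mul (L1.integrable_coeFn φ))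
      (F'.integrable_fn_mul (L1.integrable_coeFn φ))]
    refine integral_congr_ae ?_
    filter_upwards [fn_add F F'] with g hg
    rw [hg, Pi.add_apply, add_mul]
  map_smul' c F := by
    ext φ
    rw [Pi.smul_apply, RingHom.id_apply, smul_eq_mul, ← integral_const_mul]
    refine integral_congr_ae ?_
    filter_upwards [fn_smul c F] with g hg
    rw [hg, Pi.smul_apply, smul_eq_mul, mul_assoc]

instance : IsTopologicalAddGroup (LInf μ) := topologicalAddGroup_induced (pairing (μ := μ))

instance : ContinuousSMul ℝ (LInf μ) := continuousSMul_induced (pairing (μ := μ))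

instance : LocallyConvexSpace ℝ (LInf μ) :=
  LocallyConvexSpace.induced (pairing (μ := μ))

lemma isInducing_pairing : IsInducing (pairing (μ := μ)) := ⟨rfl⟩

/-- Pairing with `φ` as a continuous functional. -/
def pairingWith (φ : Lp ℝ 1 μ) : LInf μ →L[ℝ] ℝ where
  toLinearMap := (LinearMap.proj φ).comp pairing
  cont := (continuous_apply φ).comp isInducing_pairing.continuous

lemma pairingWith_apply (F : LInf μ) (φ : Lp ℝ 1 μ) : pairingWith φ F = ∫ g, F.fn g * φ g ∂μ := rfl

lemma ext_pairing [SigmaFinite μ] {F F' : LInf μ}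
    (h : ∀ φ : Lp ℝ 1 μ, pairingWith φ F = pairingWith φ F') : F = F' := by
  apply ext_fn
  refine ae_eq_of_forall_setIntegral_eq_of_sigmaFinite ?_ ?_ ?_
  · intro s hs hμs
    have : IsFiniteMeasure (μ.restrict s) := ⟨by simpa using hμs⟩
    exact (F.memLp_fn.restrict s).integrable le_top
  · intro s hs hμs
    have : IsFiniteMeasure (μ.restrict s) := ⟨by simpa using hμs⟩
    exact (F'.memLp_fn.restrict s).integrable le_top
  · intro s hs hμs
    have key : ∀ F : LInf μ, pairingWith (indicatorConstLp 1 hs hμs.ne (1 : ℝ)) F =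
        ∫ g in s, F.fn g ∂μ := fun F => by
      rw [pairingWith_apply, ← integral_indicator hs]
      refine integral_congr_ae ?_
      filter_upwards [indicatorConstLp_coeFn (p := 1) (hs := hs) (hμs := hμs.ne) (c := (1 : ℝ))]
        with g hg
      rw [hg]
      by_cases hgs : g ∈ s <;> simp [hgs]
    rw [← key, ← key, h]

instance [SigmaFinite μ] : T2Space (LInf μ) := by
  have : Function.Injective (pairing (μ := μ)) := fun F F' h =>
    ext_pairing fun φ => congrFun h φ
  exact (IsEmbedding.mk isInducing_pairing this).t2Space

lemma continuousOn_of_pairing {X : Type*} [TopologicalSpace X] {Φ : X → LInf μ} {S : Set X}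
    (h : ∀ φ, ContinuousOn (fun x => pairingWith φ (Φ x)) S) : ContinuousOn Φ S := by
  rw [isInducing_pairing.continuousOn_iff]
  exact continuousOn_pi.2 h

lemma fn_translate [μ.IsHaarMeasure] (g' : G) (F : LInf μ) :
    (translate g' F).fn =ᵐ[μ] fun g => F.fn (g * g') := fn_mk _

end LInf

/-! ### Boundary values of bounded harmonic functions -/

/-- Balls of L² are weakly compact. The bound `R` survives in the limit when tested on measurable
sets, and truncating a measurable representative makes it hold everywhere. Only those p for which
the whole sequence converges are considered, so no subsequence appears. -/
lemma exists_weak_limit {F : ℕ → Circle → ℝ} {R : ℝ} (hF : ∀ n, Measurable (F n))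
    (hR : ∀ n ζ, |F n ζ| ≤ R) : ∃ f : Circle → ℝ, Measurable f ∧ (∀ ζ, |f ζ| ≤ R) ∧
      ∀ p : Circle → ℝ, Continuous p → ∀ l,
        Filter.Tendsto (fun n => ∫ ζ, p ζ * F n ζ ∂circleMeasure) Filter.atTop (𝓝 l) →
          ∫ ζ, p ζ * f ζ ∂circleMeasure = l := by
  have hR0 : 0 ≤ R := (abs_nonneg _).trans (hR 0 1)
  have hm : ∀ n, MemLp (F n) 2 circleMeasure := fun n =>
    MemLp.of_bound (hF n).aestronglyMeasurable R (Filter.Eventually.of_forall (hR n))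
  let T : ℕ → WeakDual ℝ (Lp ℝ 2 circleMeasure) := fun n =>
    StrongDual.toWeakDual (InnerProductSpace.toDual ℝ _ ((hm n).toLp (F n)))
  have hT : ∀ n, T n ∈ WeakDual.toStrongDual ⁻¹'
      Metric.closedBall (0 : StrongDual ℝ (Lp ℝ 2 circleMeasure)) R := fun n => by
    rw [Set.mem_preimage, mem_closedBall_zero_iff]
    change ‖InnerProductSpace.toDual ℝ _ ((hm n).toLp (F n))‖ ≤ R
    rw [LinearIsometryEquiv.norm_map]
    refine (Lp.norm_le_of_ae_bound hR0 (C := R) ?_).trans ?_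
    · filter_upwards [(hm n).coeFn_toLp] with ζ hζ
      rw [hζ]
      exact hR n ζ
    · simp [measureUnivNNReal]
  obtain ⟨U, hU⟩ := Ultrafilter.exists_le (Filter.atTop : Filter ℕ)
  obtain ⟨t, -, ht⟩ := (WeakDual.isCompact_closedBall _ _).ultrafilter_le_nhds (U.map T)
    (Filter.le_principal_iff.2 (Filter.mem_map.2 (Filter.univ_mem' hT)))
  let v : Lp ℝ 2 circleMeasure :=
    (InnerProductSpace.toDual ℝ (Lp ℝ 2 circleMeasure)).symm (WeakDual.toStrongDual t)
  have hlim : ∀ {p : Circle → ℝ} (hp : MemLp p 2 circleMeasure),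
      Filter.Tendsto (fun n => ∫ ζ, p ζ * F n ζ ∂circleMeasure) U
        (𝓝 (∫ ζ, p ζ * v ζ ∂circleMeasure)) := by
    intro p hp
    have h1 : Filter.Tendsto (fun n => T n (hp.toLp p)) U (𝓝 (t (hp.toLp p))) :=
      ((WeakDual.eval_continuous (hp.toLp p)).tendsto t).comp ht
    have h2 : ∀ n, T n (hp.toLp p) = ∫ ζ, p ζ * F n ζ ∂circleMeasure := fun n => by
      change InnerProductSpace.toDual ℝ _ ((hm n).toLp (F n)) (hp.toLp p) = _
      rw [InnerProductSpace.toDual_apply_apply, L2.inner_def]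
      refine integral_congr_ae ?_
      filter_upwards [(hm n).coeFn_toLp, hp.coeFn_toLp] with ζ h1 h2
      rw [h1, h2]
      rfl
    have h3 : t (hp.toLp p) = ∫ ζ, p ζ * v ζ ∂circleMeasure := by
      have : t (hp.toLp p) = inner ℝ v (hp.toLp p) := by
        rw [InnerProductSpace.toDual_symm_apply]
        rfl
      rw [this, L2.inner_def]
      refine integral_congr_ae ?_
      filter_upwards [hp.coeFn_toLp] with ζ h2
      rw [h2]
      rfl
    rw [← h3]
    simpa only [h2] using h1
  have hv2 : MemLp v 2 circleMeasure := Lp.memLp v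
  have hvi : Integrable v circleMeasure := hv2.integrable (by norm_num)
  have hFi : ∀ n, Integrable (F n) circleMeasure := fun n => (hm n).integrable (by norm_num)
  have hind : ∀ s, MeasurableSet s → Filter.Tendsto (fun n => ∫ ζ in s, F n ζ ∂circleMeasure) U
        (𝓝 (∫ ζ in s, v ζ ∂circleMeasure)) := by
    intro s hs
    have h1 := hlim (p := s.indicator fun _ => 1) ((memLp_const 1).indicator hs)
    have h2 : ∀ q : Circle → ℝ, ∫ ζ, s.indicator (fun _ => 1) ζ * q ζ ∂circleMeasure =
        ∫ ζ in s, q ζ ∂circleMeasure := fun q => by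
      rw [← integral_indicator hs]
      congr 1
      ext ζ
      by_cases hζ : ζ ∈ s <;> simp [hζ]
    simpa only [h2] using h1
  have hle : v ≤ᵐ[circleMeasure] fun _ => R := by
    refine ae_le_of_forall_setIntegral_le hvi (integrable_const _) fun s hs _ =>
      le_of_tendsto (hind s hs) (Filter.Eventually.of_forall fun n => ?_)
    exact setIntegral_mono (hFi n).integrableOn (integrable_const _).integrableOn
      fun ζ => (abs_le.1 (hR n ζ)).2
  have hge : (fun _ => -R) ≤ᵐ[circleMeasure] v := by
    refine ae_le_of_forall_setIntegral_le (integrable_const _) hvi fun s hs _ =>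
      ge_of_tendsto (hind s hs) (Filter.Eventually.of_forall fun n => ?_)
    exact setIntegral_mono (integrable_const _).integrableOn (hFi n).integrableOn
      fun ζ => (abs_le.1 (hR n ζ)).1
  let v' := hv2.1.mk v
  refine ⟨fun ζ => max (-R) (min R (v' ζ)),
    measurable_const.max (measurable_const.min hv2.1.stronglyMeasurable_mk.measurable),
    fun ζ => abs_le.2 ⟨le_max_left _ _, max_le (by linarith) (min_le_left _ _)⟩,
    fun p hp l hl => ?_⟩
  have hp2 : MemLp p 2 circleMeasure := by
    obtain ⟨C, hC⟩ := (isCompact_range hp).exists_bound_of_continuousOn continuousOn_id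
    exact MemLp.of_bound hp.aestronglyMeasurable C (Filter.Eventually.of_forall fun ζ => hC _ ⟨ζ, rfl⟩)
  rw [← tendsto_nhds_unique (hlim hp2) (hl.mono_left hU)]
  refine integral_congr_ae ?_
  filter_upwards [hle, hge, hv2.1.ae_eq_mk] with ζ h1 h2 h3
  rw [h3] at h1 h2 ⊢
  rw [min_eq_right h1, max_eq_right h2]

lemma continuous_circle_smul_disc (z : 𝔻) : Continuous fun ζ : Circle => ζ • z := by
  rw [UnitDisc.isEmbedding_coe.continuous_iff]
  exact (by fun_prop : Continuous fun ζ : Circle => (ζ : ℂ) * z)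

/-- Here f is a weak limit of the dilates ζ ↦ h(ζr_n), so no radial limits are needed: by the
Poisson formula for dilates the integrals are h(z r_n), which tend to h(z). -/
theorem IsBoundedHarmonic.exists_boundary {h : 𝔻 → ℝ} (hh : IsBoundedHarmonic h) :
    ∃ (f : Circle → ℝ) (R : ℝ), Measurable f ∧ (∀ ζ, |f ζ| ≤ R) ∧
      ∀ g : G, h (g • (0 : 𝔻)) = ∫ ζ, f (g • ζ) ∂circleMeasure := by
  obtain ⟨R, hR⟩ := hh.bounded
  have hr : ∀ z : 𝔻, Filter.Tendsto (fun n => z * radial n) Filter.atTop (𝓝 z) := by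
    intro z
    rw [UnitDisc.isEmbedding_coe.tendsto_nhds_iff]
    simpa [Function.comp_def] using tendsto_radial.const_mul (z : ℂ)
  obtain ⟨f, hf, hfR, hlim⟩ := exists_weak_limit (F := fun n ζ => h (ζ • radial n)) (R := R)
    (fun n => (hh.continuous.comp (continuous_circle_smul_disc (radial n))).measurable)
    fun n ζ => hR _
  refine ⟨f, R, hf, hfR, fun g => ?_⟩
  rw [integral_smul_circle hf]
  refine (hlim _ (continuous_poissonKernel_circle (UnitDisc.norm_lt_one _)) _ ?_).symm
  simp only [hh.poisson]
  exact (hh.continuous.tendsto _).comp (hr _)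

/-! ### Integrals of translates -/

variable {μ : Measure G}

/-- Continuity of translation in L¹. Replacing φ by a compactly supported continuous function costs
an error uniform in ζ, because right multiplication by rotations preserves μ. -/
lemma continuous_integral_mul_rotation [μ.IsHaarMeasure] {F : G → ℝ} {R : ℝ} (hF : Measurable F)
    (hR : ∀ g, |F g| ≤ R) {φ : G → ℝ} (hφ : Integrable φ μ) :
    Continuous fun ζ : Circle => ∫ g, F g * φ (g * rotation ζ) ∂μ := by
  have hR0 : 0 ≤ R := (abs_nonneg _).trans (hR 1)
  have hint : ∀ {φ : G → ℝ}, Integrable φ μ → ∀ ζ,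
      Integrable (fun g => F g * φ (g * rotation ζ)) μ := fun hφ ζ =>
    ((measurePreserving_mul_rotation μ ζ).integrable_comp_of_integrable hφ).bdd_mul
      hF.aestronglyMeasurable (Filter.Eventually.of_forall hR)
  rw [continuous_iff_continuousAt]
  intro ζ₀
  refine continuousAt_of_locally_uniform_approx_of_continuousAt fun u hu => ?_
  obtain ⟨ε, hε, hεu⟩ := Metric.mem_uniformity_dist.1 hu
  -- The tolerance makes R times the L¹ error less than ε, also when R = 0.
  obtain ⟨φ', hφc, hφφ', hφ'c, hφ'i⟩ := hφ.exists_hasCompactSupport_integral_sub_le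
    (show 0 < ε / (2 * (R + 1)) by positivity)
  refine ⟨Set.univ, Filter.univ_mem, fun ζ => ∫ g, F g * φ' (g * rotation ζ) ∂μ, ?_, fun ζ _ => hεu ?_⟩
  -- As the rotations are compact, one compact set contains the supports of all translates of φ'.
  · have hk : IsCompact ((fun p : G × Circle => p.1 * (rotation p.2)⁻¹) ''
        (tsupport φ' ×ˢ Set.univ)) :=
      (hφc.prod isCompact_univ).image
        (continuous_fst.mul (continuous_rotation.comp continuous_snd).inv)
    have := continuousOn_integral_bilinear_of_locally_integrable_of_compact_support (s := Set.univ)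
      (μ := μ) (ContinuousLinearMap.mul ℝ ℝ) (f := fun (ζ : Circle) g => φ' (g * rotation ζ)) (g := F)
      hk ?_ ?_ ?_
    · exact this.continuousAt Filter.univ_mem
    · exact (hφ'c.comp (continuous_snd.mul (continuous_rotation.comp continuous_fst))).continuousOn
    · intro ζ g _ hg
      by_contra hne
      exact hg ⟨(g * rotation ζ, ζ), ⟨subset_tsupport _ hne, trivial⟩, by simp⟩
    · have : IsFiniteMeasure (μ.restrict ((fun p : G × Circle => p.1 * (rotation p.2)⁻¹) ''
        (tsupport φ' ×ˢ Set.univ))) := ⟨by simpa using hk.measure_lt_top⟩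
      exact Integrable.of_bound hF.aestronglyMeasurable R (Filter.Eventually.of_forall hR)
  · rw [Real.dist_eq, ← integral_sub (hint hφ ζ) (hint hφ'i ζ), ← Real.norm_eq_abs]
    calc ‖∫ g, F g * φ (g * rotation ζ) - F g * φ' (g * rotation ζ) ∂μ‖
        ≤ ∫ g, R * ‖φ (g * rotation ζ) - φ' (g * rotation ζ)‖ ∂μ := by
          refine norm_integral_le_of_norm_le (((measurePreserving_mul_rotation μ ζ).integrable_comp_of_integrable
            (hφ.sub hφ'i).norm).const_mul R) (Filter.Eventually.of_forall fun g => ?_)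
          rw [← mul_sub, norm_mul]
          exact mul_le_mul_of_nonneg_right (hR g) (norm_nonneg _)
      _ = R * ∫ g, ‖φ g - φ' g‖ ∂μ := by
          rw [integral_const_mul]
          congr 1
          have hemb : MeasurableEmbedding fun g : G => g * rotation ζ :=
            (Homeomorph.mulRight (rotation ζ)).measurableEmbedding
          exact (measurePreserving_mul_rotation μ ζ).integral_comp hemb fun g => ‖φ g - φ' g‖
      _ ≤ R * (ε / (2 * (R + 1))) := mul_le_mul_of_nonneg_left hφφ' hR0
      _ < ε := by
          rw [← mul_div_assoc, div_lt_iff₀ (by positivity)]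
          nlinarith

/-! ### The system generated by a bounded harmonic function -/

variable {μ : Measure G}

section BoundaryAverage

variable {f : Circle → ℝ} {R : ℝ}

lemma memLp_integral_smul (hf : Measurable f) (hR : ∀ ζ, |f ζ| ≤ R) (ν : ProbabilityMeasure Circle) :
    MemLp (fun g : G => ∫ ζ, f (g • ζ) ∂(ν : Measure Circle)) ∞ μ := by
  have hm : Measurable fun p : G × Circle => f (p.1 • p.2) :=
    hf.comp continuous_smul_circle.measurable
  refine memLp_top_of_bound hm.stronglyMeasurable.integral_prod_right.aestronglyMeasurable R
    (Filter.Eventually.of_forall fun g => ?_)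
  have := norm_integral_le_of_norm_le_const (μ := (ν : Measure Circle)) (f := fun ζ => f (g • ζ))
    (Filter.Eventually.of_forall fun ζ => hR (g • ζ))
  simpa using this

instance : Nonempty (ProbabilityMeasure Circle) := ⟨⟨circleMeasure, inferInstance⟩⟩

/-- The probability measure that represents a functional, if there is one. -/
def representingMeasure (ξ : WeakDual ℝ C(Circle, ℝ)) : ProbabilityMeasure Circle :=
  Classical.epsilon fun ν : ProbabilityMeasure Circle => ξ = measureFunctional (ν : Measure Circle)

lemma measureFunctional_injective {ν ν' : Measure Circle} [IsFiniteMeasure ν] [IsFiniteMeasure ν']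
    (h : measureFunctional ν = measureFunctional ν') : ν = ν' :=
  ext_of_forall_integral_eq_of_IsFiniteMeasure fun f =>
    DFunLike.congr_fun h f.toContinuousMap

lemma representingMeasure_measureFunctional (ν : Measure Circle) [IsProbabilityMeasure ν] :
    (representingMeasure (measureFunctional ν) : Measure Circle) = ν := by
  have h : ∃ ν' : ProbabilityMeasure Circle,
      measureFunctional ν = measureFunctional (ν' : Measure Circle) := ⟨⟨ν, inferInstance⟩, rfl⟩
  exact (measureFunctional_injective (Classical.epsilon_spec h)).symm

variable (μ) in
/-- The map `ν ↦ (g ↦ ∫ f (g ζ) dν)`. -/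
def boundaryAverage (hf : Measurable f) (hR : ∀ ζ, |f ζ| ≤ R) (ξ : WeakDual ℝ C(Circle, ℝ)) :
    LInf μ :=
  LInf.mk (fun g => ∫ ζ, f (g • ζ) ∂(representingMeasure ξ : Measure Circle))
    (memLp_integral_smul hf hR _)

lemma fn_boundaryAverage (hf : Measurable f) (hR : ∀ ζ, |f ζ| ≤ R) (ν : Measure Circle)
    [IsProbabilityMeasure ν] :
    (boundaryAverage μ hf hR (measureFunctional ν)).fn =ᵐ[μ] fun g => ∫ ζ, f (g • ζ) ∂ν := by
  have := LInf.fn_mk (memLp_integral_smul (μ := μ) hf hR (representingMeasure (measureFunctional ν)))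
  refine this.trans (Filter.Eventually.of_forall fun g => ?_)
  simp only [representingMeasure_measureFunctional]

/-- Although f is merely measurable, integration over `G` smooths it: moving the rotation onto φ
reduces to continuity of translation in L¹. -/
lemma continuous_integral_smul_mul [μ.IsHaarMeasure] (hf : Measurable f) (hR : ∀ ζ, |f ζ| ≤ R)
    {φ : G → ℝ} (hφ : Integrable φ μ) : Continuous fun ζ : Circle => ∫ g, f (g • ζ) * φ g ∂μ := by
  have h1 := (continuous_integral_mul_rotation (μ := μ) (F := fun g => f (g • (1 : Circle))) (R := R)
    (hf.comp (continuous_id.smul continuous_const).measurable) (fun g => hR _) hφ).comp continuous_inv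
  refine h1.congr fun ζ => ?_
  rw [Function.comp_apply, ← (measurePreserving_mul_rotation μ ζ).integral_comp
    (Homeomorph.mulRight (rotation ζ)).measurableEmbedding]
  simp [mul_smul, rotation_smul_circle, mul_assoc]

/-- By Fubini each pairing is evaluation of ξ at one fixed continuous function; weak* continuity and
affinity follow from this. -/
lemma pairingWith_boundaryAverage [μ.IsHaarMeasure] (hf : Measurable f) (hR : ∀ ζ, |f ζ| ≤ R)
    (φ : Lp ℝ 1 μ) {ξ : WeakDual ℝ C(Circle, ℝ)} (hξ : ξ ∈ probCircle) :
    LInf.pairingWith φ (boundaryAverage μ hf hR ξ) =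
      ξ ⟨_, continuous_integral_smul_mul hf hR (L1.integrable_coeFn φ)⟩ := by
  obtain ⟨ν, hν, rfl⟩ := exists_of_mem_probCircle hξ
  rw [LInf.pairingWith_apply, measureFunctional_apply]
  have h1 : ∫ g, (boundaryAverage μ hf hR (measureFunctional ν)).fn g * φ g ∂μ =
      ∫ g, ∫ ζ, f (g • ζ) * φ g ∂ν ∂μ := by
    refine integral_congr_ae ?_
    filter_upwards [fn_boundaryAverage hf hR ν] with g hg
    rw [hg, integral_mul_const]
  rw [h1, integral_integral_swap]
  · rfl
  have hφ : Integrable (fun p : G × Circle => φ p.1) (μ.prod ν) :=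
    (L1.integrable_coeFn φ).comp_fst ν
  exact hφ.bdd_mul (hf.comp continuous_smul_circle.measurable).aestronglyMeasurable
    (Filter.Eventually.of_forall fun p => hR _)

lemma isAffineHom_boundaryAverage [μ.IsHaarMeasure] (hf : Measurable f) (hR : ∀ ζ, |f ζ| ≤ R) :
    IsAffineHom pushCircle probCircle LInf.translate Set.univ (boundaryAverage μ hf hR) where
  mapsTo _ _ := trivial
  continuousOn := LInf.continuousOn_of_pairing fun φ =>
    (WeakDual.eval_continuous _).continuousOn.congr fun _ hξ =>
      pairingWith_boundaryAverage hf hR φ hξ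
  equivariant g ξ hξ := by
    obtain ⟨ν, hν, rfl⟩ := exists_of_mem_probCircle hξ
    have hν' : IsProbabilityMeasure (ν.map fun ζ => g • ζ) :=
      Measure.isProbabilityMeasure_map (measurable_smul_circle g).aemeasurable
    rw [pushCircle_measureFunctional]
    apply LInf.ext_fn
    refine (fn_boundaryAverage hf hR _).trans (Filter.EventuallyEq.symm ((LInf.fn_translate g _).trans
      (((quasiMeasurePreserving_mul_right μ g).ae_eq_comp (fn_boundaryAverage hf hR ν)).trans ?_)))
    refine Filter.Eventually.of_forall fun g' => ?_
    simp only [Function.comp_apply]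
    rw [integral_map (f := fun ζ => f (g' • ζ)) (measurable_smul_circle g).aemeasurable
      (hf.comp (measurable_smul_circle g')).aestronglyMeasurable]
    simp only [mul_smul]
  affine ξ hξ ξ' hξ' s t hs ht hst := by
    refine LInf.ext_pairing fun φ => ?_
    rw [map_add, map_smul, map_smul, pairingWith_boundaryAverage hf hR φ hξ,
      pairingWith_boundaryAverage hf hR φ hξ',
      pairingWith_boundaryAverage hf hR φ (convex_probCircle hξ hξ' hs ht hst)]
    rfl

end BoundaryAverage

variable [μ.IsHaarMeasure]

/-- The lift of a bounded harmonic function is the image of the rotation invariant measure under an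
affine homomorphism. -/
theorem exists_affineHom_harmonicLift (h : BoundedHarmonic) :
    ∃ Φ, IsAffineHom pushCircle probCircle LInf.translate Set.univ Φ ∧
      Φ circleFunctional = harmonicLift μ h := by
  obtain ⟨f, R, hf, hR, hfh⟩ := h.2.exists_boundary
  refine ⟨_, isAffineHom_boundaryAverage (μ := μ) hf hR, LInf.ext_fn ?_⟩
  refine (fn_boundaryAverage hf hR circleMeasure).trans ((LInf.fn_mk (h.2.memLp_lift μ)).trans ?_).symm
  exact Filter.Eventually.of_forall hfh

lemma IsAffineHom.hullSystem_eq_image {h : BoundedHarmonic} {Φ : WeakDual ℝ C(Circle, ℝ) → LInf μ}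
    {P : Set (LInf μ)}
    (hΦ : IsAffineHom pushCircle probCircle LInf.translate P Φ)
    (hh : Φ circleFunctional = harmonicLift μ h) : hullSystem μ h = Φ '' probCircle := by
  apply subset_antisymm
  · refine closedConvexHull_min ?_ ?_
      (isCompact_probCircle.image_of_continuousOn hΦ.continuousOn).isClosed
    · rintro _ ⟨g, rfl⟩
      simp only
      rw [← hh, ← hΦ.equivariant g _ circleFunctional_mem]
      exact ⟨_, pushCircle_mem g circleFunctional_mem, rfl⟩
    · rintro _ ⟨ξ, hξ, rfl⟩ _ ⟨ξ', hξ', rfl⟩ s t hs ht hst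
      exact ⟨_, convex_probCircle hξ hξ' hs ht hst, hΦ.affine ξ hξ ξ' hξ' s t hs ht hst⟩
  -- Invariance of Q_h is not available here. Intersecting the preimages over all translates gives a
  -- set that is invariant by construction and contains m.
  · have hcl : ∀ g, IsClosed (probCircle ∩ (fun ξ => Φ (pushCircle g ξ)) ⁻¹' hullSystem μ h) :=
      fun g => (hΦ.continuousOn.comp (continuous_pushCircle g).continuousOn
        fun ξ hξ => pushCircle_mem g hξ).preimage_isClosed_of_isClosed isCompact_probCircle.isClosed
        isClosed_closedConvexHull
    have hsub := probCircle_subset_of_invariant (isClosed_iInter hcl) (convex_iInter fun g => ?_)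
      ?_ ?_
    · rintro _ ⟨ξ, hξ, rfl⟩
      have := (Set.mem_iInter.1 (hsub hξ) 1).2
      rwa [Set.mem_preimage, pushCircle_one] at this
    · rintro ξ ⟨hξ, hξe⟩ ξ' ⟨hξ', hξe'⟩ s t hs ht hst
      refine ⟨convex_probCircle hξ hξ' hs ht hst, ?_⟩
      rw [Set.mem_preimage, pushCircle_affine, hΦ.affine _ (pushCircle_mem g hξ) _
        (pushCircle_mem g hξ') s t hs ht hst]
      exact convex_closedConvexHull hξe hξe' hs ht hst
    · intro g ξ hξ
      refine Set.mem_iInter.2 fun g' => ?_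
      have h1 := Set.mem_iInter.1 hξ (g' * g)
      refine ⟨pushCircle_mem g h1.1, ?_⟩
      rw [Set.mem_preimage, ← pushCircle_mul]
      exact h1.2
    · refine Set.mem_iInter.2 fun g => ⟨circleFunctional_mem, ?_⟩
      rw [Set.mem_preimage, hΦ.equivariant g _ circleFunctional_mem, hh]
      exact subset_closedConvexHull ⟨g, rfl⟩

/-! ### Injectivity of the lift -/

lemma exists_smul_zero (z : 𝔻) : ∃ g : G, g • (0 : 𝔻) = z := ⟨boost z, boost_smul_zero z⟩

lemma eq_of_lift_ae_eq {h h' : 𝔻 → ℝ} (hh : Continuous h) (hh' : Continuous h')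
    (H : (fun g : G => h (g • (0 : 𝔻))) =ᵐ[μ] fun g : G => h' (g • (0 : 𝔻))) : h = h' := by
  have := Continuous.ae_eq_iff_eq μ (hh.comp continuous_orbit_zero) (hh'.comp continuous_orbit_zero)
  ext z
  obtain ⟨g, rfl⟩ := exists_smul_zero z
  exact congrFun (this.1 H) g

lemma harmonicLift_injective : Function.Injective (harmonicLift μ) := fun h h' H =>
  Subtype.ext (eq_of_lift_ae_eq h.2.continuous h'.2.continuous
    ((LInf.fn_mk (h.2.memLp_lift μ)).symm.trans
      ((congrArg LInf.fn H).eventuallyEq.trans (LInf.fn_mk (h'.2.memLp_lift μ)))))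

lemma eq_const_of_translate_harmonicLift {h : BoundedHarmonic}
    (hfix : ∀ g, LInf.translate g (harmonicLift μ h) = harmonicLift μ h) : ∃ c : ℝ, ∀ z, h.1 z = c := by
  refine ⟨h.1 0, fun z => ?_⟩
  obtain ⟨g, rfl⟩ := exists_smul_zero z
  have h1 : (fun g' : G => h.1 ((g' * g) • (0 : 𝔻))) =ᵐ[μ] fun g' : G => h.1 (g' • (0 : 𝔻)) := by
    refine Filter.EventuallyEq.trans ?_
      ((congrArg LInf.fn (hfix g)).eventuallyEq.trans (LInf.fn_mk (h.2.memLp_lift μ)))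
    exact (((LInf.fn_translate g _).trans ((quasiMeasurePreserving_mul_right μ g).ae_eq_comp
      (LInf.fn_mk (h.2.memLp_lift μ)))).symm)
  have hc := h.2.continuous.comp continuous_orbit_zero
  have := congrFun ((Continuous.ae_eq_iff_eq μ (hc.comp (continuous_mul_const g)) hc).1 h1) 1
  simpa using this

/-! ### The properties of `Q_h` -/

section

variable {h : BoundedHarmonic}

lemma hullSystem_nontrivial (hc : ¬ ∃ c : ℝ, ∀ z, h.1 z = c) : (hullSystem μ h).Nontrivial := by
  by_contra hn
  rw [Set.not_nontrivial_iff] at hn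
  apply hc
  obtain ⟨Φ, hΦ, hh⟩ := exists_affineHom_harmonicLift (μ := μ) h
  have hsub := hΦ.hullSystem_eq_image hh
  refine eq_const_of_translate_harmonicLift (μ := μ) fun g => ?_
  rw [hsub] at hn
  rw [← hh, ← hΦ.equivariant g _ circleFunctional_mem]
  exact hn ⟨_, pushCircle_mem g circleFunctional_mem, rfl⟩ ⟨_, circleFunctional_mem, rfl⟩

lemma exists_affineHom_hullSystem (hc : ¬ ∃ c : ℝ, ∀ z, h.1 z = c) :
    ∃ Φ, IsAffineHom pushCircle probCircle LInf.translate (hullSystem μ h) Φ ∧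
      Φ '' probCircle = hullSystem μ h ∧ Set.InjOn Φ probCircle ∧
      Φ circleFunctional = harmonicLift μ h := by
  obtain ⟨Φ, hΦ, hh⟩ := exists_affineHom_harmonicLift (μ := μ) h
  have hsub := hΦ.hullSystem_eq_image hh
  refine ⟨Φ, ⟨?_, hΦ.continuousOn, hΦ.equivariant, hΦ.affine⟩, hsub.symm, hΦ.injOn ?_, hh⟩
  · rw [hsub]
    exact Set.mapsTo_image _ _
  · rw [← hsub]
    exact hullSystem_nontrivial hc

lemma isIrreducible_hullSystem (hc : ¬ ∃ c : ℝ, ∀ z, h.1 z = c) :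
    IsIrreducibleAffineSystem LInf.translate (hullSystem μ h) := by
  obtain ⟨Φ, hΦ, hsub, hinj, -⟩ := exists_affineHom_hullSystem (μ := μ) hc
  rw [← hsub] at hΦ ⊢
  exact hΦ.isIrreducible_image hinj

lemma affinelyIsomorphic_hullSystem (hc : ¬ ∃ c : ℝ, ∀ z, h.1 z = c) :
    AffinelyIsomorphic pushCircle probCircle LInf.translate (hullSystem μ h) := by
  obtain ⟨Φ, hΦ, hsub, hinj, -⟩ := exists_affineHom_hullSystem (μ := μ) hc
  exact hΦ.affinelyIsomorphic hinj hsub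

lemma rotation_fixed_hullSystem_iff (hc : ¬ ∃ c : ℝ, ∀ z, h.1 z = c) (F : LInf μ) :
    (F ∈ hullSystem μ h ∧ ∀ k ∈ K, LInf.translate k F = F) ↔ F = harmonicLift μ h := by
  obtain ⟨Φ, hΦ, hsub, hinj, hh⟩ := exists_affineHom_hullSystem (μ := μ) hc
  constructor
  · rintro ⟨hF, hfix⟩
    rw [← hh]
    exact (hΦ.eq_of_rotation_fixed (isIrreducible_hullSystem hc) hF
      fun ζ => hfix _ ((mem_K_iff _).2 ⟨ζ, rfl⟩)).symm
  · rintro rfl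
    refine ⟨by rw [← hsub, ← hh]; exact ⟨_, circleFunctional_mem, rfl⟩, fun k hk => ?_⟩
    obtain ⟨ζ, rfl⟩ := (mem_K_iff _).1 hk
    rw [← hh]
    exact hΦ.rotation_fixed ζ

/-- Q_h determines the lift as its only K-fixed point, and the lift determines h. -/
lemma injOn_hullSystem :
    Set.InjOn (hullSystem μ) {h : BoundedHarmonic | ¬ ∃ c : ℝ, ∀ z, h.1 z = c} := by
  intro h hc h' hc' H
  apply harmonicLift_injective (μ := μ)
  rw [← rotation_fixed_hullSystem_iff hc', ← H, rotation_fixed_hullSystem_iff hc]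

end

/-! ### A rotation invariant weight with compact support -/

/-- Since |g0| = |c|/|a|, the bound gives |c| ≤ |a|/2; with |a|² - |c|² = 1 all matrix entries are
bounded. -/
lemma isCompact_norm_smul_zero_le : IsCompact {g : G | ‖((g • (0 : 𝔻) : 𝔻) : ℂ)‖ ≤ 1 / 2} := by
  have h1 : IsCompact ((fun A : SU11 => A.1.1) ⁻¹'
      (Metric.closedBall 0 2 : Set (Fin 2 → Fin 2 → ℂ))) :=
    SU11.isClosedEmbedding.isCompact_preimage (isCompact_closedBall _ _)
  have h2 : Continuous fun g : G => ‖((g • (0 : 𝔻) : 𝔻) : ℂ)‖ :=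
    (UnitDisc.continuous_coe.comp continuous_orbit_zero).norm
  refine (h1.image continuous_quotient_mk').of_isClosed_subset (isClosed_le h2 continuous_const) ?_
  intro g hg
  obtain ⟨A, rfl⟩ := QuotientGroup.mk_surjective g
  refine ⟨A, ?_, rfl⟩
  change ‖((A • (0 : 𝔻) : 𝔻) : ℂ)‖ ≤ 1 / 2 at hg
  rw [SU11.coe_smul_disc] at hg
  simp only [UnitDisc.coe_zero, mul_zero, zero_add, norm_div, RCLike.norm_conj] at hg
  have hn := A.normSq_eq
  rw [normSq_eq_norm_sq, normSq_eq_norm_sq] at hn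
  have ha : 0 < ‖A.a‖ := by
    by_contra! h
    have : ‖A.a‖ = 0 := le_antisymm h (norm_nonneg _)
    nlinarith [norm_nonneg A.c]
  rw [div_le_iff₀ ha] at hg
  have ha2 : ‖A.a‖ ≤ 2 := by nlinarith [norm_nonneg A.c]
  have hc2 : ‖A.c‖ ≤ 2 := by linarith
  refine mem_closedBall_zero_iff.2 ((pi_norm_le_iff_of_nonneg zero_le_two).2 fun i => ?_)
  rw [pi_norm_le_iff_of_nonneg zero_le_two]
  intro j
  fin_cases i <;> fin_cases j
  · exact ha2
  · change ‖A.1.1 0 1‖ ≤ 2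
    rwa [SU11.entry01, RCLike.norm_conj]
  · exact hc2
  · change ‖A.1.1 1 1‖ ≤ 2
    rwa [SU11.entry11, RCLike.norm_conj]

variable {μ : Measure G}

lemma LInf.exists_representative (x : LInf μ) : ∃ (F : G → ℝ) (R : ℝ), Measurable F ∧
    (∀ g, |F g| ≤ R) ∧ x.fn =ᵐ[μ] F := by
  have hx := x.memLp_fn
  obtain ⟨R, hR⟩ : ∃ R, ∀ᵐ g ∂μ, |x.fn g| ≤ R := by
    refine ⟨(eLpNormEssSup x.fn μ).toReal, ?_⟩
    have hfin : eLpNormEssSup x.fn μ ≠ ∞ := by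
      rw [← eLpNorm_exponent_top]
      exact hx.2.ne
    filter_upwards [enorm_ae_le_eLpNormEssSup x.fn μ] with g hg
    simpa using ENNReal.toReal_mono hfin hg
  have hR0 : 0 ≤ |R| := abs_nonneg R
  refine ⟨fun g => max (-|R|) (min |R| (hx.1.mk x.fn g)), |R|,
    measurable_const.max (measurable_const.min hx.1.stronglyMeasurable_mk.measurable),
    fun g => abs_le.2 ⟨le_max_left _ _, max_le (by linarith) (min_le_left _ _)⟩, ?_⟩
  filter_upwards [hR, hx.1.ae_eq_mk] with g h1 h2
  rw [← h2]
  have h3 := abs_le.1 (h1.trans (le_abs_self R))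
  rw [min_eq_right h3.2, max_eq_right h3.1]

lemma abs_average_le {w : G → ℝ} (hw : Integrable w μ) (hw0 : ∀ g, 0 ≤ w g)
    (hw1 : ∫ g, w g ∂μ = 1) {F : G → ℝ} {R : ℝ} (hR : ∀ g, |F g| ≤ R) (y : G) :
    |∫ g, F (y * g) * w g ∂μ| ≤ R := by
  calc |∫ g, F (y * g) * w g ∂μ| ≤ ∫ g, R * w g ∂μ := by
        rw [← Real.norm_eq_abs]
        refine norm_integral_le_of_norm_le (hw.const_mul R) (Filter.Eventually.of_forall fun g => ?_)
        rw [norm_mul, Real.norm_of_nonneg (hw0 g)]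
        exact mul_le_mul_of_nonneg_right (hR _) (hw0 g)
    _ = R := by rw [integral_const_mul, hw1, mul_one]

variable [μ.IsHaarMeasure]

variable (μ) in
-- The weight depends on |g0| only, whence its invariance under left multiplication by rotations.
lemma exists_weight : ∃ w : G → ℝ, Continuous w ∧ HasCompactSupport w ∧ (∀ g, 0 ≤ w g) ∧
    (∀ ζ g, w (rotation ζ * g) = w g) ∧ ∫ g, w g ∂μ = 1 := by
  let w : G → ℝ := fun g => max 0 (1 / 2 - ‖((g • (0 : 𝔻) : 𝔻) : ℂ)‖)
  have hc : Continuous w :=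
    continuous_const.max (continuous_const.sub (UnitDisc.continuous_coe.comp continuous_orbit_zero).norm)
  have hs : HasCompactSupport w := HasCompactSupport.intro isCompact_norm_smul_zero_le fun g hg => by
    simp only [Set.mem_ofPred_eq, not_le] at hg
    exact max_eq_left (by linarith)
  have h0 : ∀ g, 0 ≤ w g := fun g => le_max_left _ _
  have hpos : 0 < ∫ g, w g ∂μ :=
    hc.integral_pos_of_hasCompactSupport_nonneg_nonzero hs h0 (x := 1) (by simp [w])
  refine ⟨fun g => (∫ g, w g ∂μ)⁻¹ * w g, continuous_const.mul hc, hs.mul_left,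
    fun g => mul_nonneg (inv_nonneg.2 hpos.le) (h0 g), fun ζ g => ?_, ?_⟩
  · simp only [w, mul_smul, coe_rotation_smul_disc, norm_mul, Circle.norm_coe, one_mul]
  · rw [integral_const_mul]
    exact inv_mul_cancel₀ (ne_of_gt hpos)

/-! ### Averaging bounded functions -/

lemma continuous_average {w : G → ℝ} (hw : Continuous w) (hws : HasCompactSupport w)
    {F : G → ℝ} {R : ℝ} (hF : Measurable F) (hR : ∀ g, |F g| ≤ R) :
    Continuous fun y => ∫ g, F (y * g) * w g ∂μ := by
  -- Left invariance of μ moves y from the merely measurable F to the continuous w.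
  have h1 : ∀ y, ∫ g, F (y * g) * w g ∂μ = ∫ g, F g * w (y⁻¹ * g) ∂μ := fun y => by
    rw [← integral_mul_left_eq_self (fun g => F g * w (y⁻¹ * g)) y]
    simp
  simp only [h1]
  rw [continuous_iff_continuousAt]
  intro y₀
  obtain ⟨C, hC, hCy⟩ := exists_compact_mem_nhds y₀
  have hk : IsCompact ((fun p : G × G => p.1 * p.2) '' (C ×ˢ tsupport w)) :=
    (hC.prod hws).image continuous_mul
  refine ContinuousOn.continuousAt (s := C) ?_ hCy
  refine continuousOn_integral_bilinear_of_locally_integrable_of_compact_support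
    (μ := μ) (ContinuousLinearMap.mul ℝ ℝ) (f := fun (y : G) g => w (y⁻¹ * g)) (g := F) hk ?_ ?_ ?_
  · exact (hw.comp (continuous_fst.inv.mul continuous_snd)).continuousOn
  · intro y g hy hg
    by_contra hne
    exact hg ⟨(y, y⁻¹ * g), ⟨hy, subset_tsupport _ hne⟩, by simp⟩
  · have : IsFiniteMeasure (μ.restrict ((fun p : G × G => p.1 * p.2) '' (C ×ˢ tsupport w))) :=
      ⟨by simpa using hk.measure_lt_top⟩
    exact Integrable.of_bound hF.aestronglyMeasurable R (Filter.Eventually.of_forall hR)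

/-- The mean value property for rotation invariant weights. -/
lemma IsBoundedHarmonic.integral_weight {u : 𝔻 → ℝ} (hu : IsBoundedHarmonic u) {w : G → ℝ}
    (hw : Integrable w μ) (hwr : ∀ ζ g, w (rotation ζ * g) = w g) (hw1 : ∫ g, w g ∂μ = 1) (g : G) :
    ∫ g', w g' * u ((g * g') • (0 : 𝔻)) ∂μ = u (g • (0 : 𝔻)) := by
  obtain ⟨R, hR⟩ := hu.bounded
  -- An extra rotation can be inserted because μ and w are left invariant; averaging over it brings
  -- in the mean value property on hyperbolic circles.
  have h1 : ∀ ζ : Circle, ∫ g', w g' * u ((g * g') • (0 : 𝔻)) ∂μ =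
      ∫ g', w g' * u (g • rotation ζ • g' • (0 : 𝔻)) ∂μ := fun ζ => by
    rw [← integral_mul_left_eq_self _ (rotation ζ)]
    simp only [hwr, mul_smul]
  have h2 : ∫ ζ, ∫ g', w g' * u (g • rotation ζ • g' • (0 : 𝔻)) ∂μ ∂circleMeasure =
      ∫ g', w g' * u ((g * g') • (0 : 𝔻)) ∂μ := by
    simp only [← h1]
    simp
  rw [← h2, integral_integral_swap]
  · simp only [integral_const_mul, hu.integral_rotation]
    rw [integral_mul_const, hw1, one_mul]
  have hc : Continuous fun p : Circle × G => u (g • rotation p.1 • p.2 • (0 : 𝔻)) := by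
    have := hu.continuous.comp (continuous_orbit_zero.comp (continuous_const.mul
      ((continuous_rotation.comp continuous_fst).mul continuous_snd) :
      Continuous fun p : Circle × G => g * (rotation p.1 * p.2)))
    refine this.congr fun p => ?_
    change u ((g * (rotation p.1 * p.2)) • (0 : 𝔻)) = _
    rw [mul_smul, mul_smul]
  exact (hw.comp_snd circleMeasure).mul_bdd hc.aestronglyMeasurable
    (Filter.Eventually.of_forall fun _ => hR _)

/-! ### Recognizing lifts of bounded harmonic functions -/

lemma eq_of_integral_mul_eq {X Y : G → ℝ} {R : ℝ} (hX : Continuous X) (hY : Continuous Y)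
    (hXR : ∀ g, |X g| ≤ R) (hYR : ∀ g, |Y g| ≤ R)
    (h : ∀ φ : Lp ℝ 1 μ, ∫ g, X g * φ g ∂μ = ∫ g, Y g * φ g ∂μ) : X = Y := by
  have hXm : MemLp X ∞ μ :=
    memLp_top_of_bound hX.aestronglyMeasurable R (Filter.Eventually.of_forall hXR)
  have hYm : MemLp Y ∞ μ :=
    memLp_top_of_bound hY.aestronglyMeasurable R (Filter.Eventually.of_forall hYR)
  have h1 : LInf.mk X hXm = LInf.mk Y hYm := LInf.ext_pairing fun φ => by
    rw [LInf.pairingWith_apply, LInf.pairingWith_apply]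
    refine (integral_congr_ae ?_).trans ((h φ).trans (integral_congr_ae ?_))
    · filter_upwards [LInf.fn_mk hXm] with g hg
      rw [hg]
    · filter_upwards [LInf.fn_mk hYm] with g hg
      rw [hg]
  exact (Continuous.ae_eq_iff_eq μ hX hY).1
    ((LInf.fn_mk hXm).symm.trans ((congrArg LInf.fn h1).eventuallyEq.trans (LInf.fn_mk hYm)))

/-- A bounded function on the disc that satisfies the Poisson formula for dilates is harmonic. -/
lemma isBoundedHarmonic_of_poisson {H : 𝔻 → ℝ} {R : ℝ} (hR : ∀ z, |H z| ≤ R)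
    (hc : ∀ r : 𝔻, Continuous fun ζ : Circle => H (ζ • r))
    (hP : ∀ z r : 𝔻, ∫ ζ : Circle, poissonKernel 0 z ζ * H (ζ • r) ∂circleMeasure = H (z * r)) :
    IsBoundedHarmonic H where
  bounded := ⟨R, hR⟩
  harmonic := by
    classical
    refine ⟨fun z => if hz : ‖z‖ < 1 then H (UnitDisc.mk z hz) else 0, fun z₀ hz₀ => ?_,
      fun z => ?_⟩
    · rw [mem_ball_zero_iff] at hz₀
      obtain ⟨r, hr, hr1⟩ := exists_between hz₀
      have hr0 : 0 < r := (norm_nonneg _).trans_lt hr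
      have hrn : ‖(r : ℂ)‖ < 1 := by rwa [norm_real, Real.norm_of_nonneg hr0.le]
      have hr' : (r : ℂ) ≠ 0 := by exact_mod_cast hr0.ne'
      have hdiv : ∀ z : ℂ, ‖z‖ < r → ‖z / r‖ < 1 := fun z hz => by
        rw [norm_div, norm_real, Real.norm_of_nonneg hr0.le]
        exact (div_lt_one hr0).2 hz
      -- On |z| < r, `hP` exhibits H(z) as the Poisson integral of ζ ↦ H(ζr) at z/r.
      obtain ⟨A, hA, hAre⟩ := (isBoundedHarmonic_poisson (hc (UnitDisc.mk r hrn))).exists_analytic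
      have hd : DifferentiableOn ℂ (fun z => A (z / r)) (Metric.ball 0 r) :=
        hA.comp (by fun_prop) fun z hz => by simpa using hdiv z (by simpa using hz)
      have han := (hd.analyticAt (Metric.isOpen_ball.mem_nhds (by simpa using hr))).harmonicAt_re
      refine (InnerProductSpace.harmonicAt_congr_nhds ?_).1 han
      filter_upwards [Metric.isOpen_ball.mem_nhds
        (show z₀ ∈ Metric.ball (0 : ℂ) r by simpa using hr)] with z hz
      rw [mem_ball_zero_iff] at hz
      rw [dif_pos (hz.trans hr1)]
      have h1 := hAre (UnitDisc.mk (z / r) (hdiv z hz))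
      rw [hP] at h1
      rw [UnitDisc.coe_mk] at h1
      rw [h1]
      congr 1
      apply UnitDisc.coe_injective
      simp [hr']
    · simp only [dif_pos z.norm_lt_one]
      rfl

/-- A bounded continuous function on `G` whose translates pair with integrable functions in a
harmonic way is the lift of a bounded harmonic function. -/
lemma exists_lift_of_continuous {X : G → ℝ} {R : ℝ} (hX : Continuous X) (hR : ∀ g, |X g| ≤ R)
    (hu : ∀ φ : Lp ℝ 1 μ, ∃ u : 𝔻 → ℝ, IsBoundedHarmonic u ∧
      ∀ g, ∫ y, X (y * g) * φ y ∂μ = u (g • (0 : 𝔻))) :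
    ∃ H : 𝔻 → ℝ, IsBoundedHarmonic H ∧ ∀ g, X g = H (g • (0 : 𝔻)) := by
  have hXc : ∀ g, Continuous fun y => X (y * g) := fun g => hX.comp (continuous_mul_const g)
  -- All pairings of y ↦ X(yg) depend on g only through g0, so the continuous function itself does;
  -- then y = 1.
  have h0 : ∀ g g' : G, g • (0 : 𝔻) = g' • (0 : 𝔻) → X g = X g' := by
    intro g g' h
    have := congrFun (eq_of_integral_mul_eq (μ := μ) (hXc g) (hXc g') (fun y => hR _) (fun y => hR _)
      fun φ => by
        obtain ⟨u, -, hφ⟩ := hu φ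
        rw [hφ, hφ, h]) 1
    simpa using this
  have hH : ∀ g, X g = X (boost (g • (0 : 𝔻))) := fun g => h0 _ _ (by simp)
  have hrot : ∀ (r : 𝔻) (ζ : Circle), X (boost (ζ • r)) = X (rotation ζ * boost r) := fun r ζ =>
    h0 _ _ (by rw [boost_smul_zero, mul_smul, boost_smul_zero, rotation_smul_disc])
  refine ⟨fun z => X (boost z), isBoundedHarmonic_of_poisson (fun z => hR _) (fun r => ?_)
    fun z r => ?_, hH⟩
  · simp only [hrot]
    exact hX.comp (continuous_rotation.mul continuous_const)
  · simp only [hrot]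
    have hz := z.norm_lt_one
    have hp := continuous_poissonKernel_circle hz
    have hcont : Continuous fun p : G × Circle =>
        poissonKernel 0 z p.2 * X (p.1 * (rotation p.2 * boost r)) :=
      (hp.comp continuous_snd).mul (hX.comp (continuous_fst.mul
        ((continuous_rotation.comp continuous_snd).mul continuous_const)))
    -- The Poisson formula for X is proved for all its translates in y at once. Paired with φ it
    -- becomes the formula for the harmonic function u; continuity then allows y = 1.
    have key := eq_of_integral_mul_eq (μ := μ) (R := R)
      (X := fun y => ∫ ζ : Circle, poissonKernel 0 z ζ * X (y * (rotation ζ * boost r)) ∂circleMeasure)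
      (Y := fun y => X (y * boost (z * r))) ?_ (hXc _) ?_ (fun y => hR _) ?_
    · simpa using congrFun key 1
    · have := continuous_parametric_integral_of_continuous (μ := circleMeasure)
        (f := fun y ζ => poissonKernel 0 z ζ * X (y * (rotation ζ * boost r))) hcont isCompact_univ
      simpa using this
    · intro y
      calc |∫ ζ : Circle, poissonKernel 0 z ζ * X (y * (rotation ζ * boost r)) ∂circleMeasure|
          ≤ ∫ ζ : Circle, poissonKernel 0 z ζ * R ∂circleMeasure := by
            rw [← Real.norm_eq_abs]
            refine norm_integral_le_of_norm_le (g := fun ζ : Circle => poissonKernel 0 z ζ * R)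
              (continuous_integrable (hp.mul continuous_const) circleMeasure)
              (Filter.Eventually.of_forall fun ζ => ?_)
            rw [norm_mul, Real.norm_of_nonneg (poissonKernel_circle_nonneg hz ζ)]
            exact mul_le_mul_of_nonneg_left (hR _) (poissonKernel_circle_nonneg hz ζ)
        _ = R := by rw [integral_mul_const, integral_poissonKernel hz, one_mul]
    · intro φ
      obtain ⟨u, hu, hφ⟩ := hu φ
      rw [hφ, boost_smul_zero, ← hu.poisson]
      simp only [← integral_mul_const]
      rw [integral_integral_swap]
      · refine integral_congr_ae (Filter.Eventually.of_forall fun ζ => ?_)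
        simp only [mul_assoc]
        rw [integral_const_mul]
        congr 1
        have h1 := hφ (rotation ζ * boost r)
        rw [mul_smul, boost_smul_zero, rotation_smul_disc] at h1
        exact h1
      · obtain ⟨C, hC⟩ := (isCompact_range hp).exists_bound_of_continuousOn continuousOn_id
        have hφi : Integrable (fun p : G × Circle => φ p.1) (μ.prod circleMeasure) :=
          (L1.integrable_coeFn φ).comp_fst circleMeasure
        refine hφi.bdd_mul (c := C * R) hcont.aestronglyMeasurable
          (Filter.Eventually.of_forall fun p => ?_)
        rw [norm_mul]
        exact mul_le_mul (hC _ ⟨p.2, rfl⟩) (hR _) (norm_nonneg _)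
          ((norm_nonneg _).trans (hC _ ⟨p.2, rfl⟩))

/-- An element of L^∞(G) has no point values, so it is first averaged on the right against the
weight w. The average is continuous and, by `hXu`, has the same pairings as x, so it represents x.
-/
theorem exists_eq_harmonicLift {x : LInf μ}
    (hu : ∀ φ : Lp ℝ 1 μ, ∃ u : 𝔻 → ℝ, IsBoundedHarmonic u ∧
      ∀ g, LInf.pairingWith φ (LInf.translate g x) = u (g • (0 : 𝔻))) :
    ∃ h : BoundedHarmonic, harmonicLift μ h = x := by
  obtain ⟨F, R, hF, hR, hFx⟩ := x.exists_representative
  have hFu : ∀ φ : Lp ℝ 1 μ, ∃ u : 𝔻 → ℝ, IsBoundedHarmonic u ∧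
      ∀ g, ∫ y, F (y * g) * φ y ∂μ = u (g • (0 : 𝔻)) := fun φ => by
    obtain ⟨u, hu, h⟩ := hu φ
    refine ⟨u, hu, fun g => ?_⟩
    rw [← h, LInf.pairingWith_apply]
    refine integral_congr_ae ?_
    filter_upwards [LInf.fn_translate g x,
      (quasiMeasurePreserving_mul_right μ g).ae_eq_comp hFx] with y h1 h2
    rw [h1]
    exact congrArg (· * φ y) h2.symm
  obtain ⟨w, hw, hws, hw0, hwr, hw1⟩ := exists_weight μ
  have hwi : Integrable w μ := hw.integrable_of_hasCompactSupport hws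
  -- After Fubini, averaging F amounts to averaging u against w, which leaves u unchanged by the
  -- mean value property.
  have hXu : ∀ (φ : Lp ℝ 1 μ) (u : 𝔻 → ℝ), IsBoundedHarmonic u →
      (∀ g, ∫ y, F (y * g) * φ y ∂μ = u (g • (0 : 𝔻))) →
      ∀ g, ∫ y, (∫ g', F (y * g * g') * w g' ∂μ) * φ y ∂μ = u (g • (0 : 𝔻)) := by
    intro φ u hu h g
    simp only [← integral_mul_const]
    rw [integral_integral_swap]
    · rw [← hu.integral_weight hwi hwr hw1 g]
      refine integral_congr_ae (Filter.Eventually.of_forall fun g' => ?_)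
      simp only
      rw [← h, ← integral_const_mul]
      refine integral_congr_ae (Filter.Eventually.of_forall fun y => ?_)
      simp only [mul_assoc]
      ring
    · have h1 : Integrable (fun p : G × G => φ p.1 * w p.2) (μ.prod μ) :=
        (L1.integrable_coeFn φ).mul_prod hwi
      have h2 : Integrable (fun p : G × G => F (p.1 * g * p.2) * (φ p.1 * w p.2)) (μ.prod μ) :=
        h1.bdd_mul (hF.comp (by fun_prop)).aestronglyMeasurable
          (Filter.Eventually.of_forall fun _ => hR _)
      refine h2.congr (Filter.Eventually.of_forall fun p => ?_)
      simp only [Function.uncurry]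
      ring
  have hX := continuous_average (μ := μ) hw hws hF hR
  have hXR := abs_average_le (μ := μ) hwi hw0 hw1 hR
  obtain ⟨H, hH, hXH⟩ := exists_lift_of_continuous hX hXR fun φ => by
    obtain ⟨u, hu, h⟩ := hFu φ
    exact ⟨u, hu, hXu φ u hu h⟩
  refine ⟨⟨H, hH⟩, LInf.ext_pairing fun φ => ?_⟩
  obtain ⟨u, hu, h⟩ := hFu φ
  rw [LInf.pairingWith_apply, LInf.pairingWith_apply]
  have h1 : ∫ g, (harmonicLift μ ⟨H, hH⟩).fn g * φ g ∂μ =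
      ∫ y, (∫ g', F (y * 1 * g') * w g' ∂μ) * φ y ∂μ := by
    refine integral_congr_ae ?_
    filter_upwards [LInf.fn_mk (hH.memLp_lift μ)] with g hg
    rw [mul_one, hXH, ← hg]
    rfl
  have h2 : ∫ g, x.fn g * φ g ∂μ = ∫ y, F (y * 1) * φ y ∂μ := by
    refine integral_congr_ae ?_
    filter_upwards [hFx] with g hg
    rw [mul_one, hg]
  rw [h1, h2, hXu φ u hu h, h]

/-! ### Irreducible subsystems of `L^∞(G)` -/

/-- Equivariance turns the pairing into ∫ ψ(gζ) dm with ψ(ζ) = ⟨φ, Φ(δ_ζ)⟩, the lift of the Poisson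
integral of ψ. -/
lemma IsAffineHom.exists_harmonic {P : Set (LInf μ)} {Φ : WeakDual ℝ C(Circle, ℝ) → LInf μ}
    (hΦ : IsAffineHom pushCircle probCircle LInf.translate P Φ) (φ : Lp ℝ 1 μ) :
    ∃ u : 𝔻 → ℝ, IsBoundedHarmonic u ∧
      ∀ g, LInf.pairingWith φ (LInf.translate g (Φ circleFunctional)) = u (g • (0 : 𝔻)) := by
  let ψ : C(Circle, ℝ) := ⟨fun ζ => LInf.pairingWith φ (Φ (diracFunctional ζ)), by
    simpa [Function.comp_def] using (LInf.pairingWith φ).continuous.comp (hΦ.continuous_dirac 1)⟩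
  refine ⟨_, isBoundedHarmonic_poisson ψ.continuous, fun g => ?_⟩
  rw [← hΦ.equivariant g _ circleFunctional_mem,
    hΦ.apply_eq_integral (LInf.pairingWith φ) (f := ψ) (fun _ => rfl)
      (pushCircle_mem g circleFunctional_mem), pushCircle_apply, ← integral_smul_circle
      ψ.continuous.measurable]
  rfl

theorem IsIrreducibleAffineSystem.exists_eq_hullSystem {Q : Set (LInf μ)}
    (hQ : IsIrreducibleAffineSystem LInf.translate Q) (hn : Q.Nontrivial) :
    ∃ h : BoundedHarmonic, (¬ ∃ c : ℝ, ∀ z, h.1 z = c) ∧ hullSystem μ h = Q := by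
  obtain ⟨Φ, hΦ⟩ := hQ.toIsAffineSystem.exists_affineHom
  obtain ⟨h, hh⟩ := exists_eq_harmonicLift hΦ.exists_harmonic
  have hhull : hullSystem μ h = Q := by
    rw [hΦ.hullSystem_eq_image hh.symm, hΦ.image_eq hQ]
  refine ⟨h, ?_, hhull⟩
  -- The lift of a constant is fixed by all translations, so its hull would be a single point.
  rintro ⟨c, hc⟩
  refine hn.not_subsingleton ?_
  rw [← hhull]
  have hfix : ∀ g, LInf.translate g (harmonicLift μ h) = harmonicLift μ h := fun g => by
    apply LInf.ext_fn
    have h1 := LInf.fn_mk (h.2.memLp_lift μ)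
    refine (LInf.fn_translate g _).trans
      (((quasiMeasurePreserving_mul_right μ g).ae_eq_comp h1).trans
        (Filter.EventuallyEq.trans ?_ h1.symm))
    exact Filter.Eventually.of_forall fun g' => by simp [hc]
  have hr : Set.range (fun g : G => LInf.translate g (harmonicLift μ h)) ⊆ {harmonicLift μ h} := by
    rintro _ ⟨g, rfl⟩
    exact hfix g
  exact Set.subsingleton_singleton.anti
    (closedConvexHull_min hr (convex_singleton _) isClosed_singleton)

end MobiusDisc

end

open MobiusDisc
theorem theorem3p1 (μ : MeasureTheory.Measure G) [μ.IsHaarMeasure] :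
    Set.BijOn (hullSystem μ)
      {h : BoundedHarmonic | ¬ ∃ c : ℝ, ∀ z, h.1 z = c}
      {Q : Set (LInf μ) | IsIrreducibleAffineSystem LInf.translate Q ∧ Q.Nontrivial} ∧
    (∀ h : BoundedHarmonic, (¬ ∃ c : ℝ, ∀ z, h.1 z = c) →
      (∀ F : LInf μ, (F ∈ hullSystem μ h ∧ ∀ k ∈ K, LInf.translate k F = F) ↔ F = harmonicLift μ h) ∧
      AffinelyIsomorphic pushCircle probCircle LInf.translate (hullSystem μ h)) ∧
    IsIrreducibleAffineSystem pushCircle probCircle ∧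
    (∀ (E : Type u) [AddCommGroup E] [Module ℝ E] [TopologicalSpace E] [IsTopologicalAddGroup E]
      [ContinuousSMul ℝ E] [LocallyConvexSpace ℝ E] [T2Space E] (σ : G → E → E) (P : Set E),
      IsIrreducibleAffineSystem σ P →
        (∃ Φ, IsAffineHom pushCircle probCircle σ P Φ ∧ Set.SurjOn Φ probCircle P) ∧
        ∀ Φ Φ', IsAffineHom pushCircle probCircle σ P Φ → IsAffineHom pushCircle probCircle σ P Φ' →
          Set.EqOn Φ Φ' probCircle) := by
  refine ⟨⟨fun h hc => ⟨isIrreducible_hullSystem hc, hullSystem_nontrivial hc⟩, injOn_hullSystem,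
    fun Q hQ => ?_⟩, fun h hc => ⟨rotation_fixed_hullSystem_iff hc, affinelyIsomorphic_hullSystem hc⟩,
    isIrreducibleAffineSystem_probCircle, ?_⟩
  · obtain ⟨h, hc, rfl⟩ := hQ.1.exists_eq_hullSystem hQ.2
    exact ⟨h, hc, rfl⟩
  · intro E _ _ _ _ _ _ _ σ P hP
    obtain ⟨Φ, hΦ⟩ := hP.toIsAffineSystem.exists_affineHom
    exact ⟨⟨Φ, hΦ, (hΦ.image_eq hP).ge⟩, fun Φ Φ' hΦ hΦ' => hΦ.eqOn hP hΦ'⟩
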